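/- Let $R$ be a commutative ring with $1$. Graded modules are $\mathbb Z$-graded, tensor products of graded algebras carry the Koszul sign, and differentials have degree $-1$. For dga maps $f,g:A\to B$, a *derivation homotopy* from $f$ to $g$ is a linear map $s:A\to B$ of degree $1$ with $sd_A+d_Bs=f-g$ and $s(ab)=(-1)^{|a|}f(a)s(b)+s(a)g(b)$; if one exists, write $f\simeq g$. A *Hopf algebra up to homotopy (Hah)* over $R$ is a dga $(A,d)$ with an augmentation $\varepsilon:A\to R$ and a dga map $\psi:A\to A\otimes A$ with $(\varepsilon\otimes1)\psi=1=(1\otimes\varepsilon)\psi$, such that $(\psi\otimes 1)\psi\simeq(1\otimes\psi)\psi$ and $T\psi\simeq\psi$, where $T(x\otimes y)=(-1)^{|x||y|}y\otimes x$. A morphism of $\mathbf{HAH}$ is a map $f$ of augmented dga's with $(f\otimes f)\psi_A\simeq\psi_Bf$; it is a *weak equivalence* if it induces an isomorphism on homology. For $r\ge1$ and $n\ge 0$, $\mathbf{HAH}^n_r$ is the full subcategory of the $(r-1)$-connected Hah's with multiplicative generators in degrees $r$ through $n$, i.e. of those $A$ that are, as graded algebras, tensor algebras $T(V)$ on a free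 graded $R$-module $V$ concentrated in degrees $r,\dots,n$. Two objects $A,B$ of $\mathbf{HAH}^n_r$ have the same *homotopy type* if they are related by the equivalence relation generated by: there are $C\in\mathbf{HAH}^n_r$ and weak equivalences $A\leftarrow C\to B$. Let $H$ be a connected graded Hopf algebra over $R$ which is $R$-torsion free in the sense that it is flat as an $R$-module (over a principal ideal domain, e.g. $R\subseteq\mathbb Q$, this is torsion-freeness). A *Hopf resolution* of $H$ is a Hah $(RH,d,\Delta)$, where $RH=T(V)=\bigoplus_{q\ge0}R_qH$ is the tensor algebra on a free bigraded $R$-module $V=\bigoplus_{j\ge 0,\,m\in\mathbb Z}V_{j,m}$ (resolution degree $j$, total degree $j+m$), $d$ has bidegree $(-1,0)$ and $\Delta(R_qH)\subseteq\bigoplus_{i+j=q}R_iH\otimes R_jH$, together with a bigraded algebra map $\rho:RH\to H$ ($H$ in resolution degree $0$) which preserves augmentations and coproducts and induces an isomorphism $H(RH,d)\cong H$. Fix a Hopf resolution. Let $M_H$ be the set of perturbations $(h,\nu)$: $h$ is a derivation of $RH$ of total degree $-1$ with $h(R_qH)\subseteq\bigoplus_{i\le q-2}R_iH$; $\nu:RH\to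 RH\otimes RH$ is linear of total degree $0$ with $\nu(R_qH)\subseteq\bigoplus_{i+j\le q-1}R_iH\otimes R_jH$; and $(RH,d_h,\Delta_\nu)$, with $d_h=d+h$, $\Delta_\nu=\Delta+\nu$ and the augmentation of $RH$, is a Hah. Let $D_H$ be the quotient of $M_H$ by the equivalence relation generated by $(h,\nu)\sim(\bar h,\bar\nu)$ if there is an automorphism $p$ of the graded algebra $RH$ of the form $p=1+p'$, with $p'$ lowering the resolution degree by at least $1$, such that $d_{\bar h}=p^{-1}d_hp$ and $\Delta_{\bar\nu}\simeq(p^{-1}\otimes p^{-1})\Delta_\nu p$ as maps $(RH,d_{\bar h})\to(RH\otimes RH,d_{\bar h}\otimes 1+1\otimes d_{\bar h})$. Let $\Omega^{r,n}_H$ be the set of homotopy types of objects $A$ of $\mathbf{HAH}^n_r$ with $H(A)\cong H$ as graded Hopf algebras. Here $H(A)\cong H$ means an isomorphism of augmented graded algebras under which the map $H(A)\to H(A\otimes A)$ induced by $\psi$ is the coproduct of $H$ followed by the external product $H(A)\otimes H(A)\to H(A\otimes A)$. Let $\mathrm{Aut}\,H$ be the group of automorphisms of the graded Hopf algebra $H$.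 **Corollary 5.1.** Let $r\ge 1$, and suppose that the Hopf resolution $(RH,d,\Delta)$ of $H$ belongs to $\mathbf{HAH}^n_r$. Then $\mathrm{Aut}\,H$ acts canonically on $D_H$: there is a group action such that $\alpha\cdot[(h,\nu)]=[(\bar h,\bar\nu)]$ if and only if there is a weak equivalence $(RH,d_h,\Delta_\nu)\to(RH,d_{\bar h},\Delta_{\bar\nu})$ in $\mathbf{HAH}$ inducing $\alpha$ on homology, where $H$ is identified with the homology of a perturbed resolution by sending $\rho(b)$ to the class of $b$ for $b\in R_0H$. Moreover, assigning to $(h,\nu)$ the homotopy type of $(RH,d_h,\Delta_\nu)$ induces a bijection $$D_H/\mathrm{Aut}\,H\;\approx\;\Omega^{r,n}_H .$$ -/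

import Mathlib

open scoped TensorProduct DirectSum

universe u

namespace HopfHomotopy

noncomputable section

/-! ## Graded tensor products

Graded algebras are `ℤ`-graded over a commutative ring `R`.  The product on `𝒜 ᵍ⊗[R] ℬ` carries the
Koszul sign `(a ⊗ b)(a' ⊗ b') = (-1)^(|b||a'|) aa' ⊗ bb'`. -/

section Graded

variable {R : Type u} [CommRing R]
variable {A : Type u} [Ring A] [Algebra R A] (𝒜 : ℤ → Submodule R A) [GradedAlgebra 𝒜]
variable {B : Type u} [Ring B] [Algebra R B] (ℬ : ℤ → Submodule R B) [GradedAlgebra ℬ]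
variable {C : Type u} [Ring C] [Algebra R C] (𝒞 : ℤ → Submodule R C) [GradedAlgebra 𝒞]
variable {D : Type u} [Ring D] [Algebra R D] (𝒟 : ℤ → Submodule R D) [GradedAlgebra 𝒟]

/-- The degree `k` part of the tensor product: the span of `a ⊗ b` with `|a| + |b| = k`. -/
def tensorGrading (k : ℤ) : Submodule R (𝒜 ᵍ⊗[R] ℬ) :=
  Submodule.span R {t | ∃ i j : ℤ, i + j = k ∧ ∃ a ∈ 𝒜 i, ∃ b ∈ ℬ j,
    t = GradedTensorProduct.tmul R a b}

variable {𝒜 ℬ} in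
theorem tmul_mem_tensorGrading {i j k : ℤ} (h : i + j = k) {a : A} (ha : a ∈ 𝒜 i) {b : B}
    (hb : b ∈ ℬ j) : (GradedTensorProduct.tmul R a b : 𝒜 ᵍ⊗[R] ℬ) ∈ tensorGrading 𝒜 ℬ k :=
  Submodule.subset_span ⟨i, j, h, a, ha, b, hb, rfl⟩

instance tensorGrading_gradedMonoid : SetLike.GradedMonoid (tensorGrading 𝒜 ℬ) where
  one_mem := tmul_mem_tensorGrading (add_zero 0) SetLike.GradedOne.one_mem
    SetLike.GradedOne.one_mem
  mul_mem := by
    intro k l x y hx hy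
    induction hx using Submodule.span_induction with
    | zero => rw [zero_mul]; exact Submodule.zero_mem _
    | add x x' _ _ h h' => rw [add_mul]; exact Submodule.add_mem _ h h'
    | smul r x _ h =>
      rw [GradedTensorProduct.mul_def, map_smul, LinearMap.smul_apply]
      exact Submodule.smul_mem _ r h
    | mem x hx =>
      obtain ⟨i, j, rfl, a, ha, b, hb, rfl⟩ := hx
      induction hy using Submodule.span_induction with
      | zero => rw [mul_zero]; exact Submodule.zero_mem _
      | add x x' _ _ h h' => rw [mul_add]; exact Submodule.add_mem _ h h'
      | smul r x _ h =>
        rw [GradedTensorProduct.mul_def, map_smul]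
        exact Submodule.smul_mem _ r h
      | mem y hy =>
        obtain ⟨i', j', rfl, a', ha', b', hb', rfl⟩ := hy
        have := GradedTensorProduct.tmul_coe_mul_coe_tmul (R := R) 𝒜 ℬ a ⟨b, hb⟩ ⟨a', ha'⟩ b'
        dsimp only at this
        rw [this, Units.smul_def]
        refine (tensorGrading 𝒜 ℬ _).toAddSubgroup.zsmul_mem ?_ _
        exact tmul_mem_tensorGrading (i := i + i') (j := j + j') (by ring)
          (SetLike.GradedMul.mul_mem ha ha') (SetLike.GradedMul.mul_mem hb hb')

/-- The bilinear map underlying `tensorDecompose`. -/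
def tensorDecomposeAux (i j : ℤ) :
    𝒜 i →ₗ[R] ℬ j →ₗ[R] ⨁ k, tensorGrading 𝒜 ℬ k :=
  LinearMap.mk₂ R
    (fun a b => DirectSum.lof R ℤ (fun k => tensorGrading 𝒜 ℬ k) (i + j)
      ⟨GradedTensorProduct.tmul R (a : A) (b : B), tmul_mem_tensorGrading rfl a.2 b.2⟩)
    (fun a a' b => by
      rw [← map_add]; congr 1; ext1
      exact TensorProduct.add_tmul (a : A) (a' : A) (b : B))
    (fun r a b => by
      rw [← map_smul]; congr 1)
    (fun a b b' => by
      rw [← map_add]; congr 1; ext1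
      exact TensorProduct.tmul_add (a : A) (b : B) (b' : B))
    (fun r a b => by
      rw [← map_smul]; congr 1; ext1
      exact TensorProduct.tmul_smul r (a : A) (b : B))

/-- The decomposition of a tensor into its homogeneous parts. -/
def tensorDecompose : (𝒜 ᵍ⊗[R] ℬ) →ₗ[R] ⨁ k, tensorGrading 𝒜 ℬ k :=
  (TensorProduct.lift (DirectSum.toModule R ℤ _ fun i => LinearMap.flip
      (DirectSum.toModule R ℤ _ fun j => LinearMap.flip (tensorDecomposeAux 𝒜 ℬ i j)))) ∘ₗ
    (GradedTensorProduct.auxEquiv R 𝒜 ℬ).toLinearMap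

theorem tensorDecompose_tmul {i j : ℤ} (a : 𝒜 i) (b : ℬ j) :
    tensorDecompose 𝒜 ℬ (GradedTensorProduct.tmul R (a : A) (b : B)) =
      tensorDecomposeAux 𝒜 ℬ i j a b := by
  simp only [tensorDecompose, LinearMap.comp_apply, LinearEquiv.coe_coe,
    GradedTensorProduct.auxEquiv_tmul, DirectSum.decompose_coe, TensorProduct.lift.tmul]
  rw [← DirectSum.lof_eq_of R, ← DirectSum.lof_eq_of R, DirectSum.toModule_lof,
    LinearMap.flip_apply, DirectSum.toModule_lof, LinearMap.flip_apply]

instance tensorGrading_gradedAlgebra : GradedAlgebra (tensorGrading 𝒜 ℬ) where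
  toDecomposition := DirectSum.Decomposition.ofLinearMap _ (tensorDecompose 𝒜 ℬ)
    (by
      apply GradedTensorProduct.hom_ext
      apply TensorProduct.ext
      refine DirectSum.decompose_lhom_ext 𝒜 fun i => ?_
      ext a : 1
      refine DirectSum.decompose_lhom_ext ℬ fun j => ?_
      ext b : 1
      have := tensorDecompose_tmul 𝒜 ℬ a b
      change DirectSum.coeLinearMap (tensorGrading 𝒜 ℬ)
        (tensorDecompose 𝒜 ℬ (GradedTensorProduct.tmul R (a : A) (b : B))) =
          GradedTensorProduct.tmul R (a : A) (b : B)
      rw [this]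
      exact DirectSum.coeLinearMap_lof ..)
    (by
      ext k ⟨x, hx⟩ : 2
      simp only [LinearMap.comp_apply, DirectSum.coeLinearMap_lof, LinearMap.id_apply]
      induction hx using Submodule.span_induction with
      | zero => rw [map_zero]; exact (map_zero _).symm
      | add x y hx hy h h' =>
        rw [map_add, h, h', ← map_add]; rfl
      | smul r x hx h => rw [map_smul, h, ← map_smul]; rfl
      | mem x hx =>
        obtain ⟨i, j, rfl, a, ha, b, hb, rfl⟩ := hx
        exact tensorDecompose_tmul 𝒜 ℬ ⟨a, ha⟩ ⟨b, hb⟩)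

/-- The sign automorphism `a ↦ (-1)^|a| a`. -/
def signMap : A →ₗ[R] A :=
  DirectSum.toModule R ℤ A (fun i => (((-1 : ℤˣ) ^ i : ℤˣ) : ℤ) • (𝒜 i).subtype) ∘ₗ
    (DirectSum.decomposeLinearEquiv 𝒜).toLinearMap

theorem signMap_apply {i : ℤ} {a : A} (ha : a ∈ 𝒜 i) :
    signMap 𝒜 a = (((-1 : ℤˣ) ^ i : ℤˣ) : ℤ) • a := by
  lift a to 𝒜 i using ha
  simp [signMap, DirectSum.decomposeLinearEquiv, ← DirectSum.lof_eq_of R]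

variable {𝒜 ℬ 𝒞 𝒟} in
/-- `f ⊗ g` for linear maps `f`, `g` of degree `0` (no sign arises). -/
def tensorMap (f : A →ₗ[R] C) (g : B →ₗ[R] D) : (𝒜 ᵍ⊗[R] ℬ) →ₗ[R] (𝒞 ᵍ⊗[R] 𝒟) :=
  (GradedTensorProduct.of R 𝒞 𝒟).toLinearMap ∘ₗ TensorProduct.map f g ∘ₗ
    (GradedTensorProduct.of R 𝒜 ℬ).symm.toLinearMap

/-- The tensor differential `d(a ⊗ b) = da ⊗ b + (-1)^|a| a ⊗ db`. -/
def tensorD (dA : A →ₗ[R] A) (dB : B →ₗ[R] B) : (𝒜 ᵍ⊗[R] ℬ) →ₗ[R] (𝒜 ᵍ⊗[R] ℬ) :=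
  tensorMap dA LinearMap.id + tensorMap (signMap 𝒜) dB

/-- The reassociation `(a ⊗ b) ⊗ c ↦ a ⊗ (b ⊗ c)`. -/
def tensorAssoc :
    (tensorGrading 𝒜 ℬ ᵍ⊗[R] 𝒞) →ₗ[R] (𝒜 ᵍ⊗[R] tensorGrading ℬ 𝒞) :=
  (GradedTensorProduct.of R 𝒜 (tensorGrading ℬ 𝒞)).toLinearMap ∘ₗ
    TensorProduct.map LinearMap.id (GradedTensorProduct.of R ℬ 𝒞).toLinearMap ∘ₗ
    (TensorProduct.assoc R A B C).toLinearMap ∘ₗ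
    TensorProduct.map (GradedTensorProduct.of R 𝒜 ℬ).symm.toLinearMap LinearMap.id ∘ₗ
    (GradedTensorProduct.of R (tensorGrading 𝒜 ℬ) 𝒞).symm.toLinearMap

/-! ## Differential graded algebras, derivation homotopies -/

/-- `d` has degree `m` and is a derivation: `d(ab) = d(a) b + (-1)^(m|a|) a d(b)`. -/
structure IsDerivationOfDegree (m : ℤ) (d : A →ₗ[R] A) : Prop where
  mem : ∀ i, ∀ a ∈ 𝒜 i, d a ∈ 𝒜 (i + m)
  leibniz : ∀ i, ∀ a ∈ 𝒜 i, ∀ b,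
    d (a * b) = d a * b + (((-1 : ℤˣ) ^ (m * i) : ℤˣ) : ℤ) • (a * d b)

/-- `(A, d)` is a differential graded algebra; differentials lower the degree by one. -/
structure IsDGA (d : A →ₗ[R] A) : Prop extends IsDerivationOfDegree 𝒜 (-1) d where
  d_d : ∀ a, d (d a) = 0

/-- `s` is a derivation homotopy between `f, g : (A, dA) → (B, dB)`: it has degree `1`, and
`s dA + dB s = f - g`, `s(ab) = (-1)^|a| f(a) s(b) + s(a) g(b)`. -/
structure IsDerivHomotopy (dA : A →ₗ[R] A) (dB : B →ₗ[R] B) (f g s : A →ₗ[R] B) : Prop where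
  mem : ∀ i, ∀ a ∈ 𝒜 i, s a ∈ ℬ (i + 1)
  htpy : ∀ a, s (dA a) + dB (s a) = f a - g a
  mul : ∀ i, ∀ a ∈ 𝒜 i, ∀ b,
    s (a * b) = (((-1 : ℤˣ) ^ i : ℤˣ) : ℤ) • (f a * s b) + s a * g b

/-- `f` and `g` are derivation homotopic. -/
def DerivHomotopic (dA : A →ₗ[R] A) (dB : B →ₗ[R] B) (f g : A →ₗ[R] B) : Prop :=
  ∃ s : A →ₗ[R] B, IsDerivHomotopy 𝒜 ℬ dA dB f g s

variable {𝒜} in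
/-- `ψ : A → A ⊗ A` is a map of graded algebras having the augmentation `ε` as a two-sided counit. -/
structure IsCoproduct (ε : A →ₐ[R] R) (ψ : A →ₗ[R] (𝒜 ᵍ⊗[R] 𝒜)) : Prop where
  counit_degree : ∀ i, i ≠ 0 → ∀ a ∈ 𝒜 i, ε a = 0
  mem : ∀ i, ∀ a ∈ 𝒜 i, ψ a ∈ tensorGrading 𝒜 𝒜 i
  map_one : ψ 1 = 1
  map_mul : ∀ a b, ψ (a * b) = ψ a * ψ b
  counit_left : ∀ a, TensorProduct.lid R A
    (TensorProduct.map ε.toLinearMap LinearMap.id ((GradedTensorProduct.of R 𝒜 𝒜).symm (ψ a))) = a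
  counit_right : ∀ a, TensorProduct.rid R A
    (TensorProduct.map LinearMap.id ε.toLinearMap ((GradedTensorProduct.of R 𝒜 𝒜).symm (ψ a))) = a

variable {𝒜} in
/-- The map `(ψ ⊗ 1) ψ : A → A ⊗ (A ⊗ A)`. -/
def coassocLeft (ψ : A →ₗ[R] (𝒜 ᵍ⊗[R] 𝒜)) : A →ₗ[R] (𝒜 ᵍ⊗[R] tensorGrading 𝒜 𝒜) :=
  tensorAssoc 𝒜 𝒜 𝒜 ∘ₗ
    (tensorMap ψ LinearMap.id : (𝒜 ᵍ⊗[R] 𝒜) →ₗ[R] (tensorGrading 𝒜 𝒜 ᵍ⊗[R] 𝒜)) ∘ₗ ψ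

variable {𝒜} in
/-- The map `(1 ⊗ ψ) ψ : A → A ⊗ (A ⊗ A)`. -/
def coassocRight (ψ : A →ₗ[R] (𝒜 ᵍ⊗[R] 𝒜)) : A →ₗ[R] (𝒜 ᵍ⊗[R] tensorGrading 𝒜 𝒜) :=
  (tensorMap LinearMap.id ψ : (𝒜 ᵍ⊗[R] 𝒜) →ₗ[R] (𝒜 ᵍ⊗[R] tensorGrading 𝒜 𝒜)) ∘ₗ ψ

variable {𝒜} in
/-- `(A, d, ε, ψ)` is a Hopf algebra up to homotopy: an augmented dga with a counital coproduct which
is a map of dga's and is coassociative and cocommutative up to derivation homotopy. -/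
structure IsHah (d : A →ₗ[R] A) (ε : A →ₐ[R] R) (ψ : A →ₗ[R] (𝒜 ᵍ⊗[R] 𝒜)) : Prop where
  isDGA : IsDGA 𝒜 d
  counit_d : ∀ a, ε (d a) = 0
  isCoproduct : IsCoproduct ε ψ
  coproduct_d : ∀ a, ψ (d a) = tensorD 𝒜 𝒜 d d (ψ a)
  coassoc : DerivHomotopic 𝒜 (tensorGrading 𝒜 (tensorGrading 𝒜 𝒜)) d
    (tensorD 𝒜 (tensorGrading 𝒜 𝒜) d (tensorD 𝒜 𝒜 d d)) (coassocLeft ψ) (coassocRight ψ)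
  cocomm : DerivHomotopic 𝒜 (tensorGrading 𝒜 𝒜) d (tensorD 𝒜 𝒜 d d)
    ((GradedTensorProduct.comm 𝒜 𝒜).toLinearMap ∘ₗ ψ) ψ

/-- `A` is `(r-1)`-connected with multiplicative generators in degrees `r` through `n`: it is the
tensor algebra on a free graded `R`-module concentrated in these degrees, i.e. the free algebra on a
family of homogeneous elements of such degrees.  (For `r ≥ 1` this forces `A_0 = R` and `A_i = 0` for
`i < 0` and for `0 < i < r`.) -/
def HasGeneratorsInRange (r n : ℕ) : Prop :=
  ∃ (X : Type u) (gen : X → A) (deg : X → ℤ),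
    Function.Bijective (FreeAlgebra.lift R gen) ∧
    ∀ x, (r : ℤ) ≤ deg x ∧ deg x ≤ n ∧ gen x ∈ 𝒜 (deg x)

end Graded

/-! ## Hopf algebras up to homotopy and their homotopy types -/

/-- A Hopf algebra up to homotopy (Hah) over `R`. -/
structure Hah (R : Type u) [CommRing R] where
  carrier : Type u
  [ring : Ring carrier]
  [algebra : Algebra R carrier]
  grading : ℤ → Submodule R carrier
  [graded : GradedAlgebra grading]
  d : carrier →ₗ[R] carrier
  counit : carrier →ₐ[R] R
  coproduct : carrier →ₗ[R] (grading ᵍ⊗[R] grading)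
  isHah : IsHah d counit coproduct

attribute [instance] Hah.ring Hah.algebra Hah.graded

/-- A connected graded Hopf algebra over `R` (such an algebra has a unique antipode). -/
structure GradedHopfAlgebra (R : Type u) [CommRing R] where
  carrier : Type u
  [ring : Ring carrier]
  [algebra : Algebra R carrier]
  grading : ℤ → Submodule R carrier
  [graded : GradedAlgebra grading]
  counit : carrier →ₐ[R] R
  coproduct : carrier →ₗ[R] (grading ᵍ⊗[R] grading)
  isCoproduct : IsCoproduct counit coproduct
  coassoc : coassocLeft coproduct = coassocRight coproduct
  nonneg : ∀ i < 0, grading i = ⊥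
  connected : grading 0 = LinearMap.range (Algebra.linearMap R carrier)

attribute [instance] GradedHopfAlgebra.ring GradedHopfAlgebra.algebra GradedHopfAlgebra.graded

section

variable {R : Type u} [CommRing R]

/-- A morphism of Hah's: a map of augmented dga's that commutes with the coproducts up to derivation
homotopy. -/
structure IsHahMorphism (A B : Hah R) (f : A.carrier →ₐ[R] B.carrier) : Prop where
  mem : ∀ i, ∀ a ∈ A.grading i, f a ∈ B.grading i
  map_d : ∀ a, f (A.d a) = B.d (f a)
  map_counit : ∀ a, B.counit (f a) = A.counit a
  map_coproduct : DerivHomotopic A.grading (tensorGrading B.grading B.grading) A.d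
    (tensorD B.grading B.grading B.d B.d)
    (tensorMap f.toLinearMap f.toLinearMap ∘ₗ A.coproduct) (B.coproduct ∘ₗ f.toLinearMap)

/-- A weak equivalence of Hah's: a morphism that is injective and surjective on homology. -/
structure IsWeakEquivalence (A B : Hah R) (f : A.carrier →ₐ[R] B.carrier) : Prop extends
    IsHahMorphism A B f where
  homology_injective : ∀ a, A.d a = 0 → (∃ b, B.d b = f a) → ∃ a', A.d a' = a
  homology_surjective : ∀ b, B.d b = 0 → ∃ a, A.d a = 0 ∧ ∃ b', B.d b' = f a - b

variable (R) in
/-- The objects of the full subcategory of the Hah's that are `(r-1)`-connected and have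
multiplicative generators in degrees `r` through `n`. -/
def HAH (r n : ℕ) : Type (u + 1) :=
  {A : Hah R // HasGeneratorsInRange A.grading r n}

/-- Two objects are weakly equivalent if there is a third one with weak equivalences to both. -/
def WeaklyEquivalent {r n : ℕ} (A B : HAH R r n) : Prop :=
  ∃ (C : HAH R r n) (f : C.1.carrier →ₐ[R] A.1.carrier) (g : C.1.carrier →ₐ[R] B.1.carrier),
    IsWeakEquivalence C.1 A.1 f ∧ IsWeakEquivalence C.1 B.1 g

variable (R) in
/-- The homotopy types of objects of `HAH R r n`: the classes of the equivalence relation generated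
by weak equivalence. -/
def HomotopyType (r n : ℕ) : Type (u + 1) :=
  Quot (WeaklyEquivalent (R := R) (r := r) (n := n))

/-- The homology `H(A, d)` is isomorphic to `H` as a graded Hopf algebra.  The isomorphism is given
as the surjection `π` from the cycles of `A` to `H` whose kernel is the module of boundaries; it is
multiplicative and respects degrees, units and augmentations.  The last condition says that under `π`
the map induced by `ψ` on homology is the coproduct of `H` followed by the external product
`H(A) ⊗ H(A) → H(A ⊗ A)`. -/
def HasHomology (A : Hah R) (H : GradedHopfAlgebra R) : Prop :=
  ∃ π : LinearMap.ker A.d →ₗ[R] H.carrier,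
    Function.Surjective π ∧
    (∀ z, π z = 0 ↔ ∃ a, A.d a = z) ∧
    (∀ i, ∀ z : LinearMap.ker A.d, (z : A.carrier) ∈ A.grading i → π z ∈ H.grading i) ∧
    (∀ z : LinearMap.ker A.d, (z : A.carrier) = 1 → π z = 1) ∧
    (∀ z w y : LinearMap.ker A.d, (y : A.carrier) = z * w → π y = π z * π w) ∧
    (∀ z, H.counit (π z) = A.counit z) ∧
    ∀ z : LinearMap.ker A.d, ∃ t : LinearMap.ker A.d ⊗[R] LinearMap.ker A.d,
      (∃ c, tensorD A.grading A.grading A.d A.d c = A.coproduct z -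
        GradedTensorProduct.of R A.grading A.grading
          (TensorProduct.map (Submodule.subtype _) (Submodule.subtype _) t)) ∧
      H.coproduct (π z) = GradedTensorProduct.of R H.grading H.grading (TensorProduct.map π π t)

/-- The set of homotopy types of objects of `HAH R r n` with homology isomorphic to `H`. -/
def HomotopyTypesWithHomology (r n : ℕ) (H : GradedHopfAlgebra R) : Set (HomotopyType R r n) :=
  {t | ∃ A : HAH R r n, Quot.mk _ A = t ∧ HasHomology A.1 H}

/-- The group `Aut H` of automorphisms of the graded Hopf algebra `H`. -/
def GradedHopfAlgebra.aut (H : GradedHopfAlgebra R) : Subgroup (H.carrier ≃ₐ[R] H.carrier) where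
  carrier := {α | (∀ i, ∀ a, α a ∈ H.grading i ↔ a ∈ H.grading i) ∧
    (∀ a, H.counit (α a) = H.counit a) ∧
    ∀ a, H.coproduct (α a) =
      (tensorMap α.toLinearMap α.toLinearMap :
        (H.grading ᵍ⊗[R] H.grading) →ₗ[R] (H.grading ᵍ⊗[R] H.grading)) (H.coproduct a)}
  mul_mem' := by
    rintro α β ⟨h1, h2, h3⟩ ⟨k1, k2, k3⟩
    refine ⟨fun i a => (h1 i _).trans (k1 i a), fun a => (h2 _).trans (k2 a), fun a => ?_⟩
    rw [AlgEquiv.mul_apply, h3, k3]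
    generalize H.coproduct a = t
    exact (congr($(TensorProduct.map_comp α.toLinearMap α.toLinearMap β.toLinearMap
      β.toLinearMap) t)).symm
  one_mem' := by
    refine ⟨fun i a => Iff.rfl, fun a => rfl, fun a => ?_⟩
    change H.coproduct a = _
    generalize H.coproduct a = t
    exact (congr($(TensorProduct.map_id (R := R) (M := H.carrier) (N := H.carrier)) t)).symm
  inv_mem' := by
    rintro α ⟨h1, h2, h3⟩
    have hα : ∀ a, α (α⁻¹ a) = a := fun a => α.apply_symm_apply a
    refine ⟨fun i a => ?_, fun a => ?_, fun a => ?_⟩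
    · rw [← h1 i, hα]
    · rw [← h2, hα]
    · have h := h3 (α⁻¹ a)
      rw [hα] at h
      rw [h]
      generalize H.coproduct (α⁻¹ a) = t
      have key : (TensorProduct.map (α⁻¹).toLinearMap (α⁻¹).toLinearMap) ∘ₗ
          (TensorProduct.map α.toLinearMap α.toLinearMap) = LinearMap.id := by
        rw [← TensorProduct.map_comp]
        have : (α⁻¹).toLinearMap ∘ₗ α.toLinearMap = LinearMap.id := by
          ext x; exact α.symm_apply_apply x
        rw [this, TensorProduct.map_id]
      exact (congr($key t)).symm

/-! ## Hopf resolutions, perturbations and the set `D_H` -/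

/-- The part of `A ⊗ A` of resolution degree `q`: the span of `a ⊗ b` with `a ∈ R_i`, `b ∈ R_j`,
`i + j = q`. -/
def tensorRes {A : Type u} [Ring A] [Algebra R A] (𝒜 : ℤ → Submodule R A) [GradedAlgebra 𝒜]
    (res : ℕ → Submodule R A) (q : ℕ) : Submodule R (𝒜 ᵍ⊗[R] 𝒜) :=
  Submodule.span R {t | ∃ i j : ℕ, i + j = q ∧ ∃ a ∈ res i, ∃ b ∈ res j,
    t = GradedTensorProduct.tmul R a b}

/-- A Hopf resolution `ρ : (RH, d, Δ) → H`.  Here `RH = T(V)` is the free algebra on a family `gen` of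
bihomogeneous elements, `gen x` having resolution degree `resDeg x` and internal degree `intDeg x`;
`res q` is the part `R_q H` of resolution degree `q`, and `toHah.grading` is the grading by total
degree.  The differential lowers the resolution degree by one and preserves the internal degree, `Δ`
preserves the resolution degree, and `ρ` is a bigraded algebra map (with `H` in resolution degree `0`)
that preserves coproducts and induces an isomorphism `H(RH, d) ≅ H`. -/
structure HopfResolution (H : GradedHopfAlgebra R) where
  toHah : Hah R
  X : Type u
  gen : X → toHah.carrier
  resDeg : X → ℕ
  intDeg : X → ℤ
  res : ℕ → Submodule R toHah.carrier
  [resGraded : GradedAlgebra res]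
  gen_free : Function.Bijective (FreeAlgebra.lift R gen)
  gen_mem_res : ∀ x, gen x ∈ res (resDeg x)
  gen_mem_grading : ∀ x, gen x ∈ toHah.grading (resDeg x + intDeg x)
  d_res : ∀ q, ∀ a ∈ res (q + 1), toHah.d a ∈ res q
  d_res_zero : ∀ a ∈ res 0, toHah.d a = 0
  coproduct_res : ∀ q, ∀ a ∈ res q, toHah.coproduct a ∈ tensorRes toHah.grading res q
  ρ : toHah.carrier →ₐ[R] H.carrier
  ρ_mem : ∀ i, ∀ a ∈ toHah.grading i, ρ a ∈ H.grading i
  ρ_res : ∀ q, q ≠ 0 → ∀ a ∈ res q, ρ a = 0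
  ρ_d : ∀ a, ρ (toHah.d a) = 0
  ρ_injective : ∀ a, toHah.d a = 0 → ρ a = 0 → ∃ b, toHah.d b = a
  ρ_surjective : ∀ y, ∃ a, toHah.d a = 0 ∧ ρ a = y
  ρ_counit : ∀ a, H.counit (ρ a) = toHah.counit a
  ρ_coproduct : ∀ a, H.coproduct (ρ a) =
    tensorMap ρ.toLinearMap ρ.toLinearMap (toHah.coproduct a)

namespace HopfResolution

variable {H : GradedHopfAlgebra R} (Q : HopfResolution H)

/-- The set `M_H` of perturbations `(h, ν)` of `(RH, d, Δ)`: `h` is a derivation of total degree `-1`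
lowering the resolution degree by at least two, `ν` has total degree `0` and lowers the resolution
degree by at least one, and `(RH, d + h, Δ + ν)` is a Hah. -/
structure Perturbation where
  h : Q.toHah.carrier →ₗ[R] Q.toHah.carrier
  ν : Q.toHah.carrier →ₗ[R] (Q.toHah.grading ᵍ⊗[R] Q.toHah.grading)
  h_derivation : IsDerivationOfDegree Q.toHah.grading (-1) h
  h_res : ∀ q, ∀ a ∈ Q.res q, h a ∈ ⨆ (i : ℕ) (_ : i + 2 ≤ q), Q.res i
  ν_mem : ∀ i, ∀ a ∈ Q.toHah.grading i, ν a ∈ tensorGrading Q.toHah.grading Q.toHah.grading i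
  ν_res : ∀ q, ∀ a ∈ Q.res q, ν a ∈ ⨆ (k : ℕ) (_ : k + 1 ≤ q), tensorRes Q.toHah.grading Q.res k
  isHah : IsHah (Q.toHah.d + h) Q.toHah.counit (Q.toHah.coproduct + ν)

variable {Q}

/-- The perturbed differential `d_h = d + h`. -/
def Perturbation.d (x : Q.Perturbation) : Q.toHah.carrier →ₗ[R] Q.toHah.carrier :=
  Q.toHah.d + x.h

/-- The perturbed coproduct `Δ_ν = Δ + ν`. -/
def Perturbation.coproduct (x : Q.Perturbation) :
    Q.toHah.carrier →ₗ[R] (Q.toHah.grading ᵍ⊗[R] Q.toHah.grading) :=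
  Q.toHah.coproduct + x.ν

/-- The Hah `(RH, d_h, Δ_ν)`. -/
def Perturbation.perturbed (x : Q.Perturbation) : Hah R where
  carrier := Q.toHah.carrier
  grading := Q.toHah.grading
  d := x.d
  counit := Q.toHah.counit
  coproduct := x.coproduct
  isHah := x.isHah

/-- The perturbed Hopf resolution as an object of `HAH R r n`. -/
def Perturbation.toHAH (x : Q.Perturbation) {r n : ℕ}
    (hQ : HasGeneratorsInRange Q.toHah.grading r n) : HAH R r n :=
  ⟨x.perturbed, hQ⟩

/-- `y = x * (p, s)` for some `(p, s)` in `G_H`.  Here `p` is an automorphism of the graded algebra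
`RH` of the form `1 + p'`, where `p'` lowers the resolution degree, `d_y = p⁻¹ d_x p`, and
`Δ_y = (p⁻¹ ⊗ p⁻¹) Δ_x p + s d_y + (d_y ⊗ 1 + 1 ⊗ d_y) s` with `s` a derivation homotopy. -/
def GaugeEquivalent (x y : Q.Perturbation) : Prop :=
  ∃ p : Q.toHah.carrier ≃ₐ[R] Q.toHah.carrier,
    (∀ i, ∀ a ∈ Q.toHah.grading i, p a ∈ Q.toHah.grading i) ∧
    (∀ q, ∀ a ∈ Q.res q, p a - a ∈ ⨆ (i : ℕ) (_ : i + 1 ≤ q), Q.res i) ∧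
    (∀ a, y.d a = p.symm (x.d (p a))) ∧
    DerivHomotopic Q.toHah.grading (tensorGrading Q.toHah.grading Q.toHah.grading) y.d
      (tensorD Q.toHah.grading Q.toHah.grading y.d y.d)
      y.coproduct
      (tensorMap p.symm.toLinearMap p.symm.toLinearMap ∘ₗ x.coproduct ∘ₗ p.toLinearMap)

variable (Q) in
/-- The set `D_H = M_H / G_H` of classes of perturbations. -/
def D : Type u :=
  Quot (GaugeEquivalent (Q := Q))

/-- The class of a perturbation in `D_H`. -/
def Perturbation.toD (x : Q.Perturbation) : Q.D :=
  Quot.mk _ x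

/-- There is a weak equivalence `k : (RH, d_x, Δ_x) → (RH, d_y, Δ_y)` of Hah's that induces `α` on
homology, where `H` is identified with the homology of a perturbed resolution by sending `ρ(b)` to the
class of `b`, for `b ∈ R_0 H`. -/
def Realizes (α : H.carrier → H.carrier) (x y : Q.Perturbation) : Prop :=
  ∃ k : Q.toHah.carrier →ₐ[R] Q.toHah.carrier,
    IsWeakEquivalence x.perturbed y.perturbed k ∧
    ∀ a ∈ Q.res 0, ∃ b ∈ Q.res 0, Q.ρ b = α (Q.ρ a) ∧ ∃ c, y.d c = k a - b

end HopfResolution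

end

end

end HopfHomotopy

-- Two facts carry the proof. First, RH is free on generators of positive degree. Hence derivation
-- homotopy between dga maps out of it is an equivalence relation, and such maps lift through
-- homology isomorphisms up to homotopy (`FreeGen.trans`, `FreeGen.symm`, `FreeGen.exists_lift`).
-- Second, (RH, d) is acyclic in positive resolution degree, and so is its tensor square, by a
-- Künneth argument that uses the flatness of H. A perturbation of d lowers the filtration strictly
-- more than d does, so a cycle can still be pushed down, component by component, by subtracting
-- boundaries (`IsPerturbedComplex.exists_sub_mem`).
--
-- By the first fact a homology isomorphism of free dga's is a homotopy equivalence. Weak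
-- equivalences are therefore invertible, and two objects have the same homotopy type exactly when a
-- single weak equivalence joins them. By the second fact the homology of every perturbed resolution
-- is H, read off in resolution degree zero, where h and ν vanish. Moreover the external product
-- from H ⊗ H to the homology of the tensor square is injective, so a weak equivalence of perturbed
-- resolutions induces an automorphism of the Hopf algebra H (`exists_aut_of_isWeakEquivalence`).
--
-- Elements of D_H are understood through `toD_eq_iff`: two perturbations have the same class if and
-- only if a weak equivalence between them induces the identity of H. Such a map can be deformed to
-- one of the form 1 + p' with p' lowering the resolution degree (`exists_unipotent`); it is then
-- bijective and is a gauge transformation.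
--
-- Existence is `exists_perturbed_isWeakEquivalence`: a free Hah A with a chosen identification of
-- its homology with H receives a weak equivalence from some perturbed resolution, compatible with
-- that identification. The differential d + h and the map f to A are built together, one generator
-- at a time. The coproduct of A is lifted through f ⊗ f to a counital perturbation of Δ, and
-- coassociativity and cocommutativity up to homotopy are reflected back from A because f is a
-- homotopy equivalence.
--
-- Applied to a perturbed resolution whose identification with H is twisted by an automorphism, this
-- existence theorem gives the action; applied to an arbitrary A, it gives surjectivity of the map
-- to homotopy types. Injectivity on orbits holds because a weak equivalence between perturbed
-- resolutions induces some automorphism of H.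

attribute [reducible] HopfHomotopy.HopfResolution.Perturbation.perturbed

namespace HopfHomotopy

set_option linter.unusedSectionVars false

noncomputable section

section Graded

variable {R : Type u} [CommRing R] {A : Type u} [Ring A] [Algebra R A]

/-! ### Homogeneous components -/

section Projections

variable {ι : Type*} [AddMonoid ι] [DecidableEq ι] (𝒜 : ι → Submodule R A) [GradedAlgebra 𝒜]

theorem proj_mem (i : ι) (a : A) : GradedAlgebra.proj 𝒜 i a ∈ 𝒜 i :=
  SetLike.coe_mem _

variable {𝒜} in
theorem proj_of_mem {i : ι} {a : A} (ha : a ∈ 𝒜 i) : GradedAlgebra.proj 𝒜 i a = a := by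
  rw [GradedAlgebra.proj_apply, DirectSum.decompose_of_mem_same 𝒜 ha]

variable {𝒜} in
theorem proj_of_mem_ne {i j : ι} {a : A} (ha : a ∈ 𝒜 i) (h : i ≠ j) :
    GradedAlgebra.proj 𝒜 j a = 0 := by
  rw [GradedAlgebra.proj_apply, DirectSum.decompose_of_mem_ne 𝒜 ha h]

/-- Linear maps that agree on homogeneous elements are equal. -/
theorem graded_hom_ext {M : Type*} [AddCommGroup M] [Module R M] {f g : A →ₗ[R] M}
    (h : ∀ i, ∀ a ∈ 𝒜 i, f a = g a) : f = g :=
  DirectSum.decompose_lhom_ext 𝒜 fun i => LinearMap.ext fun a => h i a a.2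

/-- A submodule containing all homogeneous elements is everything. -/
theorem mem_of_homogeneous (N : Submodule R A) (h : ∀ i, 𝒜 i ≤ N) (a : A) : a ∈ N := by
  classical
  rw [← DirectSum.sum_support_decompose 𝒜 a]
  exact N.sum_mem fun i _ => h i (SetLike.coe_mem _)

end Projections

/-- Exactness statements produce solutions of unknown degree; this is the tool that makes them
homogeneous. The target degree is a separate variable with an equation, so that shifts such as `i =
i + 1 + -1` can be supplied by `ring`. -/
theorem proj_comm {B : Type u} [Ring B] [Algebra R B] (𝒜 : ℤ → Submodule R A) [GradedAlgebra 𝒜]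
    (ℬ : ℤ → Submodule R B) [GradedAlgebra ℬ] {f : A →ₗ[R] B} {m : ℤ}
    (hf : ∀ i, ∀ a ∈ 𝒜 i, f a ∈ ℬ (i + m)) {i j : ℤ} (hj : j = i + m) (a : A) :
    GradedAlgebra.proj ℬ j (f a) = f (GradedAlgebra.proj 𝒜 i a) := by
  subst hj
  have : GradedAlgebra.proj ℬ (i + m) ∘ₗ f = f ∘ₗ GradedAlgebra.proj 𝒜 i := by
    refine graded_hom_ext 𝒜 fun k a ha => ?_
    simp only [LinearMap.comp_apply]
    by_cases h : k = i
    · subst h; rw [proj_of_mem (hf _ _ ha), proj_of_mem ha]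
    · rw [proj_of_mem_ne (hf _ _ ha) (by simpa using h), proj_of_mem_ne ha h, map_zero]
  exact congr($this a)

/-! ### The sign automorphism -/

variable (𝒜 : ℤ → Submodule R A) [GradedAlgebra 𝒜]

theorem sign_add (i j : ℤ) : (((-1 : ℤˣ) ^ (i + j) : ℤˣ) : ℤ) =
    (((-1 : ℤˣ) ^ i : ℤˣ) : ℤ) * (((-1 : ℤˣ) ^ j : ℤˣ) : ℤ) := by
  rw [zpow_add, Units.val_mul]

theorem sign_mul_self (i : ℤ) :
    (((-1 : ℤˣ) ^ i : ℤˣ) : ℤ) * (((-1 : ℤˣ) ^ i : ℤˣ) : ℤ) = 1 := by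
  rw [← Units.val_mul, Int.units_mul_self, Units.val_one]

theorem signMap_mem {i : ℤ} {a : A} (ha : a ∈ 𝒜 i) : signMap 𝒜 a ∈ 𝒜 i := by
  rw [signMap_apply 𝒜 ha]
  exact (𝒜 i).toAddSubgroup.zsmul_mem ha _

theorem signMap_mul (a b : A) : signMap 𝒜 (a * b) = signMap 𝒜 a * signMap 𝒜 b := by
  have : (LinearMap.mul R A).compr₂ (signMap 𝒜) =
      (LinearMap.mul R A).compl₁₂ (signMap 𝒜) (signMap 𝒜) := by
    refine graded_hom_ext 𝒜 fun i a ha => graded_hom_ext 𝒜 fun j b hb => ?_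
    simp only [LinearMap.compr₂_apply, LinearMap.compl₁₂_apply, LinearMap.mul_apply']
    rw [signMap_apply 𝒜 ha, signMap_apply 𝒜 hb, signMap_apply 𝒜 (SetLike.GradedMul.mul_mem ha hb),
      sign_add, smul_mul_smul_comm]
  exact congr($this a b)

theorem signMap_one : signMap 𝒜 (1 : A) = 1 := by
  rw [signMap_apply 𝒜 SetLike.GradedOne.one_mem]; simp

theorem signMap_signMap (a : A) : signMap 𝒜 (signMap 𝒜 a) = a := by
  have : signMap 𝒜 ∘ₗ signMap 𝒜 = LinearMap.id := by
    refine graded_hom_ext 𝒜 fun i a ha => ?_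
    simp only [LinearMap.comp_apply, LinearMap.id_apply]
    rw [signMap_apply 𝒜 ha, map_zsmul, signMap_apply 𝒜 ha, smul_smul, sign_mul_self, one_smul]
  exact congr($this a)

/-- The sign automorphism as a map of algebras. -/
def sgn : A →ₐ[R] A :=
  AlgHom.ofLinearMap (signMap 𝒜) (signMap_one 𝒜) (signMap_mul 𝒜)

theorem sgn_apply (a : A) : sgn 𝒜 a = signMap 𝒜 a := rfl

theorem sgn_sgn (a : A) : sgn 𝒜 (sgn 𝒜 a) = a := signMap_signMap 𝒜 a

theorem sgn_mem {i : ℤ} {a : A} (ha : a ∈ 𝒜 i) : sgn 𝒜 a ∈ 𝒜 i := signMap_mem 𝒜 ha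

variable {B : Type u} [Ring B] [Algebra R B] (ℬ : ℤ → Submodule R B) [GradedAlgebra ℬ]

theorem sgn_comm_of_degree {f : A →ₗ[R] B} (m : ℤ) (hf : ∀ i, ∀ a ∈ 𝒜 i, f a ∈ ℬ (i + m)) (a : A) :
    sgn ℬ (f a) = (((-1 : ℤˣ) ^ m : ℤˣ) : ℤ) • f (sgn 𝒜 a) := by
  have : signMap ℬ ∘ₗ f = (((-1 : ℤˣ) ^ m : ℤˣ) : ℤ) • f ∘ₗ signMap 𝒜 := by
    refine graded_hom_ext 𝒜 fun i a ha => ?_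
    simp only [LinearMap.comp_apply, LinearMap.smul_apply]
    rw [signMap_apply 𝒜 ha, signMap_apply ℬ (hf i a ha), map_zsmul, sign_add, smul_smul, mul_comm]
  exact congr($this a)

theorem sgn_comm_even {f : A →ₗ[R] B} (hf : ∀ i, ∀ a ∈ 𝒜 i, f a ∈ ℬ i) (a : A) :
    sgn ℬ (f a) = f (sgn 𝒜 a) := by
  rw [sgn_comm_of_degree 𝒜 ℬ 0 (by simpa using hf)]; simp

theorem sgn_comm_down {f : A →ₗ[R] B} (hf : ∀ i, ∀ a ∈ 𝒜 i, f a ∈ ℬ (i + -1)) (a : A) :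
    sgn ℬ (f a) = - f (sgn 𝒜 a) := by
  rw [sgn_comm_of_degree 𝒜 ℬ (-1) hf]; simp

theorem sgn_comm_up {f : A →ₗ[R] B} (hf : ∀ i, ∀ a ∈ 𝒜 i, f a ∈ ℬ (i + 1)) (a : A) :
    sgn ℬ (f a) = - f (sgn 𝒜 a) := by
  rw [sgn_comm_of_degree 𝒜 ℬ 1 hf]; simp

variable {𝒜 ℬ}

/-- Absorbing the Koszul sign into the algebra automorphism `sgn` gives an identity for all
elements, not only homogeneous ones. It exhibits d as a derivation twisted by the pair (`sgn`,
identity), which is the form used for free algebras. -/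
theorem IsDerivationOfDegree.mul {d : A →ₗ[R] A} (hd : IsDerivationOfDegree 𝒜 (-1) d) (a b : A) :
    d (a * b) = d a * b + sgn 𝒜 a * d b := by
  have : (LinearMap.mul R A).compr₂ d =
      (LinearMap.mul R A).comp d + (LinearMap.mul R A).compl₁₂ (signMap 𝒜) d := by
    refine graded_hom_ext 𝒜 fun i a ha => LinearMap.ext fun b => ?_
    simp only [LinearMap.compr₂_apply, LinearMap.compl₁₂_apply, LinearMap.mul_apply',
      LinearMap.add_apply, LinearMap.comp_apply]
    rw [hd.leibniz i a ha, signMap_apply 𝒜 ha, smul_mul_assoc]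
    simp [zpow_neg]
  exact congr($this a b)

theorem isDerivationOfDegree_of_mul {d : A →ₗ[R] A} (hd : ∀ i, ∀ a ∈ 𝒜 i, d a ∈ 𝒜 (i + -1))
    (h : ∀ a b, d (a * b) = d a * b + sgn 𝒜 a * d b) : IsDerivationOfDegree 𝒜 (-1) d where
  mem := hd
  leibniz i a ha b := by
    rw [h, sgn_apply, signMap_apply 𝒜 ha, smul_mul_assoc]
    simp [zpow_neg]

theorem IsDerivationOfDegree.sgn_d {d : A →ₗ[R] A} (hd : IsDerivationOfDegree 𝒜 (-1) d) (a : A) :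
    sgn 𝒜 (d a) = - d (sgn 𝒜 a) :=
  sgn_comm_down 𝒜 𝒜 hd.mem a

theorem IsDerivationOfDegree.map_one {d : A →ₗ[R] A} (hd : IsDerivationOfDegree 𝒜 (-1) d) :
    d 1 = 0 := by
  have := hd.mul 1 1
  simpa using this

/-- The defining identity of a derivation homotopy, with the sign absorbed in `sgn`. -/
theorem IsDerivHomotopy.mul' {dA : A →ₗ[R] A} {dB : B →ₗ[R] B} {f g s : A →ₗ[R] B}
    (hs : IsDerivHomotopy 𝒜 ℬ dA dB f g s) (a b : A) :
    s (a * b) = f (sgn 𝒜 a) * s b + s a * g b := by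
  have : (LinearMap.mul R A).compr₂ s =
      (LinearMap.mul R B).compl₁₂ (f ∘ₗ signMap 𝒜) s + (LinearMap.mul R B).compl₁₂ s g := by
    refine graded_hom_ext 𝒜 fun i a ha => LinearMap.ext fun b => ?_
    simp only [LinearMap.compr₂_apply, LinearMap.compl₁₂_apply, LinearMap.mul_apply',
      LinearMap.add_apply, LinearMap.comp_apply]
    rw [hs.mul i a ha, signMap_apply 𝒜 ha, map_zsmul, smul_mul_assoc]
  exact congr($this a b)

theorem isDerivHomotopy_of_mul {dA : A →ₗ[R] A} {dB : B →ₗ[R] B} {f g s : A →ₗ[R] B}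
    (mem : ∀ i, ∀ a ∈ 𝒜 i, s a ∈ ℬ (i + 1))
    (htpy : ∀ a, s (dA a) + dB (s a) = f a - g a)
    (mul : ∀ a b, s (a * b) = f (sgn 𝒜 a) * s b + s a * g b) :
    IsDerivHomotopy 𝒜 ℬ dA dB f g s where
  mem := mem
  htpy := htpy
  mul i a ha b := by
    rw [mul, sgn_apply, signMap_apply 𝒜 ha, map_zsmul, smul_mul_assoc]

end Graded

/-! ### Free graded algebras -/

section Free

variable {R : Type u} [CommRing R] {A : Type u} [Ring A] [Algebra R A]
  {X : Type u} {gen : X → A} (hfree : Function.Bijective (FreeAlgebra.lift R gen))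

theorem mem_span_words (hfree : Function.Bijective (FreeAlgebra.lift R gen))
    (a : A) :
    a ∈ Submodule.span R (Set.range fun l : List X => (l.map gen).prod) := by
  obtain ⟨y, rfl⟩ := hfree.2 a
  induction y using FreeAlgebra.induction with
  | grade0 r =>
    rw [AlgHom.commutes, Algebra.algebraMap_eq_smul_one]
    exact Submodule.smul_mem _ _ (Submodule.subset_span ⟨[], by simp⟩)
  | grade1 x => exact Submodule.subset_span ⟨[x], by simp⟩
  | add a b ha hb => rw [map_add]; exact Submodule.add_mem _ ha hb
  | mul a b ha hb =>
    rw [map_mul]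
    have := Submodule.mul_mem_mul ha hb
    rw [Submodule.span_mul_span] at this
    refine Submodule.span_mono ?_ this
    rintro _ ⟨_, ⟨l, rfl⟩, _, ⟨l', rfl⟩, rfl⟩
    exact ⟨l ++ l', by simp⟩

theorem word_mem {ι : Type*} [AddMonoid ι] {𝒜 : ι → Submodule R A} [SetLike.GradedMonoid 𝒜]
    {deg : X → ι} (hdeg : ∀ x, gen x ∈ 𝒜 (deg x)) (l : List X) :
    (l.map gen).prod ∈ 𝒜 (l.map deg).sum := by
  induction l with
  | nil => simpa using SetLike.GradedOne.one_mem
  | cons x l ih => simpa using SetLike.GradedMul.mul_mem (hdeg x) ih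

/-- The degree `i` part of a free graded algebra is spanned by the words of degree `i`. -/
theorem graded_le_of_words (hfree : Function.Bijective (FreeAlgebra.lift R gen))
    {ι : Type*} [AddMonoid ι] [DecidableEq ι] {𝒜 : ι → Submodule R A}
    [GradedAlgebra 𝒜] {deg : X → ι} (hdeg : ∀ x, gen x ∈ 𝒜 (deg x)) {i : ι} {N : Submodule R A}
    (h : ∀ l : List X, (l.map deg).sum = i → (l.map gen).prod ∈ N) : 𝒜 i ≤ N := by
  intro a ha
  rw [← proj_of_mem ha]
  have : Submodule.span R (Set.range fun l : List X => (l.map gen).prod) ≤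
      N.comap (GradedAlgebra.proj 𝒜 i) := by
    rw [Submodule.span_le]
    rintro _ ⟨l, rfl⟩
    simp only [Submodule.comap_coe, Set.mem_preimage, SetLike.mem_coe]
    by_cases hl : (l.map deg).sum = i
    · rw [proj_of_mem (hl ▸ word_mem hdeg l)]; exact h l hl
    · rw [proj_of_mem_ne (word_mem hdeg l) hl]; exact N.zero_mem
  exact this (mem_span_words hfree a)

/-- If all generators have positive degree, elements of degree `i` lie in each subalgebra that
contains the generators of degree at most `i`. -/
theorem mem_subalgebra_of_degree_le (hfree : Function.Bijective (FreeAlgebra.lift R gen))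
    {𝒜 : ℤ → Submodule R A}
    [GradedAlgebra 𝒜] {deg : X → ℤ} (hdeg : ∀ x, gen x ∈ 𝒜 (deg x)) (hpos : ∀ x, 1 ≤ deg x) {i : ℤ}
    (S : Subalgebra R A) (h : ∀ x, deg x ≤ i → gen x ∈ S) {a : A} (ha : a ∈ 𝒜 i) : a ∈ S := by
  refine graded_le_of_words hfree hdeg (N := Subalgebra.toSubmodule S) (fun l hl => ?_) ha
  have hn : ∀ l : List X, 0 ≤ (l.map deg).sum := fun l => List.sum_nonneg (by
    intro y hy; obtain ⟨x, -, rfl⟩ := List.mem_map.1 hy; linarith [hpos x])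
  suffices H : ∀ l : List X, (l.map deg).sum ≤ i → (l.map gen).prod ∈ S from H l hl.le
  intro l
  induction l with
  | nil => intro _; simp [S.one_mem]
  | cons x l ih =>
    intro hle
    simp only [List.map_cons, List.sum_cons, List.prod_cons] at hle ⊢
    exact S.mul_mem (h x (by linarith [hn l])) (ih (by linarith [hpos x]))

/-- The device for every reduction to generators below: the elements satisfying an identity are
shown to form a subalgebra. -/
theorem mem_subalgebra_of_gen (hfree : Function.Bijective (FreeAlgebra.lift R gen))
    (S : Subalgebra R A) (h : ∀ x, gen x ∈ S) (a : A) : a ∈ S := by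
  obtain ⟨y, rfl⟩ := hfree.2 a
  induction y using FreeAlgebra.induction with
  | grade0 r => rw [AlgHom.commutes]; exact S.algebraMap_mem r
  | grade1 x => simpa using h x
  | add a b ha hb => rw [map_add]; exact S.add_mem ha hb
  | mul a b ha hb => rw [map_mul]; exact S.mul_mem ha hb

variable {B : Type u} [Ring B] [Algebra R B]

/-- The algebra map with prescribed values on the generators. -/
def freeLift (c : X → B) : A →ₐ[R] B :=
  (FreeAlgebra.lift R c).comp (AlgEquiv.ofBijective _ hfree).symm.toAlgHom

theorem freeLift_gen (c : X → B) (x : X) : freeLift hfree c (gen x) = c x := by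
  have : (AlgEquiv.ofBijective _ hfree).symm (gen x) = FreeAlgebra.ι R x := by
    rw [AlgEquiv.symm_apply_eq]; simp
  simp [freeLift, this]

theorem free_hom_ext (hfree : Function.Bijective (FreeAlgebra.lift R gen))
    {f g : A →ₐ[R] B} (h : ∀ x, f (gen x) = g (gen x)) : f = g :=
  AlgHom.ext fun a => mem_subalgebra_of_gen hfree (AlgHom.equalizer f g) h a

/-- The matrix `(F, c; 0, G)`. -/
def derivMatrix (F G : A →ₐ[R] B) (c : X → B) : A →ₐ[R] Matrix (Fin 2) (Fin 2) B :=
  freeLift hfree fun x => !![F (gen x), c x; 0, G (gen x)]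

/-- Upper triangular matrices with diagonal (F, G) multiply so that the corner D obeys D(ab) = F(a)
D(b) + D(a) G(b). An algebra map into such matrices thus encodes a twisted derivation, and freeness
of A supplies the algebra map. -/
theorem derivMatrix_entries (F G : A →ₐ[R] B) (c : X → B) (a : A) :
    derivMatrix hfree F G c a 0 0 = F a ∧ derivMatrix hfree F G c a 1 0 = 0 ∧
      derivMatrix hfree F G c a 1 1 = G a := by
  refine mem_subalgebra_of_gen hfree
    { carrier := {a | derivMatrix hfree F G c a 0 0 = F a ∧ derivMatrix hfree F G c a 1 0 = 0 ∧
      derivMatrix hfree F G c a 1 1 = G a}, mul_mem' := ?_, add_mem' := ?_, algebraMap_mem' := ?_ }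
    ?_ a
  · rintro a b ⟨h1, h2, h3⟩ ⟨k1, k2, k3⟩
    simp [Matrix.mul_apply, Fin.sum_univ_two, h1, h2, h3, k1, k2, k3]
  · rintro a b ⟨h1, h2, h3⟩ ⟨k1, k2, k3⟩
    simp [h1, h2, h3, k1, k2, k3]
  · intro r
    simp [Matrix.algebraMap_matrix_apply]
  · intro x
    simp [derivMatrix, freeLift_gen]

/-- The `(F, G)`-derivation `D(ab) = F(a) D(b) + D(a) G(b)` with prescribed values on generators. -/
def derivLift (F G : A →ₐ[R] B) (c : X → B) : A →ₗ[R] B where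
  toFun a := derivMatrix hfree F G c a 0 1
  map_add' a b := by simp
  map_smul' r a := by simp

theorem derivLift_gen (F G : A →ₐ[R] B) (c : X → B) (x : X) :
    derivLift hfree F G c (gen x) = c x := by
  simp [derivLift, derivMatrix, freeLift_gen]

theorem derivLift_mul (F G : A →ₐ[R] B) (c : X → B) (a b : A) :
    derivLift hfree F G c (a * b) =
      F a * derivLift hfree F G c b + derivLift hfree F G c a * G b := by
  obtain ⟨h1, h2, h3⟩ := derivMatrix_entries hfree F G c a
  obtain ⟨k1, k2, k3⟩ := derivMatrix_entries hfree F G c b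
  change derivMatrix hfree F G c (a * b) 0 1 = F a * derivMatrix hfree F G c b 0 1 +
    derivMatrix hfree F G c a 0 1 * G b
  rw [map_mul, Matrix.mul_apply, Fin.sum_univ_two, h1, k3]

theorem deriv_map_one {F G : A →ₐ[R] B} {D : A →ₗ[R] B}
    (hD : ∀ a b, D (a * b) = F a * D b + D a * G b) : D 1 = 0 := by
  have := hD 1 1
  simpa using this

/-- The elements at which two `(F, G)`-derivations agree. -/
def derivEqualizer {F G : A →ₐ[R] B} {D E : A →ₗ[R] B}
    (hD : ∀ a b, D (a * b) = F a * D b + D a * G b)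
    (hE : ∀ a b, E (a * b) = F a * E b + E a * G b) : Subalgebra R A where
  carrier := {a | D a = E a}
  mul_mem' {a b} ha hb := by
    change D (a * b) = E (a * b)
    rw [hD, hE, show D a = E a from ha, show D b = E b from hb]
  add_mem' {a b} ha hb := by
    change D (a + b) = E (a + b)
    rw [map_add, map_add, show D a = E a from ha, show D b = E b from hb]
  algebraMap_mem' r := by
    change D _ = E _
    simp only [Algebra.algebraMap_eq_smul_one, map_smul, deriv_map_one hD, deriv_map_one hE]

theorem deriv_ext (hfree : Function.Bijective (FreeAlgebra.lift R gen))
    {F G : A →ₐ[R] B} {D E : A →ₗ[R] B}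
    (hD : ∀ a b, D (a * b) = F a * D b + D a * G b)
    (hE : ∀ a b, E (a * b) = F a * E b + E a * G b) (h : ∀ x, D (gen x) = E (gen x)) (a : A) :
    D a = E a :=
  mem_subalgebra_of_gen hfree (derivEqualizer hD hE) h a

variable {𝒜 : ℤ → Submodule R A} [GradedAlgebra 𝒜] {deg : X → ℤ}
  {ℬ : ℤ → Submodule R B} [GradedAlgebra ℬ]

theorem freeLift_mem (hdeg : ∀ x, gen x ∈ 𝒜 (deg x))
    {c : X → B} (hc : ∀ x, c x ∈ ℬ (deg x)) (i : ℤ) (a : A) (ha : a ∈ 𝒜 i) :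
    freeLift hfree c a ∈ ℬ i := by
  refine graded_le_of_words hfree hdeg (N := (ℬ i).comap (freeLift hfree c).toLinearMap)
    (fun l hl => ?_) ha
  subst hl
  have := word_mem (gen := c) hc l
  simpa [map_list_prod, Function.comp_def, freeLift_gen] using this

theorem deriv_mem (hfree : Function.Bijective (FreeAlgebra.lift R gen))
    (hdeg : ∀ x, gen x ∈ 𝒜 (deg x))
    {F G : A →ₐ[R] B} (hF : ∀ i, ∀ a ∈ 𝒜 i, F a ∈ ℬ i)
    (hG : ∀ i, ∀ a ∈ 𝒜 i, G a ∈ ℬ i) {D : A →ₗ[R] B}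
    (hD : ∀ a b, D (a * b) = F a * D b + D a * G b) {m : ℤ}
    (hc : ∀ x, D (gen x) ∈ ℬ (deg x + m)) (i : ℤ) (a : A) (ha : a ∈ 𝒜 i) : D a ∈ ℬ (i + m) := by
  refine graded_le_of_words hfree hdeg (N := (ℬ (i + m)).comap D) (fun l hl => ?_) ha
  clear ha
  subst hl
  induction l with
  | nil => simp [deriv_map_one hD]
  | cons x l ih =>
    simp only [Submodule.mem_comap, List.map_cons, List.prod_cons, List.sum_cons] at ih ⊢
    rw [hD]
    refine Submodule.add_mem _ ?_ ?_
    · rw [add_assoc]; exact SetLike.GradedMul.mul_mem (hF _ _ (hdeg x)) ih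
    · rw [show deg x + (l.map deg).sum + m = deg x + m + (l.map deg).sum by ring]
      exact SetLike.GradedMul.mul_mem (hc x) (hG _ _ (word_mem hdeg l))

end Free

/-- Recursive choice along a rank function. -/
theorem exists_of_step {X : Type*} {K : Type*} (rk : X → ℕ) (Good : (X → K) → X → Prop)
    (hloc : ∀ P P' x, P x = P' x → (∀ y, rk y < rk x → P y = P' y) → Good P x → Good P' x)
    (k₀ : X → K)
    (step : ∀ P x, (∀ y, rk y < rk x → Good P y) → (∀ y, rk x ≤ rk y → P y = k₀ y) →
      ∃ κ, ∀ P', P' x = κ → (∀ y, rk y < rk x → P' y = P y) → Good P' x) :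
    ∃ P, ∀ x, Good P x := by
  classical
  -- Values at rank at least that of x are filled in with the default `k₀`, so that `step` always
  -- receives a total function.
  let ext (x : X) (f : ∀ y, rk y < rk x → K) : X → K :=
    fun y => if h : rk y < rk x then f y h else k₀ y
  -- The `else` branch is never reached: the induction below shows that the extension is good at all
  -- lower ranks, and then `step` provides a value.
  let F (x : X) (f : ∀ y, rk y < rk x → K) : K :=
    if h : ∃ κ, ∀ P', P' x = κ → (∀ y, rk y < rk x → P' y = ext x f y) → Good P' x
    then h.choose else k₀ x
  let P : X → K := (measure rk).wf.fix F
  have hP : ∀ x, P x = F x (fun y _ => P y) := fun x => (measure rk).wf.fix_eq F x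
  refine ⟨P, fun x => ?_⟩
  induction hx : rk x using Nat.strong_induction_on generalizing x with
  | _ m ih =>
    subst hx
    have hlow : ∀ y, rk y < rk x → ext x (fun y _ => P y) y = P y := fun y hy => by
      simp only [ext, hy, dif_pos]
    have h : ∃ κ, ∀ P', P' x = κ →
        (∀ y, rk y < rk x → P' y = ext x (fun y _ => P y) y) → Good P' x := by
      refine step _ x (fun y hy => ?_) (fun y hy => ?_)
      · exact hloc P _ y (hlow y hy).symm (fun z hz => (hlow z (hz.trans hy)).symm) (ih _ hy y rfl)
      · simp only [ext, not_lt.2 hy, dif_neg, not_false_eq_true]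
    refine h.choose_spec P ?_ (fun y hy => (hlow y hy).symm)
    rw [hP x]
    exact dif_pos h

/-! ### Free generators, dga maps and derivation homotopies -/

section

variable {R : Type u} [CommRing R] {A : Type u} [Ring A] [Algebra R A]
  {B : Type u} [Ring B] [Algebra R B] {C : Type u} [Ring C] [Algebra R C]

/-- Free homogeneous algebra generators in positive degrees. -/
structure FreeGen (𝒜 : ℤ → Submodule R A) where
  X : Type u
  gen : X → A
  deg : X → ℤ
  free : Function.Bijective (FreeAlgebra.lift R gen)
  mem : ∀ x, gen x ∈ 𝒜 (deg x)
  pos : ∀ x, 1 ≤ deg x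

theorem HasGeneratorsInRange.freeGen {𝒜 : ℤ → Submodule R A} {r n : ℕ} (hr : 1 ≤ r)
    (h : HasGeneratorsInRange 𝒜 r n) : Nonempty (FreeGen 𝒜) := by
  obtain ⟨X, gen, deg, hfree, hx⟩ := h
  exact ⟨⟨X, gen, deg, hfree, fun x => (hx x).2.2, fun x => by have := (hx x).1; omega⟩⟩

/-- `f : (A, dA) → (B, dB)` is a map of differential graded algebras. -/
structure IsDGAMap (𝒜 : ℤ → Submodule R A) (ℬ : ℤ → Submodule R B)
    (dA : A →ₗ[R] A) (dB : B →ₗ[R] B) (f : A →ₐ[R] B) : Prop where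
  mem : ∀ i, ∀ a ∈ 𝒜 i, f a ∈ ℬ i
  map_d : ∀ a, f (dA a) = dB (f a)

variable {𝒜 : ℤ → Submodule R A} {ℬ : ℤ → Submodule R B} {𝒞 : ℤ → Submodule R C}
  {dA : A →ₗ[R] A} {dB : B →ₗ[R] B} {dC : C →ₗ[R] C}

theorem IsDGAMap.id : IsDGAMap 𝒜 𝒜 dA dA (AlgHom.id R A) := ⟨fun _ _ h => h, fun _ => rfl⟩

theorem IsDGAMap.comp {g : B →ₐ[R] C} {f : A →ₐ[R] B} (hg : IsDGAMap ℬ 𝒞 dB dC g)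
    (hf : IsDGAMap 𝒜 ℬ dA dB f) : IsDGAMap 𝒜 𝒞 dA dC (g.comp f) :=
  ⟨fun i a ha => hg.mem i _ (hf.mem i a ha), fun a => by simp [hf.map_d, hg.map_d]⟩

variable [GradedAlgebra 𝒜] [GradedAlgebra ℬ] [GradedAlgebra 𝒞]

theorem IsDGAMap.map_sgn {f : A →ₐ[R] B} (hf : IsDGAMap 𝒜 ℬ dA dB f) (a : A) :
    f (sgn 𝒜 a) = sgn ℬ (f a) :=
  (sgn_comm_even 𝒜 ℬ (f := f.toLinearMap) hf.mem a).symm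

theorem DerivHomotopic.refl (f : A →ₗ[R] B) : DerivHomotopic 𝒜 ℬ dA dB f f :=
  ⟨0, fun _ _ _ => Submodule.zero_mem _, by simp, by simp⟩

theorem DerivHomotopic.comp_left {f g : A →ₗ[R] B} (h : DerivHomotopic 𝒜 ℬ dA dB f g)
    {u : B →ₐ[R] C} (hu : IsDGAMap ℬ 𝒞 dB dC u) :
    DerivHomotopic 𝒜 𝒞 dA dC (u.toLinearMap ∘ₗ f) (u.toLinearMap ∘ₗ g) := by
  obtain ⟨s, hs⟩ := h
  refine ⟨u.toLinearMap ∘ₗ s, fun i a ha => hu.mem _ _ (hs.mem i a ha), fun a => ?_,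
    fun i a ha b => ?_⟩
  · simp [← hu.map_d, ← map_add, hs.htpy]
  · simp [hs.mul i a ha]

theorem DerivHomotopic.comp_right {f g : B →ₗ[R] C} (h : DerivHomotopic ℬ 𝒞 dB dC f g)
    {v : A →ₐ[R] B} (hv : IsDGAMap 𝒜 ℬ dA dB v) :
    DerivHomotopic 𝒜 𝒞 dA dC (f ∘ₗ v.toLinearMap) (g ∘ₗ v.toLinearMap) := by
  obtain ⟨s, hs⟩ := h
  refine ⟨s ∘ₗ v.toLinearMap, fun i a ha => hs.mem _ _ (hv.mem i a ha), fun a => ?_,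
    fun i a ha b => ?_⟩
  · simp [hv.map_d, hs.htpy]
  · simp [hs.mul i _ (hv.mem i a ha)]

/-- The elements on which `s` is a homotopy from `f` to `g` and `g` commutes with `d`. -/
def htpySubalgebra (hdA : IsDGA 𝒜 dA) (hdB : IsDGA ℬ dB) {f g : A →ₐ[R] B}
    (hf : IsDGAMap 𝒜 ℬ dA dB f) (hg : ∀ i, ∀ a ∈ 𝒜 i, g a ∈ ℬ i) {s : A →ₗ[R] B}
    (hs : ∀ i, ∀ a ∈ 𝒜 i, s a ∈ ℬ (i + 1))
    (mul : ∀ a b, s (a * b) = f (sgn 𝒜 a) * s b + s a * g b) : Subalgebra R A where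
  -- The second condition is carried along because in recursive constructions g commutes with the
  -- differentials only on the generators already treated, and the product rule for the first
  -- condition uses this for the right factor.
  carrier := {a | s (dA a) + dB (s a) = f a - g a ∧ g (dA a) = dB (g a)}
  mul_mem' {a b} ha hb := by
    obtain ⟨ha1, ha3⟩ := ha
    obtain ⟨hb1, hb3⟩ := hb
    have e1 : g (sgn 𝒜 a) = sgn ℬ (g a) :=
      (sgn_comm_even 𝒜 ℬ (f := g.toLinearMap) hg a).symm
    have e2 : s (sgn 𝒜 a) = - sgn ℬ (s a) := by rw [sgn_comm_up 𝒜 ℬ hs, neg_neg]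
    have e4 : dB (sgn ℬ (f a)) = - sgn ℬ (dB (f a)) := by rw [hdB.sgn_d, neg_neg]
    refine ⟨?_, ?_⟩
    · rw [hdA.mul, map_add, mul, mul, mul, map_add, hdB.mul, hdB.mul, sgn_sgn, hf.map_sgn,
        hf.map_sgn, hf.map_d, sgn_sgn, e2, e4, map_mul, map_mul, hb3]
      have : f a * f b - g a * g b = f a * (f b - g b) + (f a - g a) * g b := by noncomm_ring
      rw [this, ← ha1, ← hb1]
      noncomm_ring
    · rw [hdA.mul, map_add, map_mul, map_mul, map_mul, hdB.mul, ha3, hb3, e1]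
  add_mem' {a b} ha hb := by
    obtain ⟨ha1, ha3⟩ := ha
    obtain ⟨hb1, hb3⟩ := hb
    refine ⟨?_, ?_⟩
    · have := congr($ha1 + $hb1)
      simp only [map_add]
      rw [add_add_add_comm, this]; abel
    · simp [ha3, hb3]
  algebraMap_mem' r := by
    have h1 : s 1 = 0 := deriv_map_one (F := f.comp (sgn 𝒜)) mul
    refine ⟨?_, ?_⟩ <;>
    simp [Algebra.algebraMap_eq_smul_one, hdA.map_one, hdB.map_one, h1]

/-- On a free algebra it suffices to check a derivation homotopy on the generators. -/
theorem FreeGen.isDerivHomotopy (G : FreeGen 𝒜) (hdA : IsDGA 𝒜 dA) (hdB : IsDGA ℬ dB)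
    {f g : A →ₐ[R] B} (hf : IsDGAMap 𝒜 ℬ dA dB f) (hg : IsDGAMap 𝒜 ℬ dA dB g) {s : A →ₗ[R] B}
    (hs : ∀ i, ∀ a ∈ 𝒜 i, s a ∈ ℬ (i + 1))
    (mul : ∀ a b, s (a * b) = f (sgn 𝒜 a) * s b + s a * g b)
    (h : ∀ x, s (dA (G.gen x)) + dB (s (G.gen x)) = f (G.gen x) - g (G.gen x)) :
    IsDerivHomotopy 𝒜 ℬ dA dB f.toLinearMap g.toLinearMap s :=
  isDerivHomotopy_of_mul hs (fun a => (mem_subalgebra_of_gen G.free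
    (htpySubalgebra hdA hdB hf hg.mem hs mul) (fun x => ⟨h x, hg.map_d _⟩) a).1) mul

/-! ### Composition and inversion of derivation homotopies -/

section Cross

variable {X : Type u} {gen : X → A} (hfree : Function.Bijective (FreeAlgebra.lift R gen))

/-- The upper triangular matrix with rows `(P, m, 0)`, `(0, Q, n)`, `(0, 0, T)` on generators. -/
def crossMatrix (P Q T : A →ₐ[R] B) (m n : A →ₗ[R] B) : A →ₐ[R] Matrix (Fin 3) (Fin 3) B :=
  freeLift hfree fun x =>
    !![P (gen x), m (gen x), 0; 0, Q (gen x), n (gen x); 0, 0, T (gen x)]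

/-- The map `σ` with `σ(ab) = P(a) σ(b) + m(a) n(b) + σ(a) T(b)` that vanishes on generators. -/
def crossLift (P Q T : A →ₐ[R] B) (m n : A →ₗ[R] B) : A →ₗ[R] B where
  toFun a := crossMatrix hfree P Q T m n a 0 2
  map_add' a b := by simp
  map_smul' r a := by simp

variable {P Q T : A →ₐ[R] B} {m n : A →ₗ[R] B}

theorem crossLift_gen (x : X) : crossLift hfree P Q T m n (gen x) = 0 := by
  simp [crossLift, crossMatrix, freeLift_gen]

/-- This is the rule for the corner entry of a product of upper triangular 3 × 3 matrices. The other
entries are first identified with P, Q, T, m, n on the subalgebra `S`, which contains the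
generators. -/
theorem crossLift_mul (hm : ∀ a b, m (a * b) = P a * m b + m a * Q b)
    (hn : ∀ a b, n (a * b) = Q a * n b + n a * T b) (a b : A) :
    crossLift hfree P Q T m n (a * b) = P a * crossLift hfree P Q T m n b + m a * n b +
      crossLift hfree P Q T m n a * T b := by
  let M := crossMatrix hfree P Q T m n
  let S : Subalgebra R A :=
    { carrier := {a | (M a 0 0 = P a ∧ M a 0 1 = m a ∧ M a 1 1 = Q a) ∧ (M a 1 2 = n a ∧
        M a 2 2 = T a ∧ M a 1 0 = 0) ∧ M a 2 0 = 0 ∧ M a 2 1 = 0}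
      mul_mem' := by
        rintro a b ⟨⟨a1, a2, a3⟩, ⟨a4, a5, a6⟩, a7, a8⟩ ⟨⟨b1, b2, b3⟩, ⟨b4, b5, b6⟩, b7, b8⟩
        simp [Matrix.mul_apply, Fin.sum_univ_three, *]
      add_mem' := by
        rintro a b ⟨⟨a1, a2, a3⟩, ⟨a4, a5, a6⟩, a7, a8⟩ ⟨⟨b1, b2, b3⟩, ⟨b4, b5, b6⟩, b7, b8⟩
        simp [*]
      algebraMap_mem' := by
        intro r
        have h1 := deriv_map_one hm
        have h2 := deriv_map_one hn
        simp [Matrix.algebraMap_matrix_apply]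
        simp [Algebra.algebraMap_eq_smul_one, h1, h2] }
  have hS := mem_subalgebra_of_gen hfree S (fun x => by
    change (_ ∧ _ ∧ _) ∧ (_ ∧ _ ∧ _) ∧ _ ∧ _
    simp [M, crossMatrix, freeLift_gen])
  obtain ⟨⟨a1, a2, a3⟩, ⟨a4, a5, a6⟩, a7, a8⟩ := hS a
  obtain ⟨⟨b1, b2, b3⟩, ⟨b4, b5, b6⟩, b7, b8⟩ := hS b
  change M (a * b) 0 2 = P a * M b 0 2 + m a * n b + M a 0 2 * T b
  simp only [map_mul, Matrix.mul_apply, Fin.sum_univ_three, a1, a2, b4, b5]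

theorem crossLift_mem {deg : X → ℤ} (hdeg : ∀ x, gen x ∈ 𝒜 (deg x))
    (hm : ∀ a b, m (a * b) = P a * m b + m a * Q b)
    (hn : ∀ a b, n (a * b) = Q a * n b + n a * T b)
    (hP : ∀ i, ∀ a ∈ 𝒜 i, P a ∈ ℬ i)
    (hm' : ∀ i, ∀ a ∈ 𝒜 i, m a ∈ ℬ (i + 1)) (hn' : ∀ i, ∀ a ∈ 𝒜 i, n a ∈ ℬ (i + 1))
    (i : ℤ) (a : A) (ha : a ∈ 𝒜 i) : crossLift hfree P Q T m n a ∈ ℬ (i + 2) := by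
  refine graded_le_of_words hfree hdeg (N := (ℬ (i + 2)).comap (crossLift hfree P Q T m n))
    (fun l hl => ?_) ha
  clear ha
  subst hl
  induction l with
  | nil =>
    have := crossLift_mul hfree hm hn 1 1
    simp only [mul_one, map_one, one_mul, deriv_map_one hm, zero_mul, add_zero] at this
    simp [left_eq_add.1 this]
  | cons x l ih =>
    simp only [Submodule.mem_comap, List.map_cons, List.prod_cons, List.sum_cons] at ih ⊢
    rw [crossLift_mul hfree hm hn, crossLift_gen, zero_mul, add_zero]
    refine Submodule.add_mem _ ?_ ?_
    · rw [add_assoc]; exact SetLike.GradedMul.mul_mem (hP _ _ (hdeg x)) ih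
    · rw [show deg x + (l.map deg).sum + 2 = (deg x + 1) + ((l.map deg).sum + 1) by ring]
      exact SetLike.GradedMul.mul_mem (hm' _ _ (hdeg x)) (hn' _ _ (word_mem hdeg l))

end Cross

/-- If `s` is an `(f, g)`-derivation and `σ` has cross term `s (sgn a) * t b` for a
`(g, h)`-derivation `t`, then `s + t + dσ - σd` is an `(f, h)`-derivation up to the failure of `s`
and `t` to be homotopies. -/
theorem cross_boundary_mul (hdA : IsDGA 𝒜 dA) (hdB : IsDGA ℬ dB) {f g h : A →ₐ[R] B}
    (hf : IsDGAMap 𝒜 ℬ dA dB f) (hg : ∀ i, ∀ a ∈ 𝒜 i, g a ∈ ℬ i) (hh : IsDGAMap 𝒜 ℬ dA dB h)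
    {s t σ : A →ₗ[R] B} (hs : IsDerivHomotopy 𝒜 ℬ dA dB f.toLinearMap g.toLinearMap s)
    (ht : ∀ a b, t (a * b) = g (sgn 𝒜 a) * t b + t a * h b)
    (hσ : ∀ a b, σ (a * b) = f a * σ b + s (sgn 𝒜 a) * t b + σ a * h b)
    (hσ' : ∀ i, ∀ a ∈ 𝒜 i, σ a ∈ ℬ (i + 2)) (a b : A) :
    s (a * b) + t (a * b) + dB (σ (a * b)) - σ (dA (a * b)) =
      f (sgn 𝒜 a) * (s b + t b + dB (σ b) - σ (dA b)) +
        (s a + t a + dB (σ a) - σ (dA a)) * h b - s a * (t (dA b) + dB (t b) - (g b - h b)) := by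
  have hgs : g (sgn 𝒜 a) = sgn ℬ (g a) :=
    (sgn_comm_even 𝒜 ℬ (f := g.toLinearMap) hg a).symm
  have e1 : s (sgn 𝒜 a) = - sgn ℬ (s a) := by rw [sgn_comm_up 𝒜 ℬ hs.mem, neg_neg]
  have e2 : sgn ℬ (σ a) = σ (sgn 𝒜 a) := by
    rw [sgn_comm_of_degree 𝒜 ℬ 2 hσ']; norm_num
  have e3 : dB (sgn ℬ (s a)) = - sgn ℬ (dB (s a)) := by rw [hdB.sgn_d, neg_neg]
  have e4 : s (sgn 𝒜 (dA a)) = - sgn ℬ (s (dA a)) := by rw [sgn_comm_up 𝒜 ℬ hs.mem, neg_neg]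
  have e5 : sgn ℬ (dB (s a)) + sgn ℬ (s (dA a)) = sgn ℬ (f a) - sgn ℬ (g a) := by
    rw [← map_add, add_comm, hs.htpy]; simp
  have e6 : sgn ℬ (dB (s a)) = sgn ℬ (f a) - sgn ℬ (g a) - sgn ℬ (s (dA a)) := by
    rw [← e5]; abel
  have hs' := hs.mul'
  simp only [AlgHom.toLinearMap_apply] at hs'
  rw [hσ, hs', ht, hdA.mul, map_add σ, hσ, hσ, map_add dB, map_add dB, hdB.mul, hdB.mul, hdB.mul,
    hf.map_d, hh.map_d, hf.map_sgn, hgs, sgn_sgn, e1, e4, e2, map_neg, map_neg, e3, sgn_sgn, e6]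
  noncomm_ring

/-- The sum s + t satisfies the homotopy identity but is not an (f, h)-derivation. The correction dσ
- σd, where σ has the cross term s(`sgn` a) t(b) on products, repairs the product rule, and it does
not disturb the homotopy identity because d² = 0. -/
theorem FreeGen.trans (G : FreeGen 𝒜) (hdA : IsDGA 𝒜 dA) (hdB : IsDGA ℬ dB) {f g h : A →ₐ[R] B}
    (hf : IsDGAMap 𝒜 ℬ dA dB f) (hg : IsDGAMap 𝒜 ℬ dA dB g) (hh : IsDGAMap 𝒜 ℬ dA dB h)
    (h1 : DerivHomotopic 𝒜 ℬ dA dB f.toLinearMap g.toLinearMap)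
    (h2 : DerivHomotopic 𝒜 ℬ dA dB g.toLinearMap h.toLinearMap) :
    DerivHomotopic 𝒜 ℬ dA dB f.toLinearMap h.toLinearMap := by
  obtain ⟨s, hs⟩ := h1
  obtain ⟨t, ht⟩ := h2
  have hm : ∀ a b, (s ∘ₗ (sgn 𝒜).toLinearMap) (a * b) =
      f a * (s ∘ₗ (sgn 𝒜).toLinearMap) b + (s ∘ₗ (sgn 𝒜).toLinearMap) a * (g.comp (sgn 𝒜)) b := by
    intro a b; simp [hs.mul', sgn_sgn]
  have hn : ∀ a b, t (a * b) = (g.comp (sgn 𝒜)) a * t b + t a * h b := ht.mul'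
  let σ := crossLift G.free f (g.comp (sgn 𝒜)) h (s ∘ₗ (sgn 𝒜).toLinearMap) t
  have hσ : ∀ a b, σ (a * b) = f a * σ b + s (sgn 𝒜 a) * t b + σ a * h b :=
    crossLift_mul G.free hm hn
  have hσ' : ∀ i, ∀ a ∈ 𝒜 i, σ a ∈ ℬ (i + 2) :=
    crossLift_mem G.free G.mem hm hn hf.mem
      (fun i a ha => hs.mem _ _ (sgn_mem 𝒜 ha)) ht.mem
  refine ⟨s + t + dB ∘ₗ σ - σ ∘ₗ dA, isDerivHomotopy_of_mul (fun i a ha => ?_) (fun a => ?_)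
    (fun a b => ?_)⟩
  · refine Submodule.sub_mem _ (Submodule.add_mem _ (Submodule.add_mem _ (hs.mem _ _ ha)
      (ht.mem _ _ ha)) ?_) ?_
    · have := hdB.mem _ _ (hσ' _ _ ha)
      rwa [show i + 2 + -1 = i + 1 by ring] at this
    · have := hσ' _ _ (hdA.mem _ _ ha)
      rwa [show i + -1 + 2 = i + 1 by ring] at this
  · have e1 := hs.htpy a
    have e2 := ht.htpy a
    simp only [LinearMap.sub_apply, LinearMap.add_apply, LinearMap.comp_apply, hdA.d_d, hdB.d_d,
      map_sub, map_add, map_zero]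
    rw [← sub_add_sub_cancel (f.toLinearMap a) (g.toLinearMap a), ← e1, ← e2]
    abel
  · have := cross_boundary_mul hdA hdB hf hg.mem hh hs ht.mul' hσ hσ' a b
    have e := ht.htpy b
    simp only [AlgHom.toLinearMap_apply] at e
    simp only [LinearMap.sub_apply, LinearMap.add_apply, LinearMap.comp_apply,
      AlgHom.toLinearMap_apply]
    rw [this, e]; simp

end

/-! ### Recursion over the generators -/

section

variable {R : Type u} [CommRing R] {A : Type u} [Ring A] [Algebra R A]
  {B : Type u} [Ring B] [Algebra R B] {C : Type u} [Ring C] [Algebra R C]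
  {𝒜 : ℤ → Submodule R A} {ℬ : ℤ → Submodule R B} {𝒞 : ℤ → Submodule R C}
  {dA : A →ₗ[R] A} {dB : B →ₗ[R] B} {dC : C →ₗ[R] C}
  [GradedAlgebra 𝒜] [GradedAlgebra ℬ] [GradedAlgebra 𝒞]

/-- A word of degree i only involves generators of degree at most i, because all generators have
positive degree. This locality, also for the two variants that follow, makes recursion on the degree
possible: the differential of a generator only involves generators of lower degree. -/
theorem FreeGen.freeLift_congr (G : FreeGen 𝒜) {c c' : G.X → B} {i : ℤ}
    (h : ∀ x, G.deg x ≤ i → c x = c' x) {a : A} (ha : a ∈ 𝒜 i) :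
    freeLift G.free c a = freeLift G.free c' a := by
  refine mem_subalgebra_of_degree_le G.free G.mem G.pos
    (AlgHom.equalizer (freeLift G.free c) (freeLift G.free c')) (fun x hx => ?_) ha
  rw [AlgHom.mem_equalizer, freeLift_gen, freeLift_gen, h x hx]

theorem FreeGen.derivLift_congr (G : FreeGen 𝒜) {F F' T T' : A →ₐ[R] B} {c c' : G.X → B} {i : ℤ}
    (h : ∀ x, G.deg x ≤ i → F (G.gen x) = F' (G.gen x) ∧ T (G.gen x) = T' (G.gen x) ∧ c x = c' x)
    {a : A} (ha : a ∈ 𝒜 i) :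
    derivLift G.free F T c a = derivLift G.free F' T' c' a := by
  have : derivMatrix G.free F T c a = derivMatrix G.free F' T' c' a :=
    G.freeLift_congr (fun x hx => by obtain ⟨h1, h2, h3⟩ := h x hx; rw [h1, h2, h3]) ha
  exact congr($this 0 1)

theorem FreeGen.crossLift_congr (G : FreeGen 𝒜) {P Q T : A →ₐ[R] B} {m n n' : A →ₗ[R] B} {i : ℤ}
    (h : ∀ x, G.deg x ≤ i → n (G.gen x) = n' (G.gen x)) {a : A} (ha : a ∈ 𝒜 i) :
    crossLift G.free P Q T m n a = crossLift G.free P Q T m n' a := by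
  have : crossMatrix G.free P Q T m n a = crossMatrix G.free P Q T m n' a :=
    G.freeLift_congr (fun x hx => by rw [h x hx]) ha
  exact congr($this 0 2)

/-- The rank of a generator, used for recursion. -/
def FreeGen.rk (G : FreeGen 𝒜) (x : G.X) : ℕ := (G.deg x).toNat

theorem FreeGen.rk_lt (G : FreeGen 𝒜) {x y : G.X} (h : G.deg y ≤ G.deg x + -1) :
    G.rk y < G.rk x := by
  have := G.pos x; have := G.pos y; unfold FreeGen.rk; omega

theorem FreeGen.d_mem (G : FreeGen 𝒜) (hdA : IsDGA 𝒜 dA) (x : G.X) :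
    dA (G.gen x) ∈ 𝒜 (G.deg x + -1) := hdA.mem _ _ (G.mem x)

/-- The reverse homotopy t is determined by requiring the composite s + t + dσ - σd of
`FreeGen.trans` to vanish. As σ is zero on generators, this reads t(x) = -s(x) + σ(dx) there, and
σ(dx) depends on t only at generators of lower degree; so t can be defined recursively. -/
theorem FreeGen.symm (G : FreeGen 𝒜) (hdA : IsDGA 𝒜 dA) (hdB : IsDGA ℬ dB) {f g : A →ₐ[R] B}
    (hf : IsDGAMap 𝒜 ℬ dA dB f) (hg : IsDGAMap 𝒜 ℬ dA dB g)
    (h : DerivHomotopic 𝒜 ℬ dA dB f.toLinearMap g.toLinearMap) :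
    DerivHomotopic 𝒜 ℬ dA dB g.toLinearMap f.toLinearMap := by
  obtain ⟨s, hs⟩ := h
  let m := s ∘ₗ (sgn 𝒜).toLinearMap
  have hm : ∀ a b, m (a * b) = f a * m b + m a * (g.comp (sgn 𝒜)) b := by
    intro a b; simp [m, hs.mul', sgn_sgn]
  have hm' : ∀ i, ∀ a ∈ 𝒜 i, m a ∈ ℬ (i + 1) := fun i a ha => hs.mem _ _ (sgn_mem 𝒜 ha)
  let t (c : G.X → B) : A →ₗ[R] B := derivLift G.free (g.comp (sgn 𝒜)) f c
  have ht : ∀ c a b, t c (a * b) = (g.comp (sgn 𝒜)) a * t c b + t c a * f b :=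
    fun c => derivLift_mul G.free _ _ c
  have ht' : ∀ c : G.X → B, (∀ x, c x ∈ ℬ (G.deg x + 1)) → ∀ i, ∀ a ∈ 𝒜 i, t c a ∈ ℬ (i + 1) :=
    fun c hc => deriv_mem (F := g.comp (sgn 𝒜)) G.free G.mem (fun i a ha => hg.mem _ _ (sgn_mem 𝒜 ha)) hf.mem (ht c)
      (fun x => by simpa only [t, derivLift_gen] using hc x)
  let σ (c : G.X → B) : A →ₗ[R] B := crossLift G.free f (g.comp (sgn 𝒜)) f m (t c)
  have hσ : ∀ c a b, σ c (a * b) = f a * σ c b + s (sgn 𝒜 a) * t c b + σ c a * f b :=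
    fun c => crossLift_mul G.free hm (ht c)
  have hσ' : ∀ c : G.X → B, (∀ x, c x ∈ ℬ (G.deg x + 1)) → ∀ i, ∀ a ∈ 𝒜 i, σ c a ∈ ℬ (i + 2) :=
    fun c hc => crossLift_mem G.free G.mem hm (ht c) hf.mem hm' (ht' c hc)
  have hloc : ∀ (c c' : G.X → B) x, (∀ y, G.rk y < G.rk x → c y = c' y) →
      σ c (dA (G.gen x)) = σ c' (dA (G.gen x)) := fun c c' x h =>
    G.crossLift_congr (fun y hy => by
      simp only [t, derivLift_gen]; exact h y (G.rk_lt hy)) (G.d_mem hdA x)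
  obtain ⟨c, hc⟩ := exists_of_step G.rk
    (fun c x => c x ∈ ℬ (G.deg x + 1) ∧ c x = - s (G.gen x) + σ c (dA (G.gen x)))
    (fun c c' x hx hlow h => by rw [← hx, ← hloc c c' x hlow]; exact h) 0
    (fun c x hlow hdef => by
      have hc : ∀ y, c y ∈ ℬ (G.deg y + 1) := fun y => by
        rcases lt_or_ge (G.rk y) (G.rk x) with h | h
        · exact (hlow y h).1
        · rw [hdef y h]; exact Submodule.zero_mem _
      refine ⟨- s (G.gen x) + σ c (dA (G.gen x)), fun c' hx hc' => ⟨?_, ?_⟩⟩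
      · rw [hx]
        refine Submodule.add_mem _ (Submodule.neg_mem _ (hs.mem _ _ (G.mem x))) ?_
        have := hσ' c hc _ _ (G.d_mem hdA x)
        rwa [show G.deg x + -1 + 2 = G.deg x + 1 by ring] at this
      · rw [hx, hloc c' c x hc'])
  have hcm := fun x => (hc x).1
  have hmul : ∀ a b, t c (a * b) = g (sgn 𝒜 a) * t c b + t c a * f b := ht c
  let S := htpySubalgebra hdA hdB hg hf.mem (ht' c hcm) hmul
  have h1 : t c 1 = 0 := deriv_map_one (ht c)
  have h2 : s 1 = 0 := deriv_map_one (F := f.comp (sgn 𝒜)) hs.mul'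
  -- The vanishing of the composite and the homotopy identity for t must be proved together: the
  -- defect formula `cross_boundary_mul` at a product contains the failure of the homotopy identity
  -- for t at the right factor.
  let S' : Subalgebra R A :=
    { carrier := {a | a ∈ S ∧ s a + t c a + dB (σ c a) - σ c (dA a) = 0}
      mul_mem' := by
        rintro a b ⟨ha, ha'⟩ ⟨hb, hb'⟩
        refine ⟨S.mul_mem ha hb, ?_⟩
        have hb1 : t c (dA b) + dB (t c b) = g b - f b := hb.1
        rw [cross_boundary_mul hdA hdB hf hg.mem hf hs hmul (hσ c) (hσ' c hcm), ha', hb', hb1]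
        simp
      add_mem' := by
        rintro a b ⟨ha, ha'⟩ ⟨hb, hb'⟩
        refine ⟨S.add_mem ha hb, ?_⟩
        have := congr($ha' + $hb')
        rw [add_zero] at this
        simp only [map_add]
        rw [← this]; abel
      algebraMap_mem' := fun r => by
        refine ⟨S.algebraMap_mem r, ?_⟩
        have := hσ c 1 1
        simp only [mul_one, map_one, one_mul, h1, mul_zero, add_zero] at this
        simp [Algebra.algebraMap_eq_smul_one, h1, h2, hdA.map_one, left_eq_add.1 this] }
  have hS' : ∀ x, G.gen x ∈ S' := by
    intro x
    induction hx : G.rk x using Nat.strong_induction_on generalizing x with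
    | _ k ih =>
      subst hx
      have hd : dA (G.gen x) ∈ S' := mem_subalgebra_of_degree_le G.free G.mem G.pos S'
        (fun y hy => ih _ (G.rk_lt hy) y rfl) (G.d_mem hdA x)
      have e0 : t c (G.gen x) = - s (G.gen x) + σ c (dA (G.gen x)) := by
        rw [← (hc x).2]; exact derivLift_gen _ _ _ _ _
      have e1 : s (dA (G.gen x)) + t c (dA (G.gen x)) + dB (σ c (dA (G.gen x))) -
        σ c (dA (dA (G.gen x))) = 0 := hd.2
      rw [hdA.d_d, map_zero, sub_zero] at e1
      have e2 := hs.htpy (G.gen x)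
      refine ⟨⟨?_, hf.map_d _⟩, ?_⟩
      · rw [e0, map_add, map_neg]
        have e3 : t c (dA (G.gen x)) = - s (dA (G.gen x)) - dB (σ c (dA (G.gen x))) := by
          rw [← sub_eq_zero, ← e1]; abel
        rw [e3, ← neg_sub (f (G.gen x))]
        simp only [AlgHom.toLinearMap_apply] at e2
        rw [← e2]; abel
      · rw [e0]
        simp [σ, crossLift_gen]
  refine ⟨t c, G.isDerivHomotopy hdA hdB hg hf (ht' c hcm) hmul fun x => (hS' x).1.1⟩

/-- The elements on which `p` commutes with the differentials. -/
def chainSubalgebra (hdA : IsDGA 𝒜 dA) (hdB : IsDGA ℬ dB) {p : A →ₐ[R] B}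
    (hp : ∀ i, ∀ a ∈ 𝒜 i, p a ∈ ℬ i) : Subalgebra R A where
  carrier := {a | p (dA a) = dB (p a)}
  mul_mem' {a b} ha hb := by
    have e1 : p (sgn 𝒜 a) = sgn ℬ (p a) :=
      (sgn_comm_even 𝒜 ℬ (f := p.toLinearMap) hp a).symm
    change p (dA (a * b)) = dB (p (a * b))
    rw [hdA.mul, map_add, map_mul, map_mul, map_mul, hdB.mul, show p (dA a) = dB (p a) from ha,
      show p (dA b) = dB (p b) from hb, e1]
  add_mem' {a b} ha hb := by
    change p (dA (a + b)) = dB (p (a + b))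
    rw [map_add, map_add, map_add, map_add, show p (dA a) = dB (p a) from ha,
      show p (dA b) = dB (p b) from hb]
  algebraMap_mem' r := by
    change p (dA _) = dB (p _)
    simp [Algebra.algebraMap_eq_smul_one, hdA.map_one, hdB.map_one]

/-- Lifting a map `k : A → C` of dga's through `φ : B → C` up to derivation homotopy, generator by
generator, for free `A`.  `Ok` is a condition to be maintained on the values of the lift and of the
homotopy at the generators; it holds for the initial values `(b₀, 0)`. -/
theorem FreeGen.exists_lift (G : FreeGen 𝒜) (hdA : IsDGA 𝒜 dA) (hdB : IsDGA ℬ dB)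
    (hdC : IsDGA 𝒞 dC) {φ : B →ₐ[R] C} (hφ : IsDGAMap ℬ 𝒞 dB dC φ) {k : A →ₐ[R] C}
    (hk : IsDGAMap 𝒜 𝒞 dA dC k) (Ok : G.X → B → C → Prop) (b₀ : G.X → B)
    (hb₀ : ∀ x, b₀ x ∈ ℬ (G.deg x)) (hOk : ∀ x, Ok x (b₀ x) 0)
    (step : ∀ x (p : A →ₐ[R] B) (s : A →ₗ[R] C), (∀ i, ∀ a ∈ 𝒜 i, p a ∈ ℬ i) →
      (∀ i, ∀ a ∈ 𝒜 i, s a ∈ 𝒞 (i + 1)) →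
      (∀ a b, s (a * b) = k (sgn 𝒜 a) * s b + s a * φ (p b)) →
      (∀ y, Ok y (p (G.gen y)) (s (G.gen y))) →
      dB (p (dA (G.gen x))) = 0 →
      φ (p (dA (G.gen x))) = dC (k (G.gen x) - s (dA (G.gen x))) →
      ∃ b ∈ ℬ (G.deg x), ∃ c ∈ 𝒞 (G.deg x + 1), dB b = p (dA (G.gen x)) ∧
        φ b = k (G.gen x) - s (dA (G.gen x)) - dC c ∧ Ok x b c) :
    ∃ (p : A →ₐ[R] B) (s : A →ₗ[R] C), IsDGAMap 𝒜 ℬ dA dB p ∧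
      IsDerivHomotopy 𝒜 𝒞 dA dC k.toLinearMap (φ.comp p).toLinearMap s ∧
      ∀ x, Ok x (p (G.gen x)) (s (G.gen x)) := by
  let p (P : G.X → B × C) : A →ₐ[R] B := freeLift G.free fun x => (P x).1
  have hpg : ∀ P x, p P (G.gen x) = (P x).1 := fun P x => freeLift_gen _ _ _
  let s (P : G.X → B × C) : A →ₗ[R] C :=
    derivLift G.free (k.comp (sgn 𝒜)) (φ.comp (p P)) fun x => (P x).2
  have hsg : ∀ P x, s P (G.gen x) = (P x).2 := fun P x => derivLift_gen _ _ _ _ _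
  have hs : ∀ P a b, s P (a * b) = k (sgn 𝒜 a) * s P b + s P a * φ (p P b) :=
    fun P => derivLift_mul _ _ _ _
  have hpm : ∀ P : G.X → B × C, (∀ x, (P x).1 ∈ ℬ (G.deg x)) → ∀ i, ∀ a ∈ 𝒜 i, p P a ∈ ℬ i :=
    fun P hP => freeLift_mem G.free G.mem hP
  have hsm : ∀ P : G.X → B × C, (∀ x, (P x).1 ∈ ℬ (G.deg x)) →
      (∀ x, (P x).2 ∈ 𝒞 (G.deg x + 1)) → ∀ i, ∀ a ∈ 𝒜 i, s P a ∈ 𝒞 (i + 1) := fun P hP hP' =>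
    deriv_mem (F := k.comp (sgn 𝒜)) (G := φ.comp (p P)) G.free G.mem
      (fun i a ha => hk.mem _ _ (sgn_mem 𝒜 ha))
      (fun i a ha => hφ.mem _ _ (hpm P hP _ _ ha)) (hs P) (fun x => by rw [hsg]; exact hP' x)
  have hploc : ∀ (P P' : G.X → B × C) x, (∀ y, G.rk y < G.rk x → P y = P' y) →
      p P (dA (G.gen x)) = p P' (dA (G.gen x)) := fun P P' x h =>
    G.freeLift_congr (fun y hy => by rw [h y (G.rk_lt hy)]) (G.d_mem hdA x)
  have hsloc : ∀ (P P' : G.X → B × C) x, (∀ y, G.rk y < G.rk x → P y = P' y) →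
      s P (dA (G.gen x)) = s P' (dA (G.gen x)) := fun P P' x h =>
    G.derivLift_congr (fun y hy => by
      have := h y (G.rk_lt hy)
      simp [hpg, this]) (G.d_mem hdA x)
  -- `P x` holds the values of the lift and of the homotopy at the generator. The two equations say
  -- that the lift commutes with d there and that s d + d s = k - φ p there.
  obtain ⟨P, hP⟩ := exists_of_step G.rk
    (fun P x => ((P x).1 ∈ ℬ (G.deg x) ∧ (P x).2 ∈ 𝒞 (G.deg x + 1) ∧ Ok x (P x).1 (P x).2) ∧
      dB (P x).1 = p P (dA (G.gen x)) ∧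
      φ (P x).1 = k (G.gen x) - s P (dA (G.gen x)) - dC (P x).2)
    (fun P P' x hx hlow h => by rw [← hx, ← hploc P P' x hlow, ← hsloc P P' x hlow]; exact h)
    (fun x => (b₀ x, 0))
    (fun P x hlow hdef => by
      -- The default values also satisfy the degree conditions and `Ok`, so the partial lift and
      -- homotopy are homogeneous everywhere even though their equations only hold in lower degrees.
      have hall : ∀ y, (P y).1 ∈ ℬ (G.deg y) ∧ (P y).2 ∈ 𝒞 (G.deg y + 1) ∧
          Ok y (P y).1 (P y).2 := fun y => by
        rcases lt_or_ge (G.rk y) (G.rk x) with h | h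
        · exact (hlow y h).1
        · rw [hdef y h]; exact ⟨hb₀ y, Submodule.zero_mem _, hOk y⟩
      have hp' := hpm P fun y => (hall y).1
      have hs' := hsm P (fun y => (hall y).1) fun y => (hall y).2.1
      have hlow1 : ∀ y, G.deg y ≤ G.deg x + -1 → G.gen y ∈ chainSubalgebra hdA hdB hp' := by
        intro y hy
        change p P _ = dB (p P _)
        rw [hpg, (hlow y (G.rk_lt hy)).2.1]
      have hlow2 : ∀ y, G.deg y ≤ G.deg x + -1 → G.gen y ∈ htpySubalgebra (g := φ.comp (p P))
          hdA hdC hk (fun i a ha => hφ.mem _ _ (hp' _ _ ha)) hs' (hs P) := by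
        intro y hy
        obtain ⟨-, h1, h2⟩ := hlow y (G.rk_lt hy)
        refine ⟨?_, ?_⟩
        · simp only [AlgHom.comp_apply, hpg, hsg, h2]; abel
        · simp only [AlgHom.comp_apply, hpg, ← hφ.map_d, h1]
      -- The identities already known, applied to the differential of the generator, show that p(dx)
      -- is a cycle and that φ(p(dx)) is the boundary of k(x) - s(dx). This is the lifting problem
      -- handed to `step`.
      have e1 : p P (dA (dA (G.gen x))) = dB (p P (dA (G.gen x))) :=
        mem_subalgebra_of_degree_le G.free G.mem G.pos _ hlow1 (G.d_mem hdA x)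
      have e2 : s P (dA (dA (G.gen x))) + dC (s P (dA (G.gen x))) =
          k (dA (G.gen x)) - φ (p P (dA (G.gen x))) :=
        (mem_subalgebra_of_degree_le G.free G.mem G.pos _ hlow2 (G.d_mem hdA x)).1
      rw [hdA.d_d, map_zero] at e1 e2
      rw [zero_add] at e2
      obtain ⟨b, hb, c, hc, h1, h2, h3⟩ := step x (p P) (s P) hp' hs' (hs P)
        (fun y => by rw [hpg, hsg]; exact (hall y).2.2) e1.symm
        (by rw [map_sub, e2, hk.map_d]; abel)
      exact ⟨(b, c), fun P' hx hP' => by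
        rw [hx, hploc P' P x hP', hsloc P' P x hP']; exact ⟨⟨hb, hc, h3⟩, h1, h2⟩⟩)
  have hp' := hpm P fun y => (hP y).1.1
  have hs' := hsm P (fun y => (hP y).1.1) fun y => (hP y).1.2.1
  have hpd : IsDGAMap 𝒜 ℬ dA dB (p P) := ⟨hp', fun a => mem_subalgebra_of_gen G.free
    (chainSubalgebra hdA hdB hp') (fun x => by
      change p P _ = dB (p P _)
      rw [hpg, (hP x).2.1]) a⟩
  refine ⟨p P, s P, hpd, G.isDerivHomotopy hdA hdC hk (hφ.comp hpd) hs' (hs P) fun x => ?_,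
    fun x => by rw [hpg, hsg]; exact (hP x).1.2.2⟩
  simp only [AlgHom.comp_apply, hpg, hsg, (hP x).2.2]; abel

/-! ### Quasi-isomorphisms -/

/-- `φ` is injective and surjective on homology. -/
structure IsQuasiIso (dB : B →ₗ[R] B) (dC : C →ₗ[R] C) (φ : B → C) : Prop where
  inj : ∀ b, dB b = 0 → (∃ c, dC c = φ b) → ∃ b', dB b' = b
  surj : ∀ c, dC c = 0 → ∃ b, dB b = 0 ∧ ∃ c', dC c' = φ b - c

/-- Injectivity on homology gives some b₁ with boundary b. Then φ(b₁) - u is a cycle, which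
surjectivity on homology matches with a cycle b₂ up to a boundary. The difference b₁ - b₂, projected
to degree i, is the required lift. -/
theorem IsQuasiIso.exists_lift {φ : B →ₐ[R] C} (h : IsQuasiIso dB dC φ) (hdB : IsDGA ℬ dB)
    (hdC : IsDGA 𝒞 dC)
    (hφ : IsDGAMap ℬ 𝒞 dB dC φ) {i : ℤ} {b : B} (hb : b ∈ ℬ (i + -1)) {u : C} (hu : u ∈ 𝒞 i)
    (hdb : dB b = 0) (hub : φ b = dC u) :
    ∃ b' ∈ ℬ i, ∃ c ∈ 𝒞 (i + 1), dB b' = b ∧ φ b' = u - dC c := by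
  obtain ⟨b₁, rfl⟩ := h.inj b hdb ⟨u, hub.symm⟩
  obtain ⟨b₂, h2, c, hc⟩ := h.surj (φ b₁ - u) (by rw [map_sub, ← hub, hφ.map_d, sub_self])
  refine ⟨GradedAlgebra.proj ℬ i (b₁ - b₂), proj_mem _ _ _, GradedAlgebra.proj 𝒞 (i + 1) c,
    proj_mem _ _ _, ?_, ?_⟩
  · rw [← proj_comm ℬ ℬ hdB.mem (i := i) rfl, map_sub, h2, sub_zero, proj_of_mem hb]
  · rw [← proj_comm 𝒞 𝒞 hdC.mem (i := i + 1) (j := i) (by ring), hc]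
    have := proj_comm ℬ 𝒞 (f := φ.toLinearMap) (m := 0) (by simpa using hφ.mem) (i := i) (j := i)
      (by ring) (b₁ - b₂)
    simp only [AlgHom.toLinearMap_apply] at this
    rw [← this]
    simp only [map_sub, proj_of_mem hu]
    abel

/-- Lifting through a quasi-isomorphism, up to derivation homotopy. -/
theorem FreeGen.exists_lift_of_quasiIso (G : FreeGen 𝒜) (hdA : IsDGA 𝒜 dA) (hdB : IsDGA ℬ dB)
    (hdC : IsDGA 𝒞 dC) {φ : B →ₐ[R] C} (hφ : IsDGAMap ℬ 𝒞 dB dC φ) (h : IsQuasiIso dB dC φ)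
    {k : A →ₐ[R] C} (hk : IsDGAMap 𝒜 𝒞 dA dC k) :
    ∃ p : A →ₐ[R] B, IsDGAMap 𝒜 ℬ dA dB p ∧
      DerivHomotopic 𝒜 𝒞 dA dC k.toLinearMap (φ.comp p).toLinearMap := by
  obtain ⟨p, s, hp, hs, -⟩ := G.exists_lift hdA hdB hdC hφ hk (fun _ _ _ => True) 0
    (fun _ => Submodule.zero_mem _) (fun _ => trivial)
    (fun x p s hp hs _ _ h1 h2 => by
      obtain ⟨b, hb, c, hc, h3, h4⟩ := h.exists_lift hdB hdC hφ (hp _ _ (G.d_mem hdA x))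
        (u := k (G.gen x) - s (dA (G.gen x)))
        (Submodule.sub_mem _ (hk.mem _ _ (G.mem x)) (by
          have := hs _ _ (G.d_mem hdA x)
          rwa [neg_add_cancel_right] at this)) h1 h2
      exact ⟨b, hb, c, hc, h3, h4, trivial⟩)
  exact ⟨p, hp, s, hs⟩

theorem IsQuasiIso.id : IsQuasiIso dA dA (AlgHom.id R A) :=
  ⟨fun _ _ h => h, fun c hc => ⟨c, hc, 0, by simp⟩⟩

theorem DerivHomotopic.exists_boundary {f g : A →ₗ[R] B} (h : DerivHomotopic 𝒜 ℬ dA dB f g) {a : A}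
    (ha : dA a = 0) : ∃ b, dB b = f a - g a := by
  obtain ⟨s, hs⟩ := h
  exact ⟨s a, by rw [← hs.htpy, ha, map_zero, zero_add]⟩

/-- Homology isomorphisms satisfy two out of three: here `e ∘ l ≃ f`. -/
theorem IsQuasiIso.of_comp {e : B →ₐ[R] C} {l : A →ₐ[R] B} {f : A →ₐ[R] C}
    (he : IsQuasiIso dB dC e) (hed : ∀ b, e (dB b) = dC (e b)) (hf : IsQuasiIso dA dC f)
    (hl : IsDGAMap 𝒜 ℬ dA dB l)
    (h : DerivHomotopic 𝒜 𝒞 dA dC f.toLinearMap (e.comp l).toLinearMap) : IsQuasiIso dA dB l := by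
  constructor
  · rintro a ha ⟨b, hb⟩
    obtain ⟨c, hc⟩ := h.exists_boundary ha
    refine hf.inj a ha ⟨c + e b, ?_⟩
    rw [map_add, hc, ← hed, hb]; simp
  · intro b hb
    obtain ⟨a, ha, c, hc⟩ := hf.surj (e b) (by rw [← hed, hb, map_zero])
    obtain ⟨c', hc'⟩ := h.exists_boundary ha
    obtain ⟨b', hb'⟩ := he.inj (l a - b) (by rw [map_sub, ← hl.map_d, ha, hb]; simp)
      ⟨c - c', by rw [map_sub, hc, hc']; simp⟩
    exact ⟨a, ha, b', hb'⟩

theorem IsQuasiIso.comp {e : B →ₐ[R] C} {l : A →ₐ[R] B} (he : IsQuasiIso dB dC e)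
    (hed : ∀ b, e (dB b) = dC (e b)) (hl : IsQuasiIso dA dB l) (hld : ∀ b, l (dA b) = dB (l b)) :
    IsQuasiIso dA dC (e.comp l) := by
  constructor
  · rintro a ha hc
    exact hl.inj a ha (he.inj _ (by rw [← hld, ha, map_zero]) hc)
  · intro c hc
    obtain ⟨b, hb, c', hc'⟩ := he.surj c hc
    obtain ⟨a, ha, b', hb'⟩ := hl.surj b hb
    exact ⟨a, ha, e b' + c', by rw [map_add, ← hed, hb', hc', map_sub]; simp⟩

theorem IsQuasiIso.of_homotopic {f g : A →ₐ[R] B} (hf : IsQuasiIso dA dB f)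
    (h : DerivHomotopic 𝒜 ℬ dA dB f.toLinearMap g.toLinearMap) : IsQuasiIso dA dB g := by
  constructor
  · rintro a ha ⟨c, hc⟩
    obtain ⟨b, hb⟩ := h.exists_boundary ha
    exact hf.inj a ha ⟨b + c, by rw [map_add, hb, hc]; simp⟩
  · intro c hc
    obtain ⟨a, ha, b', hb'⟩ := hf.surj c hc
    obtain ⟨b, hb⟩ := h.exists_boundary ha
    exact ⟨a, ha, b' - b, by rw [map_sub, hb, hb']; simp⟩

/-- A quasi-isomorphism between free dga's has an inverse up to derivation homotopy. -/
theorem IsQuasiIso.exists_inverse (G : FreeGen 𝒜) (G' : FreeGen ℬ) (hdA : IsDGA 𝒜 dA)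
    (hdB : IsDGA ℬ dB) {f : A →ₐ[R] B} (hf : IsDGAMap 𝒜 ℬ dA dB f) (h : IsQuasiIso dA dB f) :
    ∃ g : B →ₐ[R] A, IsDGAMap ℬ 𝒜 dB dA g ∧
      DerivHomotopic ℬ ℬ dB dB (f.comp g).toLinearMap LinearMap.id ∧
      DerivHomotopic 𝒜 𝒜 dA dA (g.comp f).toLinearMap LinearMap.id := by
  obtain ⟨g, hg, h1⟩ := G'.exists_lift_of_quasiIso hdB hdA hdB hf h IsDGAMap.id
  have hgq : IsQuasiIso dB dA g := h.of_comp hf.map_d IsQuasiIso.id hg h1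
  obtain ⟨f', hf', h2⟩ := G.exists_lift_of_quasiIso hdA hdB hdA hg hgq IsDGAMap.id
  have h1' := G'.symm hdB hdB IsDGAMap.id (hf.comp hg) h1
  refine ⟨g, hg, h1', ?_⟩
  -- Now g has the right inverse f', and f has the right inverse g. Hence f ≃ f g f' ≃ f', and
  -- therefore g f ≃ g f' ≃ 1.
  have e1 : DerivHomotopic 𝒜 ℬ dA dB f.toLinearMap (f.comp (g.comp f')).toLinearMap :=
    h2.comp_left hf
  have e2 : DerivHomotopic 𝒜 ℬ dA dB (f.comp (g.comp f')).toLinearMap f'.toLinearMap :=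
    h1'.comp_right hf'
  have e3 : DerivHomotopic 𝒜 ℬ dA dB f.toLinearMap f'.toLinearMap :=
    G.trans hdA hdB hf (hf.comp (hg.comp hf')) hf' e1 e2
  have e4 : DerivHomotopic 𝒜 𝒜 dA dA (g.comp f).toLinearMap (g.comp f').toLinearMap :=
    e3.comp_left hg
  exact G.trans hdA hdA (hg.comp hf) (hg.comp hf') IsDGAMap.id e4
    (G.symm hdA hdA IsDGAMap.id (hg.comp hf') h2)

end

/-! ### Pure tensors and Koszul signs -/

section

variable {R : Type u} [CommRing R]
variable {A : Type u} [Ring A] [Algebra R A] {𝒜 : ℤ → Submodule R A} [GradedAlgebra 𝒜]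
variable {B : Type u} [Ring B] [Algebra R B] {ℬ : ℤ → Submodule R B} [GradedAlgebra ℬ]
variable {C : Type u} [Ring C] [Algebra R C] {𝒞 : ℤ → Submodule R C} [GradedAlgebra 𝒞]
variable {D : Type u} [Ring D] [Algebra R D] {𝒟 : ℤ → Submodule R D} [GradedAlgebra 𝒟]
variable {A' : Type u} [Ring A'] [Algebra R A'] {𝒜' : ℤ → Submodule R A'} [GradedAlgebra 𝒜']
variable {B' : Type u} [Ring B'] [Algebra R B'] {ℬ' : ℤ → Submodule R B'} [GradedAlgebra ℬ']
variable {M : Type*} [AddCommGroup M] [Module R M]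

open GradedTensorProduct (tmul)

instance tensor_smulCommClass : SMulCommClass R (𝒜 ᵍ⊗[R] ℬ) (𝒜 ᵍ⊗[R] ℬ) :=
  Algebra.to_smulCommClass

instance tensor_isScalarTower : IsScalarTower R (𝒜 ᵍ⊗[R] ℬ) (𝒜 ᵍ⊗[R] ℬ) := IsScalarTower.right

theorem tmul_add' (a : A) (b b' : B) :
    (tmul R a (b + b') : 𝒜 ᵍ⊗[R] ℬ) = tmul R a b + tmul R a b' := TensorProduct.tmul_add ..

theorem add_tmul' (a a' : A) (b : B) :
    (tmul R (a + a') b : 𝒜 ᵍ⊗[R] ℬ) = tmul R a b + tmul R a' b := TensorProduct.add_tmul ..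

theorem neg_tmul' (a : A) (b : B) :
    (tmul R (-a) b : 𝒜 ᵍ⊗[R] ℬ) = - tmul R a b := TensorProduct.neg_tmul ..

theorem tmul_sub' (a : A) (b b' : B) :
    (tmul R a (b - b') : 𝒜 ᵍ⊗[R] ℬ) = tmul R a b - tmul R a b' := TensorProduct.tmul_sub ..

theorem sub_tmul' (a a' : A) (b : B) :
    (tmul R (a - a') b : 𝒜 ᵍ⊗[R] ℬ) = tmul R a b - tmul R a' b := TensorProduct.sub_tmul ..

theorem tmul_zero' (a : A) : (tmul R a (0 : B) : 𝒜 ᵍ⊗[R] ℬ) = 0 := TensorProduct.tmul_zero ..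

theorem zero_tmul' (b : B) : (tmul R (0 : A) b : 𝒜 ᵍ⊗[R] ℬ) = 0 := TensorProduct.zero_tmul ..

theorem zsmul_tmul' (n : ℤ) (a : A) (b : B) :
    (tmul R (n • a) b : 𝒜 ᵍ⊗[R] ℬ) = n • tmul R a b := (TensorProduct.smul_tmul' n a b).symm

theorem tmul_zsmul' (n : ℤ) (a : A) (b : B) :
    (tmul R a (n • b) : 𝒜 ᵍ⊗[R] ℬ) = n • tmul R a b := TensorProduct.tmul_smul n a b

theorem smul_tmul'' (n : R) (a : A) (b : B) :
    (tmul R (n • a) b : 𝒜 ᵍ⊗[R] ℬ) = n • tmul R a b := (TensorProduct.smul_tmul' n a b).symm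

theorem tmul_smul'' (n : R) (a : A) (b : B) :
    (tmul R a (n • b) : 𝒜 ᵍ⊗[R] ℬ) = n • tmul R a b := TensorProduct.tmul_smul n a b

theorem tensor_ext {f g : (𝒜 ᵍ⊗[R] ℬ) →ₗ[R] M} (h : ∀ a b, f (tmul R a b) = g (tmul R a b)) :
    f = g :=
  GradedTensorProduct.hom_ext _ _ (TensorProduct.ext' h)

theorem tensor_ext_homogeneous {f g : (𝒜 ᵍ⊗[R] ℬ) →ₗ[R] M}
    (h : ∀ i, ∀ a ∈ 𝒜 i, ∀ j, ∀ b ∈ ℬ j, f (tmul R a b) = g (tmul R a b)) : f = g := by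
  refine GradedTensorProduct.hom_ext _ _ (TensorProduct.ext ?_)
  exact graded_hom_ext 𝒜 fun i a ha => graded_hom_ext ℬ fun j b hb => h i a ha j b hb

theorem tensor_induction {P : (𝒜 ᵍ⊗[R] ℬ) → Prop} (zero : P 0) (add : ∀ x y, P x → P y → P (x + y))
    (tm : ∀ a b, P (tmul R a b)) (t : 𝒜 ᵍ⊗[R] ℬ) : P t :=
  TensorProduct.induction_on (motive := P) t zero tm add

theorem tmul_mul_tmul {i j : ℤ} (a : A) {b : B} (hb : b ∈ ℬ j) {a' : A} (ha' : a' ∈ 𝒜 i) (b' : B) :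
    (tmul R a b * tmul R a' b' : 𝒜 ᵍ⊗[R] ℬ) =
      (((-1 : ℤˣ) ^ (j * i) : ℤˣ) : ℤ) • tmul R (a * a') (b * b') := by
  have := GradedTensorProduct.tmul_coe_mul_coe_tmul (R := R) 𝒜 ℬ a ⟨b, hb⟩ ⟨a', ha'⟩ b'
  dsimp only at this
  rw [this, Units.smul_def]

theorem sign_neg (i : ℤ) : (((-1 : ℤˣ) ^ (-i) : ℤˣ) : ℤ) = (((-1 : ℤˣ) ^ i : ℤˣ) : ℤ) := by
  rw [zpow_neg, Int.units_inv_eq_self]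

theorem sign_two_mul (i : ℤ) : (((-1 : ℤˣ) ^ (2 * i) : ℤˣ) : ℤ) = 1 := by
  rw [zpow_mul]; simp

/-- Passing `σ b` past an element whose degree has been shifted by `m` with `m` odd. -/
theorem tmul_sgn_mul_tmul {i j : ℤ} (a : A) {b : B} (hb : b ∈ ℬ j) {a' : A} (m : ℤ) (hm : Odd m)
    (ha' : a' ∈ 𝒜 (i + m)) (b' : B) :
    (tmul R a (sgn ℬ b) * tmul R a' b' : 𝒜 ᵍ⊗[R] ℬ) =
      (((-1 : ℤˣ) ^ (j * i) : ℤˣ) : ℤ) • tmul R (a * a') (b * b') := by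
  rw [tmul_mul_tmul a (sgn_mem ℬ hb) ha', sgn_apply, signMap_apply ℬ hb, smul_mul_assoc,
    tmul_zsmul', smul_smul, ← sign_add]
  congr 1
  obtain ⟨k, rfl⟩ := hm
  rw [show j * (i + (2 * k + 1)) + j = j * i + 2 * (j * (k + 1)) by ring, sign_add, sign_two_mul,
    mul_one]

theorem tmul_mul_tmul_sgn {i j : ℤ} (a : A) {b : B} (m : ℤ) (hm : Odd m) (hb : b ∈ ℬ (j + m))
    {a' : A} (ha' : a' ∈ 𝒜 i) (b' : B) :
    (tmul R a b * tmul R a' b' : 𝒜 ᵍ⊗[R] ℬ) =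
      (((-1 : ℤˣ) ^ (j * i) : ℤˣ) : ℤ) • tmul R (a * sgn 𝒜 a') (b * b') := by
  rw [tmul_mul_tmul a hb ha', sgn_apply, signMap_apply 𝒜 ha', mul_smul_comm,
    zsmul_tmul', smul_smul, ← sign_add]
  congr 1
  obtain ⟨k, rfl⟩ := hm
  rw [show (j + (2 * k + 1)) * i = j * i + i + 2 * (k * i) by ring, sign_add _ (2 * _),
    sign_two_mul, mul_one]

/-- Product rules on a tensor product are bilinear, so they may be checked on homogeneous pure
tensors; `m` packages the right-hand side of the rule as a bilinear map. -/
theorem tensor_mul_ext {E : Type u} [Ring E] [Algebra R E]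
    {f : (𝒜 ᵍ⊗[R] ℬ) →ₗ[R] E} {m : (𝒜 ᵍ⊗[R] ℬ) →ₗ[R] (𝒜 ᵍ⊗[R] ℬ) →ₗ[R] E}
    (h : ∀ i j i' j', ∀ a ∈ 𝒜 i, ∀ b ∈ ℬ j, ∀ a' ∈ 𝒜 i', ∀ b' ∈ ℬ j',
      f (tmul R a b * tmul R a' b') = m (tmul R a b) (tmul R a' b')) (x y : 𝒜 ᵍ⊗[R] ℬ) :
    f (x * y) = m x y := by
  have : (LinearMap.mul R (𝒜 ᵍ⊗[R] ℬ)).compr₂ f = m :=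
    tensor_ext_homogeneous fun i a ha j b hb => tensor_ext_homogeneous fun i' a' ha' j' b' hb' => by
      simpa using h i j i' j' a ha b hb a' ha' b' hb'
  exact congr($this x y)

/-! ### Maps of tensor products -/

@[simp] theorem tensorMap_tmul (f : A →ₗ[R] C) (g : B →ₗ[R] D) (a : A) (b : B) :
    (tensorMap f g : (𝒜 ᵍ⊗[R] ℬ) →ₗ[R] (𝒞 ᵍ⊗[R] 𝒟)) (tmul R a b) = tmul R (f a) (g b) := rfl

theorem tensorMap_id : (tensorMap LinearMap.id LinearMap.id : (𝒜 ᵍ⊗[R] ℬ) →ₗ[R] (𝒜 ᵍ⊗[R] ℬ)) =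
    LinearMap.id := tensor_ext fun _ _ => rfl

theorem tensorMap_comp (f' : C →ₗ[R] A') (g' : D →ₗ[R] B') (f : A →ₗ[R] C) (g : B →ₗ[R] D) :
    (tensorMap f' g' : (𝒞 ᵍ⊗[R] 𝒟) →ₗ[R] (𝒜' ᵍ⊗[R] ℬ')) ∘ₗ
      (tensorMap f g : (𝒜 ᵍ⊗[R] ℬ) →ₗ[R] (𝒞 ᵍ⊗[R] 𝒟)) =
        (tensorMap (f' ∘ₗ f) (g' ∘ₗ g) : (𝒜 ᵍ⊗[R] ℬ) →ₗ[R] (𝒜' ᵍ⊗[R] ℬ')) :=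
  tensor_ext fun _ _ => rfl

theorem tensorMap_comp_apply (f' : C →ₗ[R] A') (g' : D →ₗ[R] B') (f : A →ₗ[R] C) (g : B →ₗ[R] D)
    (t : 𝒜 ᵍ⊗[R] ℬ) :
    (tensorMap f' g' : (𝒞 ᵍ⊗[R] 𝒟) →ₗ[R] (𝒜' ᵍ⊗[R] ℬ'))
      ((tensorMap f g : (𝒜 ᵍ⊗[R] ℬ) →ₗ[R] (𝒞 ᵍ⊗[R] 𝒟)) t) =
        (tensorMap (f' ∘ₗ f) (g' ∘ₗ g) : (𝒜 ᵍ⊗[R] ℬ) →ₗ[R] (𝒜' ᵍ⊗[R] ℬ')) t :=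
  congr($(tensorMap_comp (𝒜 := 𝒜) (ℬ := ℬ) (𝒞 := 𝒞) (𝒟 := 𝒟) f' g' f g) t)

theorem tensorMap_mem {f : A →ₗ[R] C} {g : B →ₗ[R] D} {m l : ℤ}
    (hf : ∀ i, ∀ a ∈ 𝒜 i, f a ∈ 𝒞 (i + m)) (hg : ∀ i, ∀ b ∈ ℬ i, g b ∈ 𝒟 (i + l)) (k : ℤ)
    (t : 𝒜 ᵍ⊗[R] ℬ) (ht : t ∈ tensorGrading 𝒜 ℬ k) :
    (tensorMap f g t : 𝒞 ᵍ⊗[R] 𝒟) ∈ tensorGrading 𝒞 𝒟 (k + (m + l)) := by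
  have : tensorGrading 𝒜 ℬ k ≤ (tensorGrading 𝒞 𝒟 (k + (m + l))).comap (tensorMap f g) := by
    refine Submodule.span_le.2 ?_
    rintro _ ⟨i, j, rfl, a, ha, b, hb, rfl⟩
    exact tmul_mem_tensorGrading (i := i + m) (j := j + l) (by ring) (hf i a ha) (hg j b hb)
  exact this ht

theorem tensorMap_mem_zero {f : A →ₗ[R] C} {g : B →ₗ[R] D}
    (hf : ∀ i, ∀ a ∈ 𝒜 i, f a ∈ 𝒞 i) (hg : ∀ i, ∀ b ∈ ℬ i, g b ∈ 𝒟 i) (k : ℤ)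
    (t : 𝒜 ᵍ⊗[R] ℬ) (ht : t ∈ tensorGrading 𝒜 ℬ k) :
    (tensorMap f g t : 𝒞 ᵍ⊗[R] 𝒟) ∈ tensorGrading 𝒞 𝒟 k := by
  simpa using tensorMap_mem (m := 0) (l := 0) (by simpa using hf) (by simpa using hg) k t ht

/-- The tensor product of two degree preserving maps of algebras. -/
def tensorAlgHom (f : A →ₐ[R] C) (g : B →ₐ[R] D) (hf : ∀ i, ∀ a ∈ 𝒜 i, f a ∈ 𝒞 i)
    (hg : ∀ i, ∀ b ∈ ℬ i, g b ∈ 𝒟 i) : (𝒜 ᵍ⊗[R] ℬ) →ₐ[R] (𝒞 ᵍ⊗[R] 𝒟) :=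
  AlgHom.ofLinearMap (tensorMap f.toLinearMap g.toLinearMap)
    (by
      change tmul R (f 1) (g 1) = tmul R 1 1
      rw [map_one, map_one])
    (tensor_mul_ext (m := (LinearMap.mul R (𝒞 ᵍ⊗[R] 𝒟)).compl₁₂
        (tensorMap f.toLinearMap g.toLinearMap : (𝒜 ᵍ⊗[R] ℬ) →ₗ[R] (𝒞 ᵍ⊗[R] 𝒟))
        (tensorMap f.toLinearMap g.toLinearMap)) fun i j i' j' a ha b hb a' ha' b' hb' => by
      simp only [LinearMap.compl₁₂_apply, LinearMap.mul_apply', tensorMap_tmul,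
        AlgHom.toLinearMap_apply]
      rw [tmul_mul_tmul a hb ha', map_zsmul, tmul_mul_tmul _ (hg _ _ hb) (hf _ _ ha'),
        tensorMap_tmul]
      simp)

theorem sgn_tmul (a : A) (b : B) : sgn (tensorGrading 𝒜 ℬ) (tmul R a b) =
    tmul R (sgn 𝒜 a) (sgn ℬ b) := by
  have : signMap (tensorGrading 𝒜 ℬ) = tensorMap (signMap 𝒜) (signMap ℬ) := by
    refine tensor_ext_homogeneous fun i a ha j b hb => ?_
    rw [signMap_apply _ (tmul_mem_tensorGrading rfl ha hb), tensorMap_tmul, signMap_apply 𝒜 ha,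
      signMap_apply ℬ hb, zsmul_tmul', tmul_zsmul', smul_smul, ← sign_add]
  exact congr($this (tmul R a b))

/-! ### The tensor differential -/

variable {dA : A →ₗ[R] A} {dB : B →ₗ[R] B} {dC : C →ₗ[R] C} {dD : D →ₗ[R] D}

theorem tensorD_tmul (a : A) (b : B) : tensorD 𝒜 ℬ dA dB (tmul R a b) =
    tmul R (dA a) b + tmul R (sgn 𝒜 a) (dB b) := rfl

theorem tensorD_mem (hdA : ∀ i, ∀ a ∈ 𝒜 i, dA a ∈ 𝒜 (i + -1))
    (hdB : ∀ i, ∀ a ∈ ℬ i, dB a ∈ ℬ (i + -1)) (k : ℤ) (t : 𝒜 ᵍ⊗[R] ℬ)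
    (ht : t ∈ tensorGrading 𝒜 ℬ k) : tensorD 𝒜 ℬ dA dB t ∈ tensorGrading 𝒜 ℬ (k + -1) := by
  refine Submodule.add_mem _ ?_ ?_
  · simpa using tensorMap_mem (m := -1) (l := 0) hdA (g := LinearMap.id) (by simp) k t ht
  · simpa using tensorMap_mem (m := 0) (l := -1) (f := signMap 𝒜)
      (by simpa using fun i a ha => signMap_mem 𝒜 ha) hdB k t ht

theorem tensorD_mul (hdA : IsDerivationOfDegree 𝒜 (-1) dA) (hdB : IsDerivationOfDegree ℬ (-1) dB)
    (x y : 𝒜 ᵍ⊗[R] ℬ) : tensorD 𝒜 ℬ dA dB (x * y) =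
      tensorD 𝒜 ℬ dA dB x * y + sgn (tensorGrading 𝒜 ℬ) x * tensorD 𝒜 ℬ dA dB y := by
  refine tensor_mul_ext (f := tensorD 𝒜 ℬ dA dB)
    (m := (LinearMap.mul R (𝒜 ᵍ⊗[R] ℬ)).comp (tensorD 𝒜 ℬ dA dB) +
      (LinearMap.mul R (𝒜 ᵍ⊗[R] ℬ)).compl₁₂
      (sgn (tensorGrading 𝒜 ℬ)).toLinearMap (tensorD 𝒜 ℬ dA dB))
    (fun i j i' j' a ha b hb a' ha' b' hb' => ?_) x y
  have o : Odd (-1 : ℤ) := by decide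
  simp only [LinearMap.compl₁₂_apply, LinearMap.mul_apply', LinearMap.add_apply,
    LinearMap.comp_apply, AlgHom.toLinearMap_apply, tensorD_tmul, sgn_tmul, add_mul, mul_add]
  rw [tmul_mul_tmul a hb ha', map_zsmul, tensorD_tmul, hdA.mul, hdB.mul,
    tmul_mul_tmul _ hb ha', tmul_mul_tmul_sgn _ (-1) o (hdB.mem _ _ hb) ha',
    tmul_sgn_mul_tmul _ hb (-1) o (hdA.mem _ _ ha'),
    tmul_mul_tmul _ (sgn_mem ℬ hb) (sgn_mem 𝒜 ha'), map_mul]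
  simp only [add_tmul', tmul_add', smul_add]
  abel

theorem IsDGA.tensor (hdA : IsDGA 𝒜 dA) (hdB : IsDGA ℬ dB) :
    IsDGA (tensorGrading 𝒜 ℬ) (tensorD 𝒜 ℬ dA dB) where
  toIsDerivationOfDegree := isDerivationOfDegree_of_mul (tensorD_mem hdA.mem hdB.mem)
    (tensorD_mul hdA.toIsDerivationOfDegree hdB.toIsDerivationOfDegree)
  d_d t := by
    have : tensorD 𝒜 ℬ dA dB ∘ₗ tensorD 𝒜 ℬ dA dB = 0 := tensor_ext fun a b => by
      simp [tensorD_tmul, hdA.d_d, hdB.d_d, hdA.sgn_d, tmul_zero', zero_tmul', neg_tmul']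
    exact congr($this t)

theorem tensorMap_tensorD {f : A →ₐ[R] C} {g : B →ₐ[R] D} (hf : IsDGAMap 𝒜 𝒞 dA dC f)
    (hg : IsDGAMap ℬ 𝒟 dB dD g) (t : 𝒜 ᵍ⊗[R] ℬ) :
    (tensorMap f.toLinearMap g.toLinearMap (tensorD 𝒜 ℬ dA dB t) : 𝒞 ᵍ⊗[R] 𝒟) =
      tensorD 𝒞 𝒟 dC dD (tensorMap f.toLinearMap g.toLinearMap t) := by
  have : (tensorMap f.toLinearMap g.toLinearMap : (𝒜 ᵍ⊗[R] ℬ) →ₗ[R] (𝒞 ᵍ⊗[R] 𝒟)) ∘ₗ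
      tensorD 𝒜 ℬ dA dB = tensorD 𝒞 𝒟 dC dD ∘ₗ tensorMap f.toLinearMap g.toLinearMap :=
    tensor_ext fun a b => by
      simp [tensorD_tmul, hf.map_d, hg.map_d, hf.map_sgn]
  exact congr($this t)

/-- The tensor product of two dga maps, as a map of algebras. -/
def IsDGAMap.tensor {f : A →ₐ[R] C} {g : B →ₐ[R] D} (hf : IsDGAMap 𝒜 𝒞 dA dC f)
    (hg : IsDGAMap ℬ 𝒟 dB dD g) : (𝒜 ᵍ⊗[R] ℬ) →ₐ[R] (𝒞 ᵍ⊗[R] 𝒟) :=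
  tensorAlgHom f g hf.mem hg.mem

theorem IsDGAMap.tensor_isDGAMap {f : A →ₐ[R] C} {g : B →ₐ[R] D} (hf : IsDGAMap 𝒜 𝒞 dA dC f)
    (hg : IsDGAMap ℬ 𝒟 dB dD g) : IsDGAMap (tensorGrading 𝒜 ℬ) (tensorGrading 𝒞 𝒟)
      (tensorD 𝒜 ℬ dA dB) (tensorD 𝒞 𝒟 dC dD) (hf.tensor hg) :=
  ⟨tensorMap_mem_zero hf.mem hg.mem, tensorMap_tensorD hf hg⟩

theorem IsDGAMap.tensor_congr {f f' : A →ₐ[R] C} {g g' : B →ₐ[R] D} (hf : IsDGAMap 𝒜 𝒞 dA dC f)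
    (hg : IsDGAMap ℬ 𝒟 dB dD g) (hf' : IsDGAMap 𝒜 𝒞 dA dC f') (hg' : IsDGAMap ℬ 𝒟 dB dD g')
    (h : f = f') (h' : g = g') : hf.tensor hg = hf'.tensor hg' := by
  subst h h'; rfl

theorem IsDGAMap.tensor_id : (IsDGAMap.id (𝒜 := 𝒜) (dA := dA)).tensor
    (IsDGAMap.id (𝒜 := ℬ) (dA := dB)) = AlgHom.id R (𝒜 ᵍ⊗[R] ℬ) :=
  AlgHom.toLinearMap_injective tensorMap_id

theorem IsDGAMap.tensor_comp {dA' : A' →ₗ[R] A'} {dB' : B' →ₗ[R] B'}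
    {f : A →ₐ[R] C} {g : B →ₐ[R] D} {f' : C →ₐ[R] A'}
    {g' : D →ₐ[R] B'} (hf : IsDGAMap 𝒜 𝒞 dA dC f) (hg : IsDGAMap ℬ 𝒟 dB dD g)
    (hf' : IsDGAMap 𝒞 𝒜' dC dA' f') (hg' : IsDGAMap 𝒟 ℬ' dD dB' g') :
    (hf'.tensor hg').comp (hf.tensor hg) = (hf'.comp hf).tensor (hg'.comp hg) :=
  AlgHom.toLinearMap_injective (tensorMap_comp _ _ _ _)

/-- The homotopy is (f ∘ `sgn`) ⊗ s: moving the odd map s past the left factor costs the sign of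
that factor. -/
theorem DerivHomotopic.tensor_left {f : A →ₐ[R] C} (hf : IsDGAMap 𝒜 𝒞 dA dC f)
    (hdC : IsDGA 𝒞 dC) {g g' : B →ₐ[R] D}
    (hg : ∀ i, ∀ b ∈ ℬ i, g b ∈ 𝒟 i)
    (h : DerivHomotopic ℬ 𝒟 dB dD g.toLinearMap g'.toLinearMap) :
    DerivHomotopic (tensorGrading 𝒜 ℬ) (tensorGrading 𝒞 𝒟) (tensorD 𝒜 ℬ dA dB)
      (tensorD 𝒞 𝒟 dC dD) (tensorMap f.toLinearMap g.toLinearMap)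
      (tensorMap f.toLinearMap g'.toLinearMap) := by
  obtain ⟨s, hs⟩ := h
  refine ⟨tensorMap (f.comp (sgn 𝒜)).toLinearMap s, isDerivHomotopy_of_mul (fun k t ht => ?_)
    (fun t => ?_) ?_⟩
  · simpa using tensorMap_mem (m := 0) (l := 1) (f := (f.comp (sgn 𝒜)).toLinearMap)
      (by simpa using fun i a ha => hf.mem _ _ (sgn_mem 𝒜 ha)) hs.mem k t ht
  · have : tensorMap (f.comp (sgn 𝒜)).toLinearMap s ∘ₗ tensorD 𝒜 ℬ dA dB +
        tensorD 𝒞 𝒟 dC dD ∘ₗ tensorMap (f.comp (sgn 𝒜)).toLinearMap s =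
        tensorMap f.toLinearMap g.toLinearMap - tensorMap f.toLinearMap g'.toLinearMap := by
      refine tensor_ext fun a b => ?_
      have e : sgn 𝒞 (dC (f a)) = - dC (sgn 𝒞 (f a)) := hdC.sgn_d _
      have hh := hs.htpy b
      simp only [AlgHom.toLinearMap_apply] at hh
      simp only [LinearMap.add_apply, LinearMap.comp_apply, tensorD_tmul, map_add, tensorMap_tmul,
        AlgHom.toLinearMap_apply, AlgHom.comp_apply, hf.map_sgn, sgn_sgn, LinearMap.sub_apply,
        hf.map_d, e, neg_tmul', ← tmul_sub', ← hh, tmul_add']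
      abel
    exact congr($this t)
  · refine tensor_mul_ext (m := (LinearMap.mul R (𝒞 ᵍ⊗[R] 𝒟)).compl₁₂
      ((tensorMap f.toLinearMap g.toLinearMap : (𝒜 ᵍ⊗[R] ℬ) →ₗ[R] (𝒞 ᵍ⊗[R] 𝒟)) ∘ₗ (sgn (tensorGrading 𝒜 ℬ)).toLinearMap)
        (tensorMap (f.comp (sgn 𝒜)).toLinearMap s) + (LinearMap.mul R (𝒞 ᵍ⊗[R] 𝒟)).compl₁₂
      (tensorMap (f.comp (sgn 𝒜)).toLinearMap s) (tensorMap f.toLinearMap g'.toLinearMap))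
        fun i j i' j' a ha b hb a' ha' b' hb' => ?_
    have o : Odd (1 : ℤ) := by decide
    have hgs : g (sgn ℬ b) = sgn 𝒟 (g b) :=
      (sgn_comm_even ℬ 𝒟 (f := g.toLinearMap) hg b).symm
    have hh := hs.mul' b b'
    simp only [AlgHom.toLinearMap_apply] at hh
    simp only [LinearMap.compl₁₂_apply, LinearMap.mul_apply', LinearMap.add_apply,
      LinearMap.comp_apply, AlgHom.toLinearMap_apply, sgn_tmul, tensorMap_tmul, AlgHom.comp_apply]
    rw [tmul_mul_tmul a hb ha', map_zsmul, tensorMap_tmul, hh, tmul_add', smul_add, hgs,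
      tmul_mul_tmul _ (sgn_mem 𝒟 (hg _ _ hb)) (hf.mem _ _ (sgn_mem 𝒜 ha')),
      tmul_mul_tmul_sgn _ 1 o (hs.mem _ _ hb) (hf.mem _ _ ha')]
    simp [hf.map_sgn]

/-- Here s ⊗ g works without a sign, since s acts on the left factor and g is even. -/
theorem DerivHomotopic.tensor_right {g : B →ₐ[R] D} (hg : IsDGAMap ℬ 𝒟 dB dD g)
    {f f' : A →ₐ[R] C} (hf' : ∀ i, ∀ b ∈ 𝒜 i, f' b ∈ 𝒞 i)
    (h : DerivHomotopic 𝒜 𝒞 dA dC f.toLinearMap f'.toLinearMap) :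
    DerivHomotopic (tensorGrading 𝒜 ℬ) (tensorGrading 𝒞 𝒟) (tensorD 𝒜 ℬ dA dB)
      (tensorD 𝒞 𝒟 dC dD) (tensorMap f.toLinearMap g.toLinearMap)
      (tensorMap f'.toLinearMap g.toLinearMap) := by
  obtain ⟨s, hs⟩ := h
  refine ⟨tensorMap s g.toLinearMap, isDerivHomotopy_of_mul (fun k t ht => ?_)
    (fun t => ?_) ?_⟩
  · simpa using tensorMap_mem (m := 1) (l := 0) (g := g.toLinearMap) hs.mem
      (by simpa using hg.mem) k t ht
  · have : tensorMap s g.toLinearMap ∘ₗ tensorD 𝒜 ℬ dA dB +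
        tensorD 𝒞 𝒟 dC dD ∘ₗ tensorMap s g.toLinearMap =
        tensorMap f.toLinearMap g.toLinearMap - tensorMap f'.toLinearMap g.toLinearMap := by
      refine tensor_ext fun a b => ?_
      have e : s (sgn 𝒜 a) = - sgn 𝒞 (s a) := by rw [sgn_comm_up 𝒜 𝒞 hs.mem, neg_neg]
      have hh := hs.htpy a
      simp only [AlgHom.toLinearMap_apply] at hh
      simp only [LinearMap.add_apply, LinearMap.comp_apply, tensorD_tmul, map_add, tensorMap_tmul,
        AlgHom.toLinearMap_apply, LinearMap.sub_apply, hg.map_d, e, neg_tmul', ← sub_tmul', ← hh,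
        add_tmul']
      abel
    exact congr($this t)
  · refine tensor_mul_ext (m := (LinearMap.mul R (𝒞 ᵍ⊗[R] 𝒟)).compl₁₂
      ((tensorMap f.toLinearMap g.toLinearMap : (𝒜 ᵍ⊗[R] ℬ) →ₗ[R] (𝒞 ᵍ⊗[R] 𝒟)) ∘ₗ (sgn (tensorGrading 𝒜 ℬ)).toLinearMap)
        (tensorMap s g.toLinearMap) + (LinearMap.mul R (𝒞 ᵍ⊗[R] 𝒟)).compl₁₂
      (tensorMap s g.toLinearMap) (tensorMap f'.toLinearMap g.toLinearMap))
        fun i j i' j' a ha b hb a' ha' b' hb' => ?_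
    have o : Odd (1 : ℤ) := by decide
    have hh := hs.mul' a a'
    simp only [AlgHom.toLinearMap_apply] at hh
    simp only [LinearMap.compl₁₂_apply, LinearMap.mul_apply', LinearMap.add_apply,
      LinearMap.comp_apply, AlgHom.toLinearMap_apply, sgn_tmul, tensorMap_tmul]
    rw [tmul_mul_tmul a hb ha', map_zsmul, tensorMap_tmul, hh, add_tmul', smul_add, hg.map_sgn,
      tmul_sgn_mul_tmul _ (hg.mem _ _ hb) 1 o (hs.mem _ _ ha'),
      tmul_mul_tmul _ (hg.mem _ _ hb) (hf' _ _ ha')]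
    simp

/-! ### Symmetry and associativity -/

theorem comm_tmul {i j : ℤ} {a : A} (ha : a ∈ 𝒜 i) {b : B} (hb : b ∈ ℬ j) :
    GradedTensorProduct.comm 𝒜 ℬ (tmul R a b) =
      (((-1 : ℤˣ) ^ (j * i) : ℤˣ) : ℤ) • (tmul R b a : ℬ ᵍ⊗[R] 𝒜) := by
  have := GradedTensorProduct.comm_coe_tmul_coe (R := R) 𝒜 ℬ ⟨a, ha⟩ ⟨b, hb⟩
  dsimp only at this
  rw [this, Units.smul_def]

theorem comm_isDGAMap (hdA : IsDGA 𝒜 dA) (hdB : IsDGA ℬ dB) :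
    IsDGAMap (tensorGrading 𝒜 ℬ) (tensorGrading ℬ 𝒜)
    (tensorD 𝒜 ℬ dA dB) (tensorD ℬ 𝒜 dB dA) (GradedTensorProduct.comm 𝒜 ℬ).toAlgHom where
  mem k t ht := by
    have : tensorGrading 𝒜 ℬ k ≤ (tensorGrading ℬ 𝒜 k).comap
        (GradedTensorProduct.comm 𝒜 ℬ).toLinearMap := by
      refine Submodule.span_le.2 ?_
      rintro _ ⟨i, j, rfl, a, ha, b, hb, rfl⟩
      change GradedTensorProduct.comm 𝒜 ℬ (tmul R a b) ∈ tensorGrading ℬ 𝒜 (i + j)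
      rw [comm_tmul ha hb]
      exact (tensorGrading ℬ 𝒜 _).toAddSubgroup.zsmul_mem
        (tmul_mem_tensorGrading (add_comm j i) hb ha) _
    exact this ht
  map_d t := by
    have : (GradedTensorProduct.comm 𝒜 ℬ).toLinearMap ∘ₗ tensorD 𝒜 ℬ dA dB =
        tensorD ℬ 𝒜 dB dA ∘ₗ (GradedTensorProduct.comm 𝒜 ℬ).toLinearMap := by
      refine tensor_ext_homogeneous fun i a ha j b hb => ?_
      simp only [LinearMap.comp_apply, AlgEquiv.toLinearMap_apply, tensorD_tmul, map_add]
      rw [comm_tmul ha hb, comm_tmul (hdA.mem _ _ ha) hb,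
        comm_tmul (sgn_mem 𝒜 ha) (hdB.mem _ _ hb), map_zsmul, tensorD_tmul, sgn_apply, sgn_apply,
        signMap_apply 𝒜 ha, signMap_apply ℬ hb, tmul_zsmul', zsmul_tmul', smul_smul, ← sign_add,
        smul_add, smul_smul, ← sign_add, show (j + -1) * i + i = j * i by ring, mul_add, mul_neg_one,
        sign_add _ (-j), sign_neg, ← sign_add, add_comm]
    exact congr($this t)

theorem comm_tensorMap {f : A →ₐ[R] C} {g : B →ₐ[R] D} (hf : ∀ i, ∀ a ∈ 𝒜 i, f a ∈ 𝒞 i)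
    (hg : ∀ i, ∀ b ∈ ℬ i, g b ∈ 𝒟 i) (t : 𝒜 ᵍ⊗[R] ℬ) :
    GradedTensorProduct.comm 𝒞 𝒟 (tensorMap f.toLinearMap g.toLinearMap t) =
      tensorMap g.toLinearMap f.toLinearMap (GradedTensorProduct.comm 𝒜 ℬ t) := by
  have : (GradedTensorProduct.comm 𝒞 𝒟).toLinearMap ∘ₗ
      (tensorMap f.toLinearMap g.toLinearMap : (𝒜 ᵍ⊗[R] ℬ) →ₗ[R] (𝒞 ᵍ⊗[R] 𝒟)) =
      tensorMap g.toLinearMap f.toLinearMap ∘ₗ (GradedTensorProduct.comm 𝒜 ℬ).toLinearMap := by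
    refine tensor_ext_homogeneous fun i a ha j b hb => ?_
    simp only [LinearMap.comp_apply, AlgEquiv.toLinearMap_apply, tensorMap_tmul,
      AlgHom.toLinearMap_apply]
    rw [comm_tmul ha hb, comm_tmul (hf _ _ ha) (hg _ _ hb), map_zsmul]
    rfl
  exact congr($this t)

theorem tensorAssoc_tmul (a : A) (b : B) (c : C) :
    tensorAssoc 𝒜 ℬ 𝒞 (tmul R (tmul R a b) c) = tmul R a (tmul R b c) := rfl

theorem tensor₃_ext_homogeneous {f g : (tensorGrading 𝒜 ℬ ᵍ⊗[R] 𝒞) →ₗ[R] M}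
    (h : ∀ i, ∀ a ∈ 𝒜 i, ∀ j, ∀ b ∈ ℬ j, ∀ k, ∀ c ∈ 𝒞 k,
      f (tmul R (tmul R a b) c) = g (tmul R (tmul R a b) c)) : f = g := by
  refine GradedTensorProduct.hom_ext _ _ (TensorProduct.ext ?_)
  refine tensor_ext_homogeneous fun i a ha j b hb => ?_
  exact graded_hom_ext 𝒞 fun k c hc => h i a ha j b hb k c hc

theorem tensorAssoc_mul (x y : tensorGrading 𝒜 ℬ ᵍ⊗[R] 𝒞) :
    tensorAssoc 𝒜 ℬ 𝒞 (x * y) = tensorAssoc 𝒜 ℬ 𝒞 x * tensorAssoc 𝒜 ℬ 𝒞 y := by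
  have : (LinearMap.mul R (tensorGrading 𝒜 ℬ ᵍ⊗[R] 𝒞)).compr₂ (tensorAssoc 𝒜 ℬ 𝒞) =
      (LinearMap.mul R (𝒜 ᵍ⊗[R] tensorGrading ℬ 𝒞)).compl₁₂ (tensorAssoc 𝒜 ℬ 𝒞)
        (tensorAssoc 𝒜 ℬ 𝒞) := by
    refine tensor₃_ext_homogeneous fun i a ha j b hb k c hc =>
      tensor₃_ext_homogeneous fun i' a' ha' j' b' hb' k' c' hc' => ?_
    simp only [LinearMap.compr₂_apply, LinearMap.compl₁₂_apply, LinearMap.mul_apply',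
      tensorAssoc_tmul]
    rw [tmul_mul_tmul _ hc (tmul_mem_tensorGrading rfl ha' hb'), tmul_mul_tmul _ hb ha',
      tmul_mul_tmul _ (tmul_mem_tensorGrading rfl hb hc) ha', tmul_mul_tmul _ hc hb', map_zsmul,
      zsmul_tmul', map_zsmul, tensorAssoc_tmul, tmul_zsmul', smul_smul, smul_smul, ← sign_add,
      ← sign_add]
    congr 3
    ring
  exact congr($this x y)

/-- Reassociation as a map of algebras. -/
def assocHom : (tensorGrading 𝒜 ℬ ᵍ⊗[R] 𝒞) →ₐ[R] (𝒜 ᵍ⊗[R] tensorGrading ℬ 𝒞) :=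
  AlgHom.ofLinearMap (tensorAssoc 𝒜 ℬ 𝒞) rfl tensorAssoc_mul

theorem assocHom_isDGAMap : IsDGAMap (tensorGrading (tensorGrading 𝒜 ℬ) 𝒞)
    (tensorGrading 𝒜 (tensorGrading ℬ 𝒞)) (tensorD _ 𝒞 (tensorD 𝒜 ℬ dA dB) dC)
    (tensorD 𝒜 _ dA (tensorD ℬ 𝒞 dB dC)) (assocHom (𝒜 := 𝒜) (ℬ := ℬ) (𝒞 := 𝒞)) where
  mem k t ht := by
    have : tensorGrading (tensorGrading 𝒜 ℬ) 𝒞 k ≤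
        (tensorGrading 𝒜 (tensorGrading ℬ 𝒞) k).comap (tensorAssoc 𝒜 ℬ 𝒞) := by
      refine Submodule.span_le.2 ?_
      rintro _ ⟨l, j, rfl, t, ht, c, hc, rfl⟩
      change tensorAssoc 𝒜 ℬ 𝒞 (tmul R t c) ∈ tensorGrading 𝒜 (tensorGrading ℬ 𝒞) (l + j)
      induction ht using Submodule.span_induction with
      | zero => rw [zero_tmul', map_zero]; exact Submodule.zero_mem _
      | add x y _ _ hx hy => rw [add_tmul', map_add]; exact Submodule.add_mem _ hx hy
      | smul r x _ hx => rw [smul_tmul'', map_smul]; exact Submodule.smul_mem _ _ hx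
      | mem x hx =>
        obtain ⟨i, i', rfl, a, ha, b, hb, rfl⟩ := hx
        exact tmul_mem_tensorGrading (by ring) ha (tmul_mem_tensorGrading rfl hb hc)
    exact this ht
  map_d t := by
    have : tensorAssoc 𝒜 ℬ 𝒞 ∘ₗ tensorD _ 𝒞 (tensorD 𝒜 ℬ dA dB) dC =
        tensorD 𝒜 _ dA (tensorD ℬ 𝒞 dB dC) ∘ₗ tensorAssoc 𝒜 ℬ 𝒞 := by
      refine tensor₃_ext_homogeneous fun i a _ j b _ k c _ => ?_
      simp only [LinearMap.comp_apply, tensorD_tmul, tensorAssoc_tmul, add_tmul', map_add,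
        tmul_add', sgn_tmul]
      abel
    exact congr($this t)

theorem tensorAssoc_tensorMap (f : A →ₗ[R] D) (g : B →ₗ[R] A') (h : C →ₗ[R] B')
    (t : tensorGrading 𝒜 ℬ ᵍ⊗[R] 𝒞) :
    tensorAssoc 𝒟 𝒜' ℬ' (tensorMap (tensorMap f g : (𝒜 ᵍ⊗[R] ℬ) →ₗ[R] (𝒟 ᵍ⊗[R] 𝒜')) h t) =
      tensorMap f (tensorMap g h : (ℬ ᵍ⊗[R] 𝒞) →ₗ[R] (𝒜' ᵍ⊗[R] ℬ')) (tensorAssoc 𝒜 ℬ 𝒞 t) := by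
  have : tensorAssoc 𝒟 𝒜' ℬ' ∘ₗ (tensorMap (tensorMap f g : (𝒜 ᵍ⊗[R] ℬ) →ₗ[R] (𝒟 ᵍ⊗[R] 𝒜')) h :
      (tensorGrading 𝒜 ℬ ᵍ⊗[R] 𝒞) →ₗ[R] (tensorGrading 𝒟 𝒜' ᵍ⊗[R] ℬ')) =
      tensorMap f (tensorMap g h : (ℬ ᵍ⊗[R] 𝒞) →ₗ[R] (𝒜' ᵍ⊗[R] ℬ')) ∘ₗ tensorAssoc 𝒜 ℬ 𝒞 :=
    tensor₃_ext_homogeneous fun i a _ j b _ k c _ => rfl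
  exact congr($this t)

end

/-! ### Homotopies and tensor powers -/

section

variable {R : Type u} [CommRing R]
variable {A : Type u} [Ring A] [Algebra R A] {𝒜 : ℤ → Submodule R A} [GradedAlgebra 𝒜]
variable {B : Type u} [Ring B] [Algebra R B] {ℬ : ℤ → Submodule R B} [GradedAlgebra ℬ]
variable {E : Type u} [Ring E] [Algebra R E] {ℰ : ℤ → Submodule R E} [GradedAlgebra ℰ]
variable {dA : A →ₗ[R] A} {dB : B →ₗ[R] B} {dE : E →ₗ[R] E}

open GradedTensorProduct (tmul)

/-- Tensor squares of quasi-isomorphisms with a homotopy inverse are quasi-isomorphisms. -/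
theorem isQuasiIso_tensor (hdA : IsDGA 𝒜 dA) (hdB : IsDGA ℬ dB) {f : A →ₐ[R] B} {g : B →ₐ[R] A}
    (hf : IsDGAMap 𝒜 ℬ dA dB f) (hg : IsDGAMap ℬ 𝒜 dB dA g)
    (hfg : DerivHomotopic ℬ ℬ dB dB (f.comp g).toLinearMap LinearMap.id)
    (hgf : DerivHomotopic 𝒜 𝒜 dA dA (g.comp f).toLinearMap LinearMap.id) :
    IsQuasiIso (tensorD 𝒜 𝒜 dA dA) (tensorD ℬ ℬ dB dB) (hf.tensor hf) := by
  -- The maps are compared through k ⊗ k, 1 ⊗ k and 1 ⊗ 1 or the like, one factor at a time, but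
  -- only on cycles modulo boundaries. Derivation homotopies out of the tensor square cannot be
  -- composed by `FreeGen.trans`, which needs a free source.
  have key : ∀ {A : Type u} [Ring A] [Algebra R A] {𝒜 : ℤ → Submodule R A} [GradedAlgebra 𝒜]
      {dA : A →ₗ[R] A} (hdA : IsDGA 𝒜 dA) {k : A →ₐ[R] A} (hk : IsDGAMap 𝒜 𝒜 dA dA k)
      (h : DerivHomotopic 𝒜 𝒜 dA dA k.toLinearMap LinearMap.id) (t : 𝒜 ᵍ⊗[R] 𝒜),
      tensorD 𝒜 𝒜 dA dA t = 0 →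
      ∃ c, tensorD 𝒜 𝒜 dA dA c = tensorMap k.toLinearMap k.toLinearMap t - t := by
    intro A _ _ 𝒜 _ dA hdA k hk h t ht
    have e1 := DerivHomotopic.tensor_left hk hdA (g' := AlgHom.id R A) hk.mem h
    have e2 := DerivHomotopic.tensor_right (g := AlgHom.id R A) (f' := AlgHom.id R A)
      (IsDGAMap.id (𝒜 := 𝒜) (dA := dA)) (fun _ _ h => h) h
    obtain ⟨c1, h1⟩ := e1.exists_boundary ht
    obtain ⟨c2, h2⟩ := e2.exists_boundary ht
    refine ⟨c1 + c2, ?_⟩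
    rw [map_add, h1, h2, sub_add_sub_cancel]
    congr 1
    exact congr($(tensorMap_id) t)
  constructor
  · rintro t ht ⟨c, hc⟩
    obtain ⟨c', hc'⟩ := key hdA (hg.comp hf) hgf t ht
    refine ⟨tensorMap g.toLinearMap g.toLinearMap c - c', ?_⟩
    rw [map_sub, ← tensorMap_tensorD hg hg, hc, hc']
    change tensorMap g.toLinearMap g.toLinearMap (tensorMap f.toLinearMap f.toLinearMap t) - _ = t
    rw [tensorMap_comp_apply]
    exact sub_sub_cancel _ t
  · intro t ht
    refine ⟨tensorMap g.toLinearMap g.toLinearMap t, ?_, ?_⟩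
    · rw [← tensorMap_tensorD hg hg, ht, map_zero]
    · obtain ⟨c, hc⟩ := key hdB (hf.comp hg) hfg t ht
      refine ⟨c, hc.trans ?_⟩
      change _ = (tensorMap f.toLinearMap f.toLinearMap : (𝒜 ᵍ⊗[R] 𝒜) →ₗ[R] (ℬ ᵍ⊗[R] ℬ))
        (tensorMap g.toLinearMap g.toLinearMap t) - t
      rw [tensorMap_comp_apply]
      rfl

/-- The chain is u ≃ g f u ≃ g f v ≃ v. The relation g f ≃ 1 is only assumed after composition with
maps out of the free algebra E, because for tensor powers the intermediate homotopies can only be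
composed there. -/
theorem FreeGen.reflect (G : FreeGen ℰ) (hdE : IsDGA ℰ dE) (hdA : IsDGA 𝒜 dA)
    {f : A →ₐ[R] B} {g : B →ₐ[R] A} (hf : IsDGAMap 𝒜 ℬ dA dB f) (hg : IsDGAMap ℬ 𝒜 dB dA g)
    (h : ∀ u : E →ₐ[R] A, IsDGAMap ℰ 𝒜 dE dA u →
      DerivHomotopic ℰ 𝒜 dE dA ((g.comp f).comp u).toLinearMap u.toLinearMap)
    {u v : E →ₐ[R] A} (hu : IsDGAMap ℰ 𝒜 dE dA u) (hv : IsDGAMap ℰ 𝒜 dE dA v)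
    (huv : DerivHomotopic ℰ ℬ dE dB (f.comp u).toLinearMap (f.comp v).toLinearMap) :
    DerivHomotopic ℰ 𝒜 dE dA u.toLinearMap v.toLinearMap := by
  have hgf := hg.comp hf
  have e := huv.comp_left hg
  exact G.trans hdE hdA hu (hgf.comp hu) hv (G.symm hdE hdA (hgf.comp hu) hu (h u hu))
    (G.trans hdE hdA (hgf.comp hu) (hgf.comp hv) hv e (h v hv))

/-- The two tensor factors of g f are deformed to the identity one after the other, after
precomposition with a map out of E. The version for three factors works in the same way. -/
theorem FreeGen.reflect_tensor (G : FreeGen ℰ) (hdE : IsDGA ℰ dE) (hdA : IsDGA 𝒜 dA)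
    {f : A →ₐ[R] B} {g : B →ₐ[R] A}
    (hf : IsDGAMap 𝒜 ℬ dA dB f) (hg : IsDGAMap ℬ 𝒜 dB dA g)
    (hgf : DerivHomotopic 𝒜 𝒜 dA dA (g.comp f).toLinearMap LinearMap.id)
    {u v : E →ₐ[R] (𝒜 ᵍ⊗[R] 𝒜)}
    (hu : IsDGAMap ℰ (tensorGrading 𝒜 𝒜) dE (tensorD 𝒜 𝒜 dA dA) u)
    (hv : IsDGAMap ℰ (tensorGrading 𝒜 𝒜) dE (tensorD 𝒜 𝒜 dA dA) v)
    (huv : DerivHomotopic ℰ (tensorGrading ℬ ℬ) dE (tensorD ℬ ℬ dB dB)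
      ((hf.tensor hf).comp u).toLinearMap ((hf.tensor hf).comp v).toLinearMap) :
    DerivHomotopic ℰ (tensorGrading 𝒜 𝒜) dE (tensorD 𝒜 𝒜 dA dA) u.toLinearMap v.toLinearMap := by
  refine G.reflect hdE (hdA.tensor hdA) (hf.tensor_isDGAMap hf) (hg.tensor_isDGAMap hg)
    (fun w hw => ?_) hu hv huv
  have hk := hg.comp hf
  have hid := IsDGAMap.id (𝒜 := 𝒜) (dA := dA)
  have e1 := DerivHomotopic.tensor_left hk hdA (g' := AlgHom.id R A) hk.mem hgf
  have e2 := DerivHomotopic.tensor_right (g := AlgHom.id R A) (f' := AlgHom.id R A)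
    hid hid.mem hgf
  have h3 := G.trans hdE (hdA.tensor hdA) ((hk.tensor_isDGAMap hk).comp hw)
    ((hk.tensor_isDGAMap hid).comp hw) ((hid.tensor_isDGAMap hid).comp hw)
    (e1.comp_right hw) (e2.comp_right hw)
  rw [hf.tensor_comp hf hg hg]
  rwa [IsDGAMap.tensor_id] at h3

theorem FreeGen.reflect_tensor₃ (G : FreeGen ℰ) (hdE : IsDGA ℰ dE) (hdA : IsDGA 𝒜 dA)
    {f : A →ₐ[R] B} {g : B →ₐ[R] A}
    (hf : IsDGAMap 𝒜 ℬ dA dB f) (hg : IsDGAMap ℬ 𝒜 dB dA g)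
    (hgf : DerivHomotopic 𝒜 𝒜 dA dA (g.comp f).toLinearMap LinearMap.id)
    {u v : E →ₐ[R] (𝒜 ᵍ⊗[R] tensorGrading 𝒜 𝒜)}
    (hu : IsDGAMap ℰ (tensorGrading 𝒜 (tensorGrading 𝒜 𝒜)) dE
      (tensorD 𝒜 _ dA (tensorD 𝒜 𝒜 dA dA)) u)
    (hv : IsDGAMap ℰ (tensorGrading 𝒜 (tensorGrading 𝒜 𝒜)) dE
      (tensorD 𝒜 _ dA (tensorD 𝒜 𝒜 dA dA)) v)
    (huv : DerivHomotopic ℰ (tensorGrading ℬ (tensorGrading ℬ ℬ)) dE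
      (tensorD ℬ _ dB (tensorD ℬ ℬ dB dB))
      ((hf.tensor (hf.tensor_isDGAMap hf)).comp u).toLinearMap
      ((hf.tensor (hf.tensor_isDGAMap hf)).comp v).toLinearMap) :
    DerivHomotopic ℰ (tensorGrading 𝒜 (tensorGrading 𝒜 𝒜)) dE
      (tensorD 𝒜 _ dA (tensorD 𝒜 𝒜 dA dA)) u.toLinearMap v.toLinearMap := by
  refine G.reflect hdE (hdA.tensor (hdA.tensor hdA)) (hf.tensor_isDGAMap (hf.tensor_isDGAMap hf))
    (hg.tensor_isDGAMap (hg.tensor_isDGAMap hg))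
    (fun w hw => ?_) hu hv huv
  have hk := hg.comp hf
  have hid := IsDGAMap.id (𝒜 := 𝒜) (dA := dA)
  have hkk := hk.tensor_isDGAMap hk
  have hik := hid.tensor_isDGAMap hk
  have hii := hid.tensor_isDGAMap hid
  have e1 : DerivHomotopic _ _ _ _ (hk.tensor hk).toLinearMap (hid.tensor hk).toLinearMap :=
    DerivHomotopic.tensor_right (g := g.comp f) (f' := AlgHom.id R A) hk hid.mem hgf
  have e2 : DerivHomotopic _ _ _ _ (hid.tensor hk).toLinearMap (hid.tensor hid).toLinearMap :=
    DerivHomotopic.tensor_left (g' := AlgHom.id R A) hid hdA hk.mem hgf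
  have f1 : DerivHomotopic _ _ _ _ (hk.tensor hkk).toLinearMap (hid.tensor hkk).toLinearMap :=
    DerivHomotopic.tensor_right (f' := AlgHom.id R A) hkk hid.mem hgf
  have f2 : DerivHomotopic _ _ _ _ (hid.tensor hkk).toLinearMap (hid.tensor hik).toLinearMap :=
    DerivHomotopic.tensor_left hid hdA hkk.mem e1
  have f3 : DerivHomotopic _ _ _ _ (hid.tensor hik).toLinearMap (hid.tensor hii).toLinearMap :=
    DerivHomotopic.tensor_left hid hdA hik.mem e2
  have hd := hdA.tensor (hdA.tensor hdA)
  have h3 := G.trans hdE hd ((hk.tensor_isDGAMap hkk).comp hw)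
    ((hid.tensor_isDGAMap hkk).comp hw) ((hid.tensor_isDGAMap hii).comp hw)
    (f1.comp_right hw) (G.trans hdE hd ((hid.tensor_isDGAMap hkk).comp hw)
      ((hid.tensor_isDGAMap hik).comp hw) ((hid.tensor_isDGAMap hii).comp hw)
      (f2.comp_right hw) (f3.comp_right hw))
  rw [hf.tensor_comp (hf.tensor_isDGAMap hf) hg (hg.tensor_isDGAMap hg),
    (hg.comp hf).tensor_congr _ hk hkk rfl (hf.tensor_comp hf hg hg)]
  rwa [hid.tensor_congr hii hid IsDGAMap.id rfl IsDGAMap.tensor_id, IsDGAMap.tensor_id] at h3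

end

/-! ### Coproducts -/

section

variable {R : Type u} [CommRing R]
variable {A : Type u} [Ring A] [Algebra R A] {𝒜 : ℤ → Submodule R A} [GradedAlgebra 𝒜]

/-- A coproduct as a map of algebras. -/
def IsCoproduct.hom {ε : A →ₐ[R] R} {ψ : A →ₗ[R] (𝒜 ᵍ⊗[R] 𝒜)} (h : IsCoproduct ε ψ) :
    A →ₐ[R] (𝒜 ᵍ⊗[R] 𝒜) :=
  AlgHom.ofLinearMap ψ h.map_one h.map_mul

end

/-! ### Morphisms of Hah's -/

section Morphisms

variable {R : Type u} [CommRing R] {A B C : Hah R}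

/-- The coproduct of a Hah as a map of algebras. -/
def Hah.psi (A : Hah R) : A.carrier →ₐ[R] (A.grading ᵍ⊗[R] A.grading) := A.isHah.isCoproduct.hom

/-- The differential of the tensor square. -/
abbrev Hah.d₂ (A : Hah R) : (A.grading ᵍ⊗[R] A.grading) →ₗ[R] (A.grading ᵍ⊗[R] A.grading) :=
  tensorD A.grading A.grading A.d A.d

theorem Hah.isDGA (A : Hah R) : IsDGA A.grading A.d := A.isHah.isDGA

theorem Hah.isDGA₂ (A : Hah R) : IsDGA (tensorGrading A.grading A.grading) A.d₂ :=
  A.isDGA.tensor A.isDGA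

theorem Hah.psi_isDGAMap (A : Hah R) :
    IsDGAMap A.grading (tensorGrading A.grading A.grading) A.d A.d₂ A.psi :=
  ⟨A.isHah.isCoproduct.mem, A.isHah.coproduct_d⟩

theorem IsHahMorphism.isDGAMap {f : A.carrier →ₐ[R] B.carrier} (h : IsHahMorphism A B f) :
    IsDGAMap A.grading B.grading A.d B.d f := ⟨h.mem, h.map_d⟩

/-- Augmentations vanish off degree zero, so both sides are zero on generators of positive degree.
Compatibility with augmentations is therefore automatic for degree preserving maps. -/
theorem counit_comp_of_free (G : FreeGen A.grading) {f : A.carrier →ₐ[R] B.carrier}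
    (hf : ∀ i, ∀ a ∈ A.grading i, f a ∈ B.grading i) (a : A.carrier) :
    B.counit (f a) = A.counit a := by
  have : B.counit.comp f = A.counit := free_hom_ext G.free fun x => by
    have hx : G.deg x ≠ 0 := by have := G.pos x; omega
    rw [AlgHom.comp_apply, B.isHah.isCoproduct.counit_degree _ hx _ (hf _ _ (G.mem x)),
      A.isHah.isCoproduct.counit_degree _ hx _ (G.mem x)]
  exact congr($this a)

/-- The condition on the coproducts, in terms of maps of algebras. -/
def CoproductCompatible {f : A.carrier →ₐ[R] B.carrier}
    (hf : IsDGAMap A.grading B.grading A.d B.d f) : Prop :=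
  DerivHomotopic A.grading (tensorGrading B.grading B.grading) A.d B.d₂
    ((hf.tensor hf).comp A.psi).toLinearMap (B.psi.comp f).toLinearMap

theorem isHahMorphism_of_free (G : FreeGen A.grading) {f : A.carrier →ₐ[R] B.carrier}
    (hf : IsDGAMap A.grading B.grading A.d B.d f) (h : CoproductCompatible hf) :
    IsHahMorphism A B f :=
  ⟨hf.mem, hf.map_d, counit_comp_of_free G hf.mem, h⟩

theorem IsHahMorphism.compatible {f : A.carrier →ₐ[R] B.carrier} (h : IsHahMorphism A B f) :
    CoproductCompatible h.isDGAMap := h.map_coproduct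

theorem IsHahMorphism.id (G : FreeGen A.grading) : IsHahMorphism A A (AlgHom.id R A.carrier) := by
  refine isHahMorphism_of_free G IsDGAMap.id ?_
  rw [CoproductCompatible, IsDGAMap.tensor_id]
  exact DerivHomotopic.refl _

theorem IsHahMorphism.comp (G : FreeGen A.grading) {g : B.carrier →ₐ[R] C.carrier}
    {f : A.carrier →ₐ[R] B.carrier} (hg : IsHahMorphism B C g) (hf : IsHahMorphism A B f) :
    IsHahMorphism A C (g.comp f) := by
  have hg' := hg.isDGAMap
  have hf' := hf.isDGAMap
  have hgg := hg'.tensor_isDGAMap hg'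
  have hff := hf'.tensor_isDGAMap hf'
  refine isHahMorphism_of_free G (hg'.comp hf') ?_
  have e1 := hf.compatible.comp_left hgg
  have e2 := hg.compatible.comp_right hf'
  have e3 := G.trans A.isDGA C.isDGA₂ (hgg.comp (hff.comp A.psi_isDGAMap))
    (hgg.comp (B.psi_isDGAMap.comp hf')) (C.psi_isDGAMap.comp (hg'.comp hf')) e1 e2
  rw [CoproductCompatible, ← hf'.tensor_comp hf' hg' hg']
  exact e3

/-- The chain is (f' ⊗ f')ψ ≃ (f' ⊗ f)ψ ≃ (f ⊗ f)ψ ≃ ψf ≃ ψf', and freeness of A allows the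
homotopies to be composed. -/
theorem IsHahMorphism.of_homotopic (G : FreeGen A.grading) {f f' : A.carrier →ₐ[R] B.carrier}
    (hf : IsHahMorphism A B f) (hf' : IsDGAMap A.grading B.grading A.d B.d f')
    (h : DerivHomotopic A.grading B.grading A.d B.d f.toLinearMap f'.toLinearMap) :
    IsHahMorphism A B f' := by
  have hfd := hf.isDGAMap
  refine isHahMorphism_of_free G hf' ?_
  have h' := G.symm A.isDGA B.isDGA hfd hf' h
  have e1 : DerivHomotopic _ _ _ _ (hf'.tensor hf').toLinearMap (hf'.tensor hfd).toLinearMap :=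
    DerivHomotopic.tensor_left hf' B.isDGA hf'.mem h'
  have e2 : DerivHomotopic _ _ _ _ (hf'.tensor hfd).toLinearMap (hfd.tensor hfd).toLinearMap :=
    DerivHomotopic.tensor_right hfd hfd.mem h'
  have p := A.psi_isDGAMap
  have q := B.psi_isDGAMap
  have d := G.trans A.isDGA B.isDGA₂ ((hf'.tensor_isDGAMap hf').comp p)
    ((hf'.tensor_isDGAMap hfd).comp p) ((hfd.tensor_isDGAMap hfd).comp p)
    (e1.comp_right p) (e2.comp_right p)
  have e := G.trans A.isDGA B.isDGA₂ ((hf'.tensor_isDGAMap hf').comp p)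
    ((hfd.tensor_isDGAMap hfd).comp p) (q.comp hfd) d hf.compatible
  exact G.trans A.isDGA B.isDGA₂ ((hf'.tensor_isDGAMap hf').comp p) (q.comp hfd) (q.comp hf') e
    (h.comp_left q)

theorem IsWeakEquivalence.isQuasiIso {f : A.carrier →ₐ[R] B.carrier} (h : IsWeakEquivalence A B f) :
    IsQuasiIso A.d B.d f := ⟨h.homology_injective, h.homology_surjective⟩

theorem IsHahMorphism.isWeakEquivalence {f : A.carrier →ₐ[R] B.carrier} (h : IsHahMorphism A B f)
    (hq : IsQuasiIso A.d B.d f) : IsWeakEquivalence A B f := ⟨h, hq.inj, hq.surj⟩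

theorem IsWeakEquivalence.id (G : FreeGen A.grading) :
    IsWeakEquivalence A A (AlgHom.id R A.carrier) :=
  (IsHahMorphism.id G).isWeakEquivalence IsQuasiIso.id

theorem IsWeakEquivalence.comp (G : FreeGen A.grading) {g : B.carrier →ₐ[R] C.carrier}
    {f : A.carrier →ₐ[R] B.carrier} (hg : IsWeakEquivalence B C g) (hf : IsWeakEquivalence A B f) :
    IsWeakEquivalence A C (g.comp f) :=
  (hg.toIsHahMorphism.comp G hf.toIsHahMorphism).isWeakEquivalence
    (hg.isQuasiIso.comp hg.map_d hf.isQuasiIso hf.map_d)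

theorem IsWeakEquivalence.of_homotopic (G : FreeGen A.grading) {f f' : A.carrier →ₐ[R] B.carrier}
    (hf : IsWeakEquivalence A B f) (hf' : IsDGAMap A.grading B.grading A.d B.d f')
    (h : DerivHomotopic A.grading B.grading A.d B.d f.toLinearMap f'.toLinearMap) :
    IsWeakEquivalence A B f' :=
  (hf.toIsHahMorphism.of_homotopic G hf' h).isWeakEquivalence (hf.isQuasiIso.of_homotopic h)

/-- Weak equivalences lift through weak equivalences, up to homotopy. -/
theorem IsWeakEquivalence.exists_lift (G : FreeGen A.grading) (GB : FreeGen B.grading)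
    (GC : FreeGen C.grading) {f : A.carrier →ₐ[R] B.carrier} {e : C.carrier →ₐ[R] B.carrier}
    (hf : IsWeakEquivalence A B f) (he : IsWeakEquivalence C B e) :
    ∃ l : A.carrier →ₐ[R] C.carrier, IsWeakEquivalence A C l ∧
      DerivHomotopic A.grading B.grading A.d B.d f.toLinearMap (e.comp l).toLinearMap := by
  have hfd := hf.isDGAMap
  have hed := he.isDGAMap
  obtain ⟨l, hl, hfl⟩ := G.exists_lift_of_quasiIso A.isDGA C.isDGA B.isDGA hed he.isQuasiIso hfd
  obtain ⟨g, hg, -, hge⟩ := he.isQuasiIso.exists_inverse GC GB C.isDGA B.isDGA hed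
  refine ⟨l, IsHahMorphism.isWeakEquivalence (isHahMorphism_of_free G hl ?_)
    (he.isQuasiIso.of_comp hed.map_d hf.isQuasiIso hl hfl), hfl⟩
  have hel : IsHahMorphism A B (e.comp l) := hf.toIsHahMorphism.of_homotopic G (hed.comp hl) hfl
  have hee := hed.tensor_isDGAMap hed
  have hll := hl.tensor_isDGAMap hl
  -- Compatibility of l with the coproducts is checked after applying e ⊗ e, where it follows from
  -- the compatibility of e l ≃ f and that of e.
  refine G.reflect_tensor A.isDGA C.isDGA hed hg hge (hll.comp A.psi_isDGAMap)
    (C.psi_isDGAMap.comp hl) ?_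
  have h1 := hel.compatible
  rw [CoproductCompatible, ← hl.tensor_comp hl hed hed] at h1
  have h2 := G.symm A.isDGA B.isDGA₂ ((hee.comp C.psi_isDGAMap).comp hl)
    ((B.psi_isDGAMap.comp hed).comp hl) (he.compatible.comp_right hl)
  exact G.trans A.isDGA B.isDGA₂ (hee.comp (hll.comp A.psi_isDGAMap))
    (B.psi_isDGAMap.comp (hed.comp hl)) (hee.comp (C.psi_isDGAMap.comp hl)) h1 h2

theorem IsWeakEquivalence.exists_inverse (GA : FreeGen A.grading) (GB : FreeGen B.grading)
    {f : A.carrier →ₐ[R] B.carrier} (hf : IsWeakEquivalence A B f) :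
    ∃ g : B.carrier →ₐ[R] A.carrier, IsWeakEquivalence B A g ∧
      DerivHomotopic B.grading B.grading B.d B.d LinearMap.id (f.comp g).toLinearMap :=
  (IsWeakEquivalence.id GB).exists_lift GB GB GA hf

end Morphisms

/-! ### Filtered complexes -/

section Filtered

variable {R : Type u} [CommRing R] {M : Type u} [AddCommGroup M] [Module R M]

/-- The sum of the pieces of index less than `q`. -/
def below (F : ℕ → Submodule R M) (q : ℕ) : Submodule R M := ⨆ (i : ℕ) (_ : i + 1 ≤ q), F i

variable {F : ℕ → Submodule R M}

theorem le_below {i q : ℕ} (h : i < q) : F i ≤ below F q :=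
  le_iSup₂_of_le i h le_rfl

theorem below_le {q : ℕ} {N : Submodule R M} (h : ∀ i < q, F i ≤ N) : below F q ≤ N :=
  iSup₂_le h

theorem below_mono {p q : ℕ} (h : p ≤ q) : below F p ≤ below F q :=
  below_le fun _ hi => le_below (hi.trans_le h)

theorem below_zero : below F 0 = ⊥ := le_bot_iff.1 (below_le fun i hi => absurd hi (by omega))

theorem mem_below_zero {z : M} : z ∈ below F 0 ↔ z = 0 := by rw [below_zero, Submodule.mem_bot]

theorem below_one : below F 1 = F 0 :=
  le_antisymm (below_le fun i hi => by rw [Nat.lt_one_iff.1 hi]) (le_below Nat.one_pos)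

/-- Truncated subtraction is harmless: for q equal to 0 or 1 both sides are zero. Lowering the index
by at least two thus means landing in `below F (q - 1)`. -/
theorem iSup_add_two (F : ℕ → Submodule R M) (q : ℕ) :
    ⨆ (i : ℕ) (_ : i + 2 ≤ q), F i = below F (q - 1) :=
  le_antisymm (iSup₂_le fun i hi => le_below (by omega))
    (below_le fun i hi => le_iSup₂_of_le i (by omega) le_rfl)

theorem exists_of_mem_below_succ {q : ℕ} {z : M} (hz : z ∈ below F (q + 1)) :
    ∃ z' ∈ below F q, ∃ y ∈ F q, z' + y = z := by
  have : below F (q + 1) ≤ below F q ⊔ F q := below_le fun i hi => by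
    rcases (Nat.lt_succ_iff.1 hi).lt_or_eq with h | rfl
    · exact (le_below h).trans le_sup_left
    · exact le_sup_right
  exact Submodule.mem_sup.1 (this hz)

/-- A complex with a differential `d` lowering the index by one, acyclic in positive index, and a
perturbation `h` lowering the index by at least two. -/
structure IsPerturbedComplex (F : ℕ → Submodule R M) (P : ℕ → M →ₗ[R] M) (d h : M →ₗ[R] M) :
    Prop where
  exhaust : ∀ z, ∃ N, z ∈ below F N
  proj_same : ∀ q, ∀ z ∈ F q, P q z = z
  proj_ne : ∀ i q, i ≠ q → ∀ z ∈ F i, P q z = 0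
  d_mem : ∀ q, ∀ z ∈ F (q + 1), d z ∈ F q
  d_zero : ∀ z ∈ F 0, d z = 0
  h_mem : ∀ q, ∀ z ∈ F q, h z ∈ below F (q - 1)
  acyclic : ∀ q, ∀ z ∈ F (q + 1), d z = 0 → ∃ w ∈ F (q + 2), d w = z

variable {P : ℕ → M →ₗ[R] M} {d h : M →ₗ[R] M}

theorem IsPerturbedComplex.proj_below (H : IsPerturbedComplex F P d h) {q : ℕ} {z : M}
    (hz : z ∈ below F q) : P q z = 0 :=
  below_le (N := LinearMap.ker (P q)) (fun i hi z hz => H.proj_ne i q hi.ne z hz) hz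

theorem IsPerturbedComplex.d_below (H : IsPerturbedComplex F P d h) {q : ℕ} {z : M}
    (hz : z ∈ below F q) : (d + h) z ∈ below F (q - 1) := by
  refine below_le (N := (below F (q - 1)).comap (d + h)) (fun i hi z hz => ?_) hz
  refine Submodule.add_mem _ ?_ (below_mono (by omega) (H.h_mem i z hz))
  cases i with
  | zero => rw [H.d_zero z hz]; exact Submodule.zero_mem _
  | succ i => exact le_below (by omega) (H.d_mem i z hz)

/-- As long as the top component y of z has index above q, it is a d-cycle, since the rest of (d +
h)z lies lower. By acyclicity y = dw, and subtracting (d + h)w lowers the filtration of z without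
changing its perturbed boundary. -/
theorem IsPerturbedComplex.exists_sub_mem (H : IsPerturbedComplex F P d h)
    (hd : ∀ z, (d + h) ((d + h) z) = 0) {q : ℕ} {z : M}
    (hz : (d + h) z ∈ below F q) : ∃ c, z - (d + h) c ∈ below F (q + 1) := by
  obtain ⟨N, hN⟩ := H.exhaust z
  induction N generalizing z with
  | zero => exact ⟨0, by rw [map_zero, sub_zero]; exact below_mono (Nat.zero_le _) hN⟩
  | succ N ih =>
    by_cases hNq : N ≤ q
    · exact ⟨0, by rw [map_zero, sub_zero]; exact below_mono (by omega) hN⟩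
    obtain ⟨m, rfl⟩ : ∃ m, N = m + 1 := ⟨N - 1, by omega⟩
    obtain ⟨z', hz', y, hy, rfl⟩ := exists_of_mem_below_succ hN
    have hy0 : d y = 0 := by
      have e1 : d y = (d + h) (z' + y) - (d + h) z' - h y := by
        rw [map_add, LinearMap.add_apply d h y]; abel
      -- dy has index m and also lies in the sum of the pieces of index less than m, so its
      -- projection to index m shows that it is zero.
      have e2 : d y ∈ below F m := by
        have k1 := H.d_below hz'
        have k2 := H.h_mem _ y hy
        have k3 := below_mono (F := F) (show q ≤ m by omega) hz
        rw [Nat.add_sub_cancel] at k1 k2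
        rw [e1]
        exact Submodule.sub_mem _ (Submodule.sub_mem _ k3 k1) k2
      exact (H.proj_same m _ (H.d_mem m y hy)).symm.trans (H.proj_below e2)
    obtain ⟨w, hw, hwy⟩ := H.acyclic m y hy hy0
    obtain ⟨c, hc⟩ := ih (z := z' + y - (d + h) w) (by rwa [map_sub, hd, sub_zero]) (by
      have : z' + y - (d + h) w = z' - h w := by rw [LinearMap.add_apply, hwy]; abel
      have k : h w ∈ below F (m + 1) := by
        have := H.h_mem _ w hw
        rwa [show m + 2 - 1 = m + 1 by omega] at this
      rw [this]
      exact Submodule.sub_mem _ hz' k)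
    exact ⟨w + c, by rwa [map_add, ← sub_sub]⟩

end Filtered

/-! ### Flatness -/

section Kunneth

variable {R : Type u} [CommRing R] {A H N : Type u} [AddCommGroup A] [Module R A]
  [AddCommGroup H] [Module R H] [AddCommGroup N] [Module R N]

open TensorProduct (map)

theorem map_map' {A₁ A₂ A₃ B₁ B₂ B₃ : Type u} [AddCommGroup A₁] [Module R A₁]
    [AddCommGroup A₂] [Module R A₂] [AddCommGroup A₃] [Module R A₃] [AddCommGroup B₁] [Module R B₁]
    [AddCommGroup B₂] [Module R B₂] [AddCommGroup B₃] [Module R B₃]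
    (f : A₂ →ₗ[R] A₃) (g : B₂ →ₗ[R] B₃) (f' : A₁ →ₗ[R] A₂) (g' : B₁ →ₗ[R] B₂) (z : A₁ ⊗[R] B₁) :
    map f g (map f' g' z) = map (f ∘ₗ f') (g ∘ₗ g') z := by
  rw [TensorProduct.map_comp, LinearMap.comp_apply]

/-- The two conditions dz = 0 and ρz = 0 are merged into the kernel of the single map (d, ρ), so the
hypothesis becomes exactness at A, which survives tensoring with a flat module. -/
theorem exists_of_flat_right [Module.Flat R N] {d : A →ₗ[R] A} {ρ : A →ₗ[R] H}
    (hd : ∀ a, d (d a) = 0) (hρ : ∀ a, ρ (d a) = 0)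
    (ex : ∀ a, d a = 0 → ρ a = 0 → ∃ b, d b = a) {z : A ⊗[R] N} (h1 : map d LinearMap.id z = 0)
    (h2 : map ρ LinearMap.id z = 0) : ∃ w, map d LinearMap.id w = z := by
  have hex : Function.Exact d (d.prod ρ) := fun a => by
    constructor
    · intro h
      exact ex a congr(($h).1) congr(($h).2)
    · rintro ⟨b, rfl⟩
      ext <;> simp [hd, hρ]
  refine (Module.Flat.rTensor_exact N hex z).1 ?_
  -- The identity of A × H is split into its two summands in order to test the vanishing of (d, ρ) ⊗
  -- 1 on each component.
  have e : (LinearMap.inl R A H ∘ₗ LinearMap.fst R A H + LinearMap.inr R A H ∘ₗ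
      LinearMap.snd R A H) = LinearMap.id := by ext <;> simp
  change map (d.prod ρ) LinearMap.id z = 0
  rw [← LinearMap.id_comp (d.prod ρ), ← e, LinearMap.add_comp, TensorProduct.map_add_left,
    LinearMap.add_apply, LinearMap.comp_assoc, LinearMap.comp_assoc, LinearMap.fst_prod,
    LinearMap.snd_prod, ← LinearMap.id_comp (LinearMap.id : N →ₗ[R] N), TensorProduct.map_comp,
    TensorProduct.map_comp, LinearMap.comp_apply, LinearMap.comp_apply, h1, h2]
  simp

theorem exists_of_flat_left [Module.Flat R N] {d : A →ₗ[R] A} {ρ : A →ₗ[R] H}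
    (hd : ∀ a, d (d a) = 0) (hρ : ∀ a, ρ (d a) = 0)
    (ex : ∀ a, d a = 0 → ρ a = 0 → ∃ b, d b = a) {z : N ⊗[R] A} (h1 : map LinearMap.id d z = 0)
    (h2 : map LinearMap.id ρ z = 0) : ∃ w, map LinearMap.id d w = z := by
  have hc : ∀ {B : Type u} [AddCommGroup B] [Module R B] (f : A →ₗ[R] B) (z : N ⊗[R] A),
      map f LinearMap.id (TensorProduct.comm R N A z) =
        TensorProduct.comm R N B (map LinearMap.id f z) :=
    fun f z => by
      induction z with
      | zero => simp
      | add x y hx hy => rw [map_add, map_add, hx, hy, map_add, map_add]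
      | tmul a b => rfl
  obtain ⟨w, hw⟩ := exists_of_flat_right (N := N) hd hρ ex (z := TensorProduct.comm R N A z)
    (by rw [hc, h1, map_zero]) (by rw [hc, h2, map_zero])
  refine ⟨(TensorProduct.comm R N A).symm w, ?_⟩
  apply (TensorProduct.comm R N A).injective
  rw [← hc, LinearEquiv.apply_symm_apply, hw]

/-- Künneth theorem for the tensor square of a flat resolution `(A, d) → H` of a flat module. -/
theorem exists_of_tensor_cycle [Module.Flat R A] [Module.Flat R H] {d σ : A →ₗ[R] A}
    {ρ : A →ₗ[R] H} {σ' : H →ₗ[R] H} {e : ℕ → A →ₗ[R] A}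
    (hd : ∀ a, d (d a) = 0) (hρ : ∀ a, ρ (d a) = 0)
    (ex : ∀ a, d a = 0 → ρ a = 0 → ∃ b, d b = a) (surj : Function.Surjective ρ)
    (hσ' : σ' ∘ₗ σ' = LinearMap.id) (hρσ : ρ ∘ₗ σ = σ' ∘ₗ ρ)
    (he : ∀ i, e i ∘ₗ e i = e i) (hne : ∀ i j, i ≠ j → e i ∘ₗ e j = 0)
    (fin : ∀ a, ∃ N, ∀ n, N ≤ n → ∑ i ∈ Finset.range n, e i a = a)
    (hDD : ∀ w : A ⊗[R] A, map d LinearMap.id (map d LinearMap.id w + map σ d w) +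
      map σ d (map d LinearMap.id w + map σ d w) = 0)
    (hde : ∀ i, d ∘ₗ e (i + 1) = e i ∘ₗ d) (hde0 : d ∘ₗ e 0 = 0) (hρe : ρ ∘ₗ e 0 = ρ)
    {z : A ⊗[R] A} (hz : map d LinearMap.id z + map σ d z = 0) (hρz : map ρ ρ z = 0) :
    ∃ w, map d LinearMap.id w + map σ d w = z := by
  have fin' : ∀ z : A ⊗[R] A, ∃ N, ∀ n, N ≤ n →
      ∑ i ∈ Finset.range n, map LinearMap.id (e i) z = z := by
    intro z
    induction z with
    | zero => exact ⟨0, by simp⟩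
    | add x y hx hy =>
      obtain ⟨N, hN⟩ := hx
      obtain ⟨N', hN'⟩ := hy
      refine ⟨max N N', fun n hn => ?_⟩
      simp only [map_add, Finset.sum_add_distrib]
      rw [hN n (le_of_max_le_left hn), hN' n (le_of_max_le_right hn)]
    | tmul a b =>
      obtain ⟨N, hN⟩ := fin b
      exact ⟨N, fun n hn => by simp [← TensorProduct.tmul_sum, hN n hn]⟩
  have ρd : ρ ∘ₗ d = 0 := LinearMap.ext hρ
  -- The case in which ρ ⊗ 1 kills z, by induction on a bound for the resolution degree of the
  -- second factor. The top component is a cycle for d ⊗ 1 alone and is killed by ρ ⊗ 1; flatness of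
  -- A makes it a boundary for d ⊗ 1, which is subtracted.
  have step : ∀ (j : ℕ) (z : A ⊗[R] A), (∀ i, j ≤ i → map LinearMap.id (e i) z = 0) →
      map d LinearMap.id z + map σ d z = 0 → map ρ LinearMap.id z = 0 →
      ∃ w, map d LinearMap.id w + map σ d w = z := by
    intro j
    induction j with
    | zero =>
      intro z h0 _ _
      obtain ⟨N, hN⟩ := fin' z
      exact ⟨0, by rw [← hN N le_rfl, Finset.sum_eq_zero fun i _ => h0 i (Nat.zero_le _)]; simp⟩
    | succ j ih =>
      intro z h0 hz hρz
      have y1 : map d LinearMap.id (map LinearMap.id (e j) z) = 0 := by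
        have e1 : map d (e j) z = map LinearMap.id (e j) (map d LinearMap.id z) := by
          rw [map_map']; rfl
        have e2 : map LinearMap.id (e j) (map σ d z) = 0 := by
          rw [map_map', ← hde, LinearMap.id_comp, ← LinearMap.comp_id σ, ← map_map', h0 _ le_rfl,
            map_zero]
        rw [map_map', LinearMap.comp_id, LinearMap.id_comp, e1, eq_neg_of_add_eq_zero_left hz,
          map_neg, e2, neg_zero]
      have y2 : map ρ LinearMap.id (map LinearMap.id (e j) z) = 0 := by
        rw [map_map', LinearMap.comp_id, LinearMap.id_comp, ← LinearMap.id_comp ρ,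
          ← LinearMap.comp_id (e j), ← map_map', hρz, map_zero]
      obtain ⟨w₀, hw₀⟩ := exists_of_flat_right hd hρ ex y1 y2
      -- Dropping index zero in the first factor does not change (d ⊗ 1)w₀, as d vanishes there, but
      -- makes ρ ⊗ 1 kill w, which keeps the induction hypothesis intact. The factor `e j` ensures
      -- that σ ⊗ d only contributes to lower components.
      obtain ⟨w, hw⟩ : ∃ w, w = map (LinearMap.id - e 0) (e j) w₀ := ⟨_, rfl⟩
      have w1 : map d LinearMap.id w = map LinearMap.id (e j) z := by
        rw [hw, map_map', LinearMap.comp_sub, hde0, LinearMap.comp_id, sub_zero, LinearMap.id_comp]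
        have : map d (e j) w₀ = map LinearMap.id (e j) (map d LinearMap.id w₀) := by
          rw [map_map']; rfl
        rw [this, hw₀, map_map', he]
        rfl
      have w2 : ∀ g : A →ₗ[R] A, map ρ g w = 0 := fun g => by
        rw [hw, map_map', LinearMap.comp_sub, hρe, LinearMap.comp_id, sub_self,
          TensorProduct.map_zero_left, LinearMap.zero_apply]
      have w3 : ∀ i, j ≤ i → map LinearMap.id (e i) (map σ d w) = 0 := fun i hi => by
        have h3 : (e i ∘ₗ d) ∘ₗ e j = 0 := by
          rw [← hde, LinearMap.comp_assoc, hne (i + 1) j (by omega), LinearMap.comp_zero]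
        rw [hw, map_map', map_map', h3, TensorProduct.map_zero_right, LinearMap.zero_apply]
      obtain ⟨w', hw'⟩ := ih (z - (map d LinearMap.id w + map σ d w)) (fun i hi => by
          rw [w1, map_sub, map_add, w3 i hi, add_zero, map_map']
          rcases hi.eq_or_lt with rfl | hi
          · rw [he]; exact sub_self _
          · rw [hne i j hi.ne', h0 i hi, TensorProduct.map_zero_right]; simp) (by
          rw [map_sub, map_sub, sub_add_sub_comm, hz, hDD, sub_zero]) (by
          have k1 : map σ' d (map ρ LinearMap.id w) = 0 := by rw [w2, map_zero]
          rw [map_map', ← hρσ, LinearMap.comp_id] at k1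
          rw [map_sub, hρz, map_add, map_map', map_map', ρd, LinearMap.id_comp,
            LinearMap.id_comp, TensorProduct.map_zero_left, k1]
          simp)
      exact ⟨w + w', by rw [map_add, map_add, add_add_add_comm, hw']; abel⟩
  have vanish : ∀ z : A ⊗[R] A, ∃ N, ∀ i, N ≤ i → map LinearMap.id (e i) z = 0 := fun z => by
    obtain ⟨N, hN⟩ := fin' z
    refine ⟨N, fun i hi => ?_⟩
    have := hN (i + 1) (by omega)
    rwa [Finset.sum_range_succ, hN i hi, add_eq_left] at this
  -- Reduction to `step`: (ρ ⊗ 1)z is a cycle for 1 ⊗ d killed by 1 ⊗ ρ, hence (1 ⊗ d)y by flatness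
  -- of H.
  have c1 : map LinearMap.id d (map ρ LinearMap.id z) = 0 := by
    have c : map σ' LinearMap.id (map ρ LinearMap.id (map d LinearMap.id z + map σ d z)) = 0 := by
      rw [hz, map_zero, map_zero]
    rw [map_add, map_map', map_map', ρd, TensorProduct.map_zero_left, LinearMap.zero_apply,
      zero_add, map_map', hρσ, ← LinearMap.comp_assoc, hσ'] at c
    rw [map_map']
    exact c
  have c2 : map LinearMap.id ρ (map ρ LinearMap.id z) = 0 := by rw [map_map']; exact hρz
  obtain ⟨y, hy⟩ := exists_of_flat_left hd hρ ex c1 c2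
  -- The element y is lifted after twisting by σ', because the tensor differential applies σ to the
  -- left factor and σ'σ' = 1. Subtracting the boundary of w then kills (ρ ⊗ 1)z.
  obtain ⟨w, hw⟩ := TensorProduct.map_surjective surj (g' := (LinearMap.id : A →ₗ[R] A)) Function.surjective_id
    (map σ' LinearMap.id y)
  obtain ⟨N, hN⟩ := vanish (z - (map d LinearMap.id w + map σ d w))
  obtain ⟨w', hw'⟩ := step N (z - (map d LinearMap.id w + map σ d w)) hN
    (by rw [map_sub, map_sub, sub_add_sub_comm, hz, hDD, sub_zero]) (by
      have k1 : map ρ LinearMap.id (map σ d w) = map ρ LinearMap.id z := by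
        have k2 : map ρ LinearMap.id (map σ d w) = map σ' d (map ρ LinearMap.id w) := by
          rw [map_map', map_map', hρσ]; rfl
        have k3 : map ρ LinearMap.id w = map σ' LinearMap.id y := hw
        rw [k2, k3, map_map', hσ']
        exact hy
      rw [map_sub, map_add, k1, map_map', ρd, TensorProduct.map_zero_left, LinearMap.zero_apply,
        zero_add, sub_self])
  exact ⟨w + w', by rw [map_add, map_add, add_add_add_comm, hw']; abel⟩

end Kunneth

/-! ### Multiplicative filtrations -/

section Below

variable {R : Type u} [CommRing R]

/-- The elements in some step of the filtration. -/
def exhausted {M : Type u} [AddCommGroup M] [Module R M] (F : ℕ → Submodule R M) :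
    Submodule R M where
  carrier := {z | ∃ N, z ∈ below F N}
  add_mem' := by
    rintro a b ⟨N, hN⟩ ⟨N', hN'⟩
    exact ⟨max N N', Submodule.add_mem _ (below_mono (le_max_left _ _) hN)
      (below_mono (le_max_right _ _) hN')⟩
  zero_mem' := ⟨0, Submodule.zero_mem _⟩
  smul_mem' := by
    rintro r a ⟨N, hN⟩
    exact ⟨N, Submodule.smul_mem _ _ hN⟩

theorem le_exhausted {M : Type u} [AddCommGroup M] [Module R M] (F : ℕ → Submodule R M) (q : ℕ) :
    F q ≤ exhausted F := fun _ hz => ⟨q + 1, le_below (Nat.lt_succ_self q) hz⟩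

theorem map_below {M N : Type u} [AddCommGroup M] [Module R M] [AddCommGroup N] [Module R N]
    {F : ℕ → Submodule R M} {G : ℕ → Submodule R N} {f : M →ₗ[R] N}
    (hf : ∀ q, ∀ a ∈ F q, f a ∈ G q) {q : ℕ} {a : M} (ha : a ∈ below F q) : f a ∈ below G q :=
  below_le (N := (below G q).comap f) (fun i hi a ha => le_below hi (hf i a ha)) ha

theorem map_below_succ {M N : Type u} [AddCommGroup M] [Module R M] [AddCommGroup N] [Module R N]
    {F : ℕ → Submodule R M} {G : ℕ → Submodule R N} {f : M →ₗ[R] N} {g : M →ₗ[R] N}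
    (hf : ∀ q, ∀ a ∈ F q, f a ∈ G q) (h : ∀ q, ∀ a ∈ F q, g a - f a ∈ below G q)
    {q : ℕ} {a : M} (ha : a ∈ below F q) : g a ∈ below G q :=
  below_le (N := (below G q).comap g) (fun i hi a ha => by
    have := Submodule.add_mem _ (below_mono hi.le (h i a ha)) (le_below hi (hf i a ha))
    rwa [sub_add_cancel] at this) ha

variable {B : Type u} [Ring B] [Algebra R B] {F : ℕ → Submodule R B}

theorem mul_below (hF : ∀ i j, ∀ a ∈ F i, ∀ b ∈ F j, a * b ∈ F (i + j)) {i q : ℕ} {a b : B}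
    (ha : a ∈ F i) (hb : b ∈ below F q) : a * b ∈ below F (i + q) :=
  below_le (N := (below F (i + q)).comap (LinearMap.mulLeft R a))
    (fun j hj b hb => le_below (by omega) (hF i j a ha b hb)) hb

theorem below_mul (hF : ∀ i j, ∀ a ∈ F i, ∀ b ∈ F j, a * b ∈ F (i + j)) {i q : ℕ} {a b : B}
    (ha : a ∈ below F q) (hb : b ∈ below F (i + 1)) : a * b ∈ below F (q + i) :=
  below_le (N := (below F (q + i)).comap (LinearMap.mulRight R b))
    (fun j hj a ha => below_mono (by omega) (mul_below hF ha hb)) ha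

variable {A : Type u} [Ring A] [Algebra R A] {𝒜 : ℕ → Submodule R A} [GradedAlgebra 𝒜]
  {X : Type u} {gen : X → A} {deg : X → ℕ}

/-- If an algebra map agrees with a filtered map on generators, modulo lower terms, then it does so
everywhere. -/
theorem sub_mem_below_of_gen (hfree : Function.Bijective (FreeAlgebra.lift R gen))
    (hdeg : ∀ x, gen x ∈ 𝒜 (deg x)) (hF : ∀ i j, ∀ a ∈ F i, ∀ b ∈ F j, a * b ∈ F (i + j))
    {u v : A →ₐ[R] B} (hv : ∀ q, ∀ a ∈ 𝒜 q, v a ∈ F q)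
    (h : ∀ x, u (gen x) - v (gen x) ∈ below F (deg x)) (q : ℕ) (a : A) (ha : a ∈ 𝒜 q) :
    u a - v a ∈ below F q := by
  refine graded_le_of_words hfree hdeg (N := (below F q).comap (u.toLinearMap - v.toLinearMap))
    (fun l hl => ?_) ha
  clear ha
  subst hl
  induction l with
  | nil => simp
  | cons x l ih =>
    simp only [Submodule.mem_comap, List.map_cons, List.prod_cons, List.sum_cons,
      LinearMap.sub_apply, AlgHom.toLinearMap_apply, map_mul] at ih ⊢
    generalize (l.map gen).prod = b, word_mem hdeg l = hb at ih ⊢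
    have e : u (gen x) * u b - v (gen x) * v b =
        (u (gen x) - v (gen x)) * u b + v (gen x) * (u b - v b) := by noncomm_ring
    rw [e]
    refine Submodule.add_mem _ (below_mul hF (h x) ?_) (mul_below hF (hv _ _ (hdeg x)) ih)
    have := Submodule.add_mem _ (below_mono (Nat.le_succ _) ih)
      (le_below (Nat.lt_succ_self _) (hv _ _ hb))
    rwa [sub_add_cancel] at this

theorem deriv_mem_below (hfree : Function.Bijective (FreeAlgebra.lift R gen))
    (hdeg : ∀ x, gen x ∈ 𝒜 (deg x)) {u : A →ₐ[R] A} (hu : ∀ q, ∀ a ∈ 𝒜 q, u a ∈ 𝒜 q)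
    {D : A →ₗ[R] A} (hD : ∀ a b, D (a * b) = u a * D b + D a * b)
    (h : ∀ x, D (gen x) ∈ below 𝒜 (deg x - 1)) (q : ℕ) (a : A) (ha : a ∈ 𝒜 q) :
    D a ∈ below 𝒜 (q - 1) := by
  have hF : ∀ i j, ∀ a ∈ 𝒜 i, ∀ b ∈ 𝒜 j, a * b ∈ 𝒜 (i + j) :=
    fun i j a ha b hb => SetLike.GradedMul.mul_mem ha hb
  refine graded_le_of_words hfree hdeg (N := (below 𝒜 (q - 1)).comap D) (fun l hl => ?_) ha
  clear ha
  subst hl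
  induction l with
  | nil =>
    have : D 1 = 0 := deriv_map_one (F := u) (G := AlgHom.id R A) hD
    simp [this]
  | cons x l ih =>
    simp only [Submodule.mem_comap, List.map_cons, List.prod_cons, List.sum_cons] at ih ⊢
    have hb := word_mem hdeg l
    generalize (l.map gen).prod = b at ih hb ⊢
    rw [hD]
    refine Submodule.add_mem _ ?_ ?_
    -- Index zero is separate because of truncated subtraction: there `below 𝒜 (0 - 1)` is zero and
    -- the term vanishes, whereas i + (0 - 1) would not be (i + 0) - 1.
    · rcases Nat.eq_zero_or_pos (l.map deg).sum with h0 | h0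
      · rw [h0, mem_below_zero] at ih
        rw [ih, mul_zero]
        exact Submodule.zero_mem _
      · exact below_mono (by omega) (mul_below hF (hu _ _ (hdeg x)) ih)
    · have h' := h x
      rcases Nat.eq_zero_or_pos (deg x) with h0 | h0
      · rw [h0, mem_below_zero] at h'
        rw [h', zero_mul]
        exact Submodule.zero_mem _
      · exact below_mono (by omega) (below_mul hF h' (le_below (Nat.lt_succ_self _) hb))

/-- `IsPerturbedComplex` for a complex whose cycles of positive index are boundaries. -/
theorem IsPerturbedComplex.of_exists {M : Type u} [AddCommGroup M] [Module R M]
    {F : ℕ → Submodule R M} {P : ℕ → M →ₗ[R] M} {d h : M →ₗ[R] M}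
    (exhaust : ∀ z, ∃ N, z ∈ below F N) (mem : ∀ q z, P q z ∈ F q)
    (proj_same : ∀ q, ∀ z ∈ F q, P q z = z)
    (proj_ne : ∀ i q, i ≠ q → ∀ z ∈ F i, P q z = 0) (d_mem : ∀ q, ∀ z ∈ F (q + 1), d z ∈ F q)
    (d_zero : ∀ z ∈ F 0, d z = 0) (h_mem : ∀ q, ∀ z ∈ F q, h z ∈ below F (q - 1))
    (acyclic : ∀ q, ∀ z ∈ F (q + 1), d z = 0 → ∃ w, d w = z) : IsPerturbedComplex F P d h where
  exhaust := exhaust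
  proj_same := proj_same
  proj_ne := proj_ne
  d_mem := d_mem
  d_zero := d_zero
  h_mem := h_mem
  acyclic q z hz hdz := by
    obtain ⟨w, rfl⟩ := acyclic q z hz hdz
    -- The given w need not be homogeneous in the index. Its component of index q + 2 suffices,
    -- because the projections commute with d up to the shift.
    refine ⟨P (q + 2) w, mem _ _, ?_⟩
    have key : ∀ w, d (P (q + 2) w) = P (q + 1) (d w) := fun w => by
      obtain ⟨N, hN⟩ := exhaust w
      refine below_le (N := LinearMap.eqLocus (d ∘ₗ P (q + 2)) (P (q + 1) ∘ₗ d))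
        (fun i _ w hw => ?_) hN
      change d (P (q + 2) w) = P (q + 1) (d w)
      by_cases hi : i = q + 2
      · subst hi
        rw [proj_same _ _ hw, proj_same _ _ (d_mem _ _ hw)]
      · rw [proj_ne _ _ hi _ hw, map_zero]
        cases i with
        | zero => rw [d_zero _ hw, map_zero]
        | succ i => rw [proj_ne i _ (by omega) _ (d_mem _ _ hw)]
    rw [key, proj_same _ _ hz]

end Below

/-! ### Hopf resolutions -/

namespace HopfResolution

open GradedTensorProduct (tmul)

variable {R : Type u} [CommRing R] {H : GradedHopfAlgebra R} (Q : HopfResolution H)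

attribute [instance] HopfResolution.resGraded

/-- The generators have positive degree. -/
def Positive : Prop :=
  ∀ x, Q.gen x ∈ Q.toHah.grading (max 1 (Q.resDeg x + Q.intDeg x))

/-- The range condition speaks of some free generating family, not of the bihomogeneous one. A
bihomogeneous generator of degree at most zero would be a scalar, since the algebra is positively
generated, and a free generator over a nontrivial ring is not a scalar. Over the trivial ring
everything is zero, which is why `Positive` is a membership with `max 1` and not an inequality of
degrees. -/
theorem positive_of_hasGeneratorsInRange {r n : ℕ} (hr : 1 ≤ r)
    (hQ : HasGeneratorsInRange Q.toHah.grading r n) : Q.Positive := by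
  intro x
  obtain ⟨G⟩ := hQ.freeGen hr
  rcases subsingleton_or_nontrivial R with hR | hR
  · have := Module.subsingleton R Q.toHah.carrier
    rw [Subsingleton.elim (Q.gen x) 0]
    exact Submodule.zero_mem _
  · rcases le_or_gt 1 ((Q.resDeg x : ℤ) + Q.intDeg x) with h | h
    · rw [max_eq_right h]
      exact Q.gen_mem_grading x
    · exfalso
      have hN : Q.gen x ∈ Submodule.span R {(1 : Q.toHah.carrier)} := by
        refine graded_le_of_words G.free G.mem (fun l hl => ?_) (Q.gen_mem_grading x)
        cases l with
        | nil => simp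
        | cons y l =>
          have h1 := G.pos y
          have h2 : 0 ≤ (l.map G.deg).sum := List.sum_nonneg (by
            intro k hk; obtain ⟨z, -, rfl⟩ := List.mem_map.1 hk; linarith [G.pos z])
          simp only [List.map_cons, List.sum_cons] at hl
          omega
      obtain ⟨r, hr⟩ := Submodule.mem_span_singleton.1 hN
      have : FreeAlgebra.lift R Q.gen (FreeAlgebra.ι R x) =
          FreeAlgebra.lift R Q.gen (algebraMap R _ r) := by
        rw [FreeAlgebra.lift_ι_apply, AlgHom.commutes, Algebra.algebraMap_eq_smul_one, hr]
      exact FreeAlgebra.ι_ne_algebraMap x r (Q.gen_free.1 this)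

variable {Q}

/-- The generators of a Hopf resolution. -/
def freeGen (hQ : Q.Positive) : FreeGen Q.toHah.grading where
  X := Q.X
  gen := Q.gen
  deg x := max 1 (Q.resDeg x + Q.intDeg x)
  free := Q.gen_free
  mem := hQ
  pos _ := le_max_left _ _

theorem res_mul (i j : ℕ) (a : Q.toHah.carrier) (ha : a ∈ Q.res i) (b : Q.toHah.carrier)
    (hb : b ∈ Q.res j) : a * b ∈ Q.res (i + j) := SetLike.GradedMul.mul_mem ha hb

/-- Words in the generators are homogeneous for both gradings, so the pieces of fixed resolution
degree are spanned by bihomogeneous elements. -/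
theorem res_le {q : ℕ} {N : Submodule R Q.toHah.carrier}
    (h : ∀ k, ∀ a ∈ Q.res q, a ∈ Q.toHah.grading k → a ∈ N) : Q.res q ≤ N :=
  graded_le_of_words Q.gen_free Q.gen_mem_res fun l hl =>
    h _ _ (hl ▸ word_mem Q.gen_mem_res l) (word_mem Q.gen_mem_grading l)

theorem sgn_mem_res {q : ℕ} {a : Q.toHah.carrier} (ha : a ∈ Q.res q) :
    sgn Q.toHah.grading a ∈ Q.res q :=
  res_le (N := (Q.res q).comap (sgn Q.toHah.grading).toLinearMap) (fun k a ha hk => by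
    change sgn Q.toHah.grading a ∈ Q.res q
    rw [sgn_apply, signMap_apply _ hk]
    exact (Q.res q).toAddSubgroup.zsmul_mem ha _) ha

theorem proj_mem_res (i : ℤ) {q : ℕ} {a : Q.toHah.carrier} (ha : a ∈ Q.res q) :
    GradedAlgebra.proj Q.toHah.grading i a ∈ Q.res q :=
  res_le (N := (Q.res q).comap (GradedAlgebra.proj Q.toHah.grading i)) (fun k a ha hk => by
    change GradedAlgebra.proj Q.toHah.grading i a ∈ Q.res q
    by_cases h : k = i
    · rw [proj_of_mem (h ▸ hk)]; exact ha
    · rw [proj_of_mem_ne hk h]; exact Submodule.zero_mem _) ha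

theorem proj_res_mem {i : ℤ} (q : ℕ) {a : Q.toHah.carrier} (ha : a ∈ Q.toHah.grading i) :
    GradedAlgebra.proj Q.res q a ∈ Q.toHah.grading i := by
  refine graded_le_of_words Q.gen_free Q.gen_mem_grading
    (N := (Q.toHah.grading i).comap (GradedAlgebra.proj Q.res q)) (fun l hl => ?_) ha
  change GradedAlgebra.proj Q.res q _ ∈ Q.toHah.grading i
  by_cases h : (l.map Q.resDeg).sum = q
  · rw [proj_of_mem (h ▸ word_mem Q.gen_mem_res l)]
    exact hl ▸ word_mem Q.gen_mem_grading l
  · rw [proj_of_mem_ne (word_mem Q.gen_mem_res l) h]; exact Submodule.zero_mem _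

theorem exhaust (a : Q.toHah.carrier) : ∃ N, a ∈ below Q.res N :=
  mem_of_homogeneous Q.res (exhausted Q.res) (le_exhausted Q.res) a

theorem ρ_proj_zero (a : Q.toHah.carrier) : Q.ρ (GradedAlgebra.proj Q.res 0 a) = Q.ρ a := by
  have : Q.ρ.toLinearMap ∘ₗ GradedAlgebra.proj Q.res 0 = Q.ρ.toLinearMap :=
    graded_hom_ext Q.res fun i a ha => by
      simp only [LinearMap.comp_apply, AlgHom.toLinearMap_apply]
      by_cases h : i = 0
      · rw [proj_of_mem (h ▸ ha)]
      · rw [proj_of_mem_ne ha h, map_zero, Q.ρ_res i h a ha]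
  exact congr($this a)

theorem exists_res_zero (y : H.carrier) : ∃ a ∈ Q.res 0, Q.ρ a = y := by
  obtain ⟨a, -, rfl⟩ := Q.ρ_surjective y
  exact ⟨GradedAlgebra.proj Q.res 0 a, proj_mem _ _ _, ρ_proj_zero a⟩

theorem ρ_proj (i : ℤ) (a : Q.toHah.carrier) :
    Q.ρ (GradedAlgebra.proj Q.toHah.grading i a) = GradedAlgebra.proj H.grading i (Q.ρ a) :=
  (proj_comm Q.toHah.grading H.grading (f := Q.ρ.toLinearMap) (m := 0)
    (fun i a ha => by rw [add_zero]; exact Q.ρ_mem i a ha) (add_zero i).symm a).symm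

theorem exists_res_zero_of_mem {i : ℤ} {y : H.carrier} (hy : y ∈ H.grading i) :
    ∃ a ∈ Q.res 0, a ∈ Q.toHah.grading i ∧ Q.ρ a = y := by
  obtain ⟨a, ha, rfl⟩ := exists_res_zero (Q := Q) y
  exact ⟨_, proj_mem_res i ha, proj_mem _ _ _, by rw [ρ_proj, proj_of_mem hy]⟩

theorem counit_res {q : ℕ} (hq : q ≠ 0) {a : Q.toHah.carrier} (ha : a ∈ Q.res q) :
    Q.toHah.counit a = 0 := by rw [← Q.ρ_counit, Q.ρ_res q hq a ha, map_zero]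

theorem d_proj (q : ℕ) (a : Q.toHah.carrier) :
    Q.toHah.d (GradedAlgebra.proj Q.res (q + 1) a) = GradedAlgebra.proj Q.res q (Q.toHah.d a) := by
  have : Q.toHah.d ∘ₗ GradedAlgebra.proj Q.res (q + 1) =
      GradedAlgebra.proj Q.res q ∘ₗ Q.toHah.d :=
    graded_hom_ext Q.res fun i a ha => by
      simp only [LinearMap.comp_apply]
      cases i with
      | zero =>
        rw [proj_of_mem_ne ha (Nat.succ_ne_zero q).symm, Q.d_res_zero a ha, map_zero, map_zero]
      | succ i =>
        by_cases h : i = q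
        · rw [proj_of_mem (h ▸ ha), proj_of_mem (h ▸ Q.d_res i a ha)]
        · rw [proj_of_mem_ne ha (by omega), proj_of_mem_ne (Q.d_res i a ha) h, map_zero]
  exact congr($this a)

theorem sum_proj {n : ℕ} {a : Q.toHah.carrier} (ha : a ∈ below Q.res n) :
    ∑ i ∈ Finset.range n, GradedAlgebra.proj Q.res i a = a := by
  refine below_le (N := LinearMap.eqLocus (∑ i ∈ Finset.range n, GradedAlgebra.proj Q.res i)
    LinearMap.id) (fun i hi a ha => ?_) ha |> fun h => by simpa using h
  change (∑ i ∈ Finset.range n, GradedAlgebra.proj Q.res i) a = a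
  rw [LinearMap.sum_apply, Finset.sum_eq_single i, proj_of_mem ha]
  · exact fun j _ hj => proj_of_mem_ne ha hj.symm
  · exact fun h => absurd (Finset.mem_range.2 hi) h

/-- In positive resolution degree ρ vanishes, so the isomorphism on homology forces cycles to be
boundaries. -/
theorem isPerturbedComplex {h : Q.toHah.carrier →ₗ[R] Q.toHah.carrier}
    (hh : ∀ q, ∀ a ∈ Q.res q, h a ∈ below Q.res (q - 1)) :
    IsPerturbedComplex Q.res (GradedAlgebra.proj Q.res) Q.toHah.d h :=
  .of_exists exhaust (proj_mem Q.res) (fun _ _ hz => proj_of_mem hz)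
    (fun _ _ hi _ hz => proj_of_mem_ne hz hi) Q.d_res Q.d_res_zero hh
    fun q z hz hdz => Q.ρ_injective z hdz (Q.ρ_res _ (Nat.succ_ne_zero q) z hz)

/-! #### The tensor square -/

/-- The tensor square of a Hopf resolution. -/
abbrev sq (Q : HopfResolution H) : Type u := Q.toHah.grading ᵍ⊗[R] Q.toHah.grading

/-- The resolution degree on the tensor square. -/
abbrev res₂ (Q : HopfResolution H) : ℕ → Submodule R Q.sq := tensorRes Q.toHah.grading Q.res

theorem tmul_mem_res₂ {i j q : ℕ} (h : i + j = q) {a b : Q.toHah.carrier} (ha : a ∈ Q.res i)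
    (hb : b ∈ Q.res j) : (tmul R a b : Q.sq) ∈ Q.res₂ q :=
  Submodule.subset_span ⟨i, j, h, a, ha, b, hb, rfl⟩

/-- `a ⊗ b` as a linear function of `a`. -/
def tmulRight (b : Q.toHah.carrier) : Q.toHah.carrier →ₗ[R] Q.sq where
  toFun a := tmul R a b
  map_add' a a' := add_tmul' a a' b
  map_smul' r a := smul_tmul'' r a b

/-- `a ⊗ b` as a linear function of `b`. -/
def tmulLeft (a : Q.toHah.carrier) : Q.toHah.carrier →ₗ[R] Q.sq where
  toFun b := tmul R a b
  map_add' b b' := tmul_add' a b b'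
  map_smul' r b := tmul_smul'' r a b

theorem res₂_le {q : ℕ} {N : Submodule R Q.sq}
    (h : ∀ i j, i + j = q → ∀ k l, ∀ a ∈ Q.res i, a ∈ Q.toHah.grading k → ∀ b ∈ Q.res j,
      b ∈ Q.toHah.grading l → tmul R a b ∈ N) : Q.res₂ q ≤ N := by
  refine Submodule.span_le.2 ?_
  rintro _ ⟨i, j, hij, a, ha, b, hb, rfl⟩
  refine res_le (N := N.comap (tmulRight b)) (fun k a ha hk => ?_) ha
  exact res_le (N := N.comap (tmulLeft a)) (fun l b hb hl => h i j hij k l a ha hk b hb hl) hb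

theorem sq_mem {N : Submodule R Q.sq} (h : ∀ q, Q.res₂ q ≤ N) (t : Q.sq) : t ∈ N := by
  refine tensor_induction (P := fun t => t ∈ N) N.zero_mem (fun _ _ => N.add_mem) (fun a b => ?_) t
  refine mem_of_homogeneous Q.res (N.comap (tmulRight b)) (fun i a ha => ?_) a
  exact mem_of_homogeneous Q.res (N.comap (tmulLeft a))
    (fun j b hb => h (i + j) (tmul_mem_res₂ rfl ha hb)) b

theorem exhaust₂ (t : Q.sq) : ∃ N, t ∈ below Q.res₂ N :=
  sq_mem (N := exhausted Q.res₂) (le_exhausted Q.res₂) t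

theorem res₂_mul (i j : ℕ) (s : Q.sq) (hs : s ∈ Q.res₂ i) (t : Q.sq) (ht : t ∈ Q.res₂ j) :
    s * t ∈ Q.res₂ (i + j) := by
  refine res₂_le (N := (Q.res₂ (i + j)).comap (LinearMap.mulRight R t)) ?_ hs
  rintro i₁ i₂ rfl k₁ k₂ a ha hak b hb hbk
  refine res₂_le (N := (Q.res₂ (i₁ + i₂ + j)).comap (LinearMap.mulLeft R (tmul R a b))) ?_ ht
  rintro j₁ j₂ rfl l₁ l₂ a' ha' hal' b' hb' hbl'
  change (tmul R a b : Q.sq) * (tmul R a' b' : Q.sq) ∈ Q.res₂ (i₁ + i₂ + (j₁ + j₂))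
  rw [tmul_mul_tmul a hbk hal' b']
  exact (Q.res₂ _).toAddSubgroup.zsmul_mem
    (tmul_mem_res₂ (by omega) (res_mul _ _ _ ha _ ha') (res_mul _ _ _ hb _ hb')) _

theorem proj_mem_res₂ (k : ℤ) {q : ℕ} {t : Q.sq} (ht : t ∈ Q.res₂ q) :
    GradedAlgebra.proj (tensorGrading Q.toHah.grading Q.toHah.grading) k t ∈ Q.res₂ q := by
  refine res₂_le (N := (Q.res₂ q).comap
    (GradedAlgebra.proj (tensorGrading Q.toHah.grading Q.toHah.grading) k)) ?_ ht
  intro i j hij k₁ k₂ a ha hak b hb hbk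
  change GradedAlgebra.proj (tensorGrading Q.toHah.grading Q.toHah.grading) k
    (tmul R a b : Q.sq) ∈ Q.res₂ q
  have hm : (tmul R a b : Q.sq) ∈ tensorGrading Q.toHah.grading Q.toHah.grading (k₁ + k₂) :=
    tmul_mem_tensorGrading rfl hak hbk
  by_cases h : k₁ + k₂ = k
  · subst h
    rw [proj_of_mem hm]; exact tmul_mem_res₂ hij ha hb
  · rw [proj_of_mem_ne hm h]; exact Submodule.zero_mem _

variable (Q) in
/-- The projections onto the parts of fixed resolution degree of the tensor square. -/
def proj₂ (q : ℕ) : Q.sq →ₗ[R] Q.sq :=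
  ∑ ij ∈ Finset.HasAntidiagonal.antidiagonal q,
    tensorMap (GradedAlgebra.proj Q.res ij.1) (GradedAlgebra.proj Q.res ij.2)

theorem proj₂_tmul (q : ℕ) (a b : Q.toHah.carrier) : Q.proj₂ q (tmul R a b) =
    ∑ ij ∈ Finset.HasAntidiagonal.antidiagonal q,
      tmul R (GradedAlgebra.proj Q.res ij.1 a) (GradedAlgebra.proj Q.res ij.2 b) := by
  simp [proj₂, LinearMap.sum_apply]

theorem proj₂_mem (q : ℕ) (t : Q.sq) : Q.proj₂ q t ∈ Q.res₂ q := by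
  refine tensor_induction (P := fun t => Q.proj₂ q t ∈ Q.res₂ q) ?_ ?_ (fun a b => ?_) t
  · rw [map_zero]; exact Submodule.zero_mem _
  · intro x y hx hy
    rw [map_add]; exact Submodule.add_mem _ hx hy
  · rw [proj₂_tmul]
    exact Submodule.sum_mem _ fun ij hij => tmul_mem_res₂ (Finset.HasAntidiagonal.mem_antidiagonal.1 hij)
      (proj_mem _ _ _) (proj_mem _ _ _)

theorem proj₂_of_mem (q : ℕ) (t : Q.sq) (ht : t ∈ Q.res₂ q) : Q.proj₂ q t = t := by
  refine Submodule.span_le (p := LinearMap.eqLocus (Q.proj₂ q) LinearMap.id).2 ?_ ht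
  rintro _ ⟨i, j, hij, a, ha, b, hb, rfl⟩
  change Q.proj₂ q _ = _
  rw [proj₂_tmul, Finset.sum_eq_single (i, j), proj_of_mem ha, proj_of_mem hb]
  · rfl
  · rintro ⟨i', j'⟩ - h
    by_cases hi : i = i'
    · have hj : j ≠ j' := fun hj => h (by rw [hi, hj])
      rw [proj_of_mem_ne hb hj, tmul_zero']
    · rw [proj_of_mem_ne ha hi, zero_tmul']
  · intro h
    exact absurd (Finset.HasAntidiagonal.mem_antidiagonal.2 hij) h

theorem proj₂_of_mem_ne (p q : ℕ) (hpq : p ≠ q) (t : Q.sq) (ht : t ∈ Q.res₂ p) :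
    Q.proj₂ q t = 0 := by
  refine Submodule.span_le (p := LinearMap.ker (Q.proj₂ q)).2 ?_ ht
  rintro _ ⟨i, j, hij, a, ha, b, hb, rfl⟩
  change Q.proj₂ q _ = 0
  rw [proj₂_tmul]
  refine Finset.sum_eq_zero ?_
  rintro ⟨i', j'⟩ h
  have h' := Finset.HasAntidiagonal.mem_antidiagonal.1 h
  dsimp only at h' ⊢
  by_cases hi : i = i'
  · rw [proj_of_mem_ne hb (show j ≠ j' by omega), tmul_zero']
  · rw [proj_of_mem_ne ha hi, zero_tmul']

theorem tensorD_mem_res₂ (q : ℕ) (t : Q.sq) (ht : t ∈ Q.res₂ (q + 1)) :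
    Q.toHah.d₂ t ∈ Q.res₂ q := by
  refine Submodule.span_le (p := (Q.res₂ q).comap Q.toHah.d₂).2 ?_ ht
  rintro _ ⟨i, j, hij, a, ha, b, hb, rfl⟩
  change tensorD _ _ _ _ _ ∈ Q.res₂ q
  rw [tensorD_tmul]
  refine Submodule.add_mem _ ?_ ?_
  · cases i with
    | zero => rw [Q.d_res_zero a ha, zero_tmul']; exact Submodule.zero_mem _
    | succ i => exact tmul_mem_res₂ (by omega) (Q.d_res i a ha) hb
  · cases j with
    | zero => rw [Q.d_res_zero b hb, tmul_zero']; exact Submodule.zero_mem _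
    | succ j => exact tmul_mem_res₂ (by omega) (sgn_mem_res ha) (Q.d_res j b hb)

theorem tensorD_res₂_zero (t : Q.sq) (ht : t ∈ Q.res₂ 0) : Q.toHah.d₂ t = 0 := by
  refine Submodule.span_le (p := LinearMap.ker Q.toHah.d₂).2 ?_ ht
  rintro _ ⟨i, j, hij, a, ha, b, hb, rfl⟩
  obtain ⟨rfl, rfl⟩ : i = 0 ∧ j = 0 := by omega
  change tensorD _ _ _ _ _ = 0
  rw [tensorD_tmul, Q.d_res_zero a ha, Q.d_res_zero b hb, zero_tmul', tmul_zero', add_zero]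

theorem tmul_below_left {i q : ℕ} {a b : Q.toHah.carrier} (ha : a ∈ below Q.res q)
    (hb : b ∈ Q.res i) : (tmul R a b : Q.sq) ∈ below Q.res₂ (q + i) :=
  below_le (N := (below Q.res₂ (q + i)).comap (tmulRight b))
    (fun _ hj _ ha => le_below (by omega) (tmul_mem_res₂ rfl ha hb)) ha

theorem tmul_below_right {i q : ℕ} {a b : Q.toHah.carrier} (ha : a ∈ Q.res i)
    (hb : b ∈ below Q.res q) : (tmul R a b : Q.sq) ∈ below Q.res₂ (i + q) :=
  below_le (N := (below Q.res₂ (i + q)).comap (tmulLeft a))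
    (fun _ hj _ hb => le_below (by omega) (tmul_mem_res₂ rfl ha hb)) hb

theorem tensorD_mem_below {h : Q.toHah.carrier →ₗ[R] Q.toHah.carrier}
    (hh : ∀ q, ∀ a ∈ Q.res q, h a ∈ below Q.res (q - 1)) (q : ℕ) (t : Q.sq) (ht : t ∈ Q.res₂ q) :
    tensorD Q.toHah.grading Q.toHah.grading h h t ∈ below Q.res₂ (q - 1) := by
  have h0 : ∀ a ∈ Q.res 0, h a = 0 := fun a ha => mem_below_zero.1 (hh 0 a ha)
  refine Submodule.span_le (p := (below Q.res₂ (q - 1)).comap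
    (tensorD Q.toHah.grading Q.toHah.grading h h)).2 ?_ ht
  rintro _ ⟨i, j, hij, a, ha, b, hb, rfl⟩
  change tensorD _ _ _ _ _ ∈ below Q.res₂ (q - 1)
  rw [tensorD_tmul]
  refine Submodule.add_mem _ ?_ ?_
  · cases i with
    | zero => rw [h0 a ha, zero_tmul']; exact Submodule.zero_mem _
    | succ i => exact below_mono (by omega) (tmul_below_left (hh _ a ha) hb)
  · cases j with
    | zero => rw [h0 b hb, tmul_zero']; exact Submodule.zero_mem _
    | succ j => exact below_mono (by omega) (tmul_below_right (sgn_mem_res ha) (hh _ b hb))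

theorem tensorD_add (d h : Q.toHah.carrier →ₗ[R] Q.toHah.carrier) :
    tensorD Q.toHah.grading Q.toHah.grading (d + h) (d + h) =
      tensorD Q.toHah.grading Q.toHah.grading d d + tensorD Q.toHah.grading Q.toHah.grading h h :=
  tensor_ext fun a b => by
    rw [LinearMap.add_apply, tensorD_tmul, tensorD_tmul, tensorD_tmul, LinearMap.add_apply,
      LinearMap.add_apply, add_tmul', tmul_add', add_add_add_comm]

theorem flat (Q : HopfResolution H) : Module.Flat R Q.toHah.carrier := by
  let e := (AlgEquiv.ofBijective _ Q.gen_free).toLinearEquiv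
  have : Module.Free R Q.toHah.carrier := Module.Free.of_equiv e
  infer_instance

/-- A tensor of positive resolution degree is killed by ρ ⊗ ρ, since one of its factors has positive
resolution degree; acyclicity is then `exists_of_tensor_cycle`. RH is flat because a free algebra is
a free module, and the flatness of H is a hypothesis. -/
theorem isPerturbedComplex₂ [Module.Flat R H.carrier]
    {h : Q.toHah.carrier →ₗ[R] Q.toHah.carrier}
    (hh : ∀ q, ∀ a ∈ Q.res q, h a ∈ below Q.res (q - 1)) :
    IsPerturbedComplex Q.res₂ Q.proj₂ Q.toHah.d₂ (tensorD Q.toHah.grading Q.toHah.grading h h) := by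
  refine .of_exists exhaust₂ proj₂_mem proj₂_of_mem proj₂_of_mem_ne tensorD_mem_res₂
    tensorD_res₂_zero (tensorD_mem_below hh) fun q z hz hdz => ?_
  have := Q.flat
  have hρz : TensorProduct.map Q.ρ.toLinearMap Q.ρ.toLinearMap z = 0 := by
    have : tensorMap (𝒞 := H.grading) (𝒟 := H.grading) Q.ρ.toLinearMap Q.ρ.toLinearMap z = 0 := by
      refine Submodule.span_le (p := LinearMap.ker (tensorMap (𝒞 := H.grading) (𝒟 := H.grading)
        Q.ρ.toLinearMap Q.ρ.toLinearMap)).2 ?_ hz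
      rintro _ ⟨i, j, hij, a, ha, b, hb, rfl⟩
      change tensorMap _ _ _ = _
      rw [tensorMap_tmul]
      rcases Nat.eq_zero_or_pos i with h0 | h0
      · rw [AlgHom.toLinearMap_apply Q.ρ b, Q.ρ_res j (by omega) b hb, tmul_zero']
      · rw [AlgHom.toLinearMap_apply Q.ρ a, Q.ρ_res i (by omega) a ha, zero_tmul']
    exact this
  exact exists_of_tensor_cycle (σ := signMap Q.toHah.grading) (σ' := signMap H.grading)
    (e := GradedAlgebra.proj Q.res) Q.toHah.isDGA.d_d Q.ρ_d Q.ρ_injective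
    (fun y => (Q.ρ_surjective y).imp fun _ h => h.2)
    (LinearMap.ext (sgn_sgn H.grading))
    (LinearMap.ext fun a => (sgn_comm_even Q.toHah.grading H.grading (f := Q.ρ.toLinearMap)
      Q.ρ_mem a).symm)
    (fun i => LinearMap.ext fun a => proj_of_mem (proj_mem Q.res i a))
    (fun i j hij => LinearMap.ext fun a => proj_of_mem_ne (proj_mem Q.res j a) hij.symm)
    (fun a => (exhaust a).imp fun N hN n hn => sum_proj (below_mono hn hN))
    (fun w => Q.toHah.isDGA₂.d_d w) (fun i => LinearMap.ext (d_proj i))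
    (LinearMap.ext fun a => Q.d_res_zero _ (proj_mem Q.res 0 a)) (LinearMap.ext ρ_proj_zero)
    hdz hρz

end HopfResolution

open GradedTensorProduct (tmul)

/-! ### Homology isomorphisms -/

section Homology

variable {R : Type u} [CommRing R]

/-- The homogeneous version of `IsPerturbedComplex.exists_sub_mem`. -/
theorem IsPerturbedComplex.exists_sub_mem_of_degree {A : Type u} [Ring A] [Algebra R A]
    {𝒜 : ℤ → Submodule R A} [GradedAlgebra 𝒜] {F : ℕ → Submodule R A} {P : ℕ → A →ₗ[R] A}
    {d h : A →ₗ[R] A} (H : IsPerturbedComplex F P d h) (hd : IsDGA 𝒜 (d + h))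
    (hproj : ∀ i q, ∀ a ∈ F q, GradedAlgebra.proj 𝒜 i a ∈ F q) {i : ℤ} {q : ℕ} {z : A}
    (hi : z ∈ 𝒜 i) (hz : (d + h) z ∈ below F q) :
    ∃ c ∈ 𝒜 (i + 1), z - (d + h) c ∈ below F (q + 1) := by
  obtain ⟨c, hc⟩ := H.exists_sub_mem hd.d_d hz
  refine ⟨_, proj_mem 𝒜 (i + 1) c, ?_⟩
  have := map_below (hproj i) hc
  rwa [map_sub, proj_of_mem hi, proj_comm 𝒜 𝒜 hd.mem (show i = i + 1 + -1 by ring)] at this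

/-- The external product of cycles. -/
def Hah.cross (A : Hah R) :
    LinearMap.ker A.d ⊗[R] LinearMap.ker A.d →ₗ[R] (A.grading ᵍ⊗[R] A.grading) :=
  (GradedTensorProduct.of R A.grading A.grading).toLinearMap ∘ₗ
    TensorProduct.map (Submodule.subtype _) (Submodule.subtype _)

theorem Hah.cross_tmul (A : Hah R) (z w : LinearMap.ker A.d) :
    A.cross (z ⊗ₜ w) = tmul R (z : A.carrier) (w : A.carrier) := rfl

/-- `π` induces an isomorphism of graded Hopf algebras `H(A) ≅ H`. -/
structure IsHomologyIso (A : Hah R) (H : GradedHopfAlgebra R)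
    (π : LinearMap.ker A.d →ₗ[R] H.carrier) : Prop where
  surjective : Function.Surjective π
  eq_zero_iff : ∀ z, π z = 0 ↔ ∃ a, A.d a = z
  mem : ∀ i, ∀ z : LinearMap.ker A.d, (z : A.carrier) ∈ A.grading i → π z ∈ H.grading i
  map_one : ∀ z : LinearMap.ker A.d, (z : A.carrier) = 1 → π z = 1
  map_mul : ∀ z w y : LinearMap.ker A.d, (y : A.carrier) = z * w → π y = π z * π w
  counit : ∀ z, H.counit (π z) = A.counit z
  coproduct : ∀ z : LinearMap.ker A.d, ∃ t : LinearMap.ker A.d ⊗[R] LinearMap.ker A.d,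
    (∃ c, A.d₂ c = A.coproduct z - A.cross t) ∧
    H.coproduct (π z) = GradedTensorProduct.of R H.grading H.grading (TensorProduct.map π π t)

theorem hasHomology_iff {A : Hah R} {H : GradedHopfAlgebra R} :
    HasHomology A H ↔ ∃ π, IsHomologyIso A H π :=
  exists_congr fun _ => ⟨fun ⟨h1, h2, h3, h4, h5, h6, h7⟩ => ⟨h1, h2, h3, h4, h5, h6, h7⟩,
    fun ⟨h1, h2, h3, h4, h5, h6, h7⟩ => ⟨h1, h2, h3, h4, h5, h6, h7⟩⟩

variable {A B : Hah R} {H : GradedHopfAlgebra R} {π : LinearMap.ker A.d →ₗ[R] H.carrier}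
  {π' : LinearMap.ker B.d →ₗ[R] H.carrier}

theorem IsHomologyIso.eq_iff (h : IsHomologyIso A H π) (z w : LinearMap.ker A.d) :
    π z = π w ↔ ∃ a, A.d a = z - w := by
  rw [← sub_eq_zero, ← map_sub, h.eq_zero_iff]; rfl

theorem IsHomologyIso.comp_aut (h : IsHomologyIso A H π) (α : H.aut) :
    IsHomologyIso A H ((α : H.carrier ≃ₐ[R] H.carrier).toLinearMap ∘ₗ π) where
  surjective := α.1.surjective.comp h.surjective
  eq_zero_iff z := by
    rw [← h.eq_zero_iff]
    exact map_eq_zero_iff _ α.1.injective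
  mem i z hz := (α.2.1 i _).2 (h.mem i z hz)
  map_one z hz := by
    rw [LinearMap.comp_apply, h.map_one z hz]
    exact _root_.map_one α.1
  map_mul z w y hy := by
    rw [LinearMap.comp_apply, h.map_mul z w y hy]
    exact _root_.map_mul α.1 _ _
  counit z := (α.2.2.1 _).trans (h.counit z)
  coproduct z := by
    obtain ⟨t, ht, e⟩ := h.coproduct z
    refine ⟨t, ht, (α.2.2.2 _).trans ?_⟩
    rw [e, TensorProduct.map_comp]
    rfl

/-- Homology isomorphisms are compatible with the projections to the homogeneous parts. -/
theorem IsHomologyIso.exists_proj (h : IsHomologyIso A H π) (i : ℤ) (z : LinearMap.ker A.d) :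
    ∃ w : LinearMap.ker A.d, (w : A.carrier) ∈ A.grading i ∧
      π w = GradedAlgebra.proj H.grading i (π z) := by
  have hd : ∀ (j : ℤ) (z : A.carrier), A.d z = 0 → A.d (GradedAlgebra.proj A.grading j z) = 0 :=
    fun j z hz => by
      rw [← proj_comm A.grading A.grading A.isDGA.mem rfl, hz, map_zero]
  let L (j : ℤ) : LinearMap.ker A.d →ₗ[R] LinearMap.ker A.d :=
    (GradedAlgebra.proj A.grading j).restrict fun z hz => hd j z hz
  refine ⟨L i z, proj_mem _ _ _, ?_⟩
  have e : ∀ j, GradedAlgebra.proj H.grading i (π (L j z)) = if j = i then π (L i z) else 0 := by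
    intro j
    have hm := h.mem j (L j z) (proj_mem A.grading j z.1)
    split_ifs with hj
    · subst hj; exact proj_of_mem hm
    · exact proj_of_mem_ne hm hj
  classical
  have hz : z = ∑ j ∈ (DirectSum.decompose A.grading z.1).support, L j z := by
    apply Subtype.ext
    rw [Submodule.coe_sum]
    exact (DirectSum.sum_support_decompose A.grading z.1).symm
  conv_rhs => rw [hz]
  rw [map_sum, map_sum, Finset.sum_congr rfl fun j _ => e j, Finset.sum_ite_eq']
  split_ifs with hi
  · rfl
  · have : L i z = 0 := Subtype.ext (by
      change ((DirectSum.decompose A.grading z.1 i : A.grading i) : A.carrier) = 0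
      rw [DFinsupp.notMem_support_iff.1 hi]; rfl)
    rw [this, map_zero]

/-- This is right exactness of the tensor product and needs no flatness. -/
theorem ker_map_self {M N : Type u} [AddCommGroup M] [Module R M] [AddCommGroup N] [Module R N]
    {f : M →ₗ[R] N} (hf : Function.Surjective f) :
    LinearMap.ker (TensorProduct.map f f) =
      LinearMap.range (LinearMap.lTensor M (LinearMap.ker f).subtype) ⊔
        LinearMap.range (LinearMap.rTensor M (LinearMap.ker f).subtype) :=
  TensorProduct.map_ker (LinearMap.exact_subtype_ker_map f) hf (LinearMap.exact_subtype_ker_map f)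
    hf

/-- The external product `H(A) ⊗ H(A) → H(A ⊗ A)` is injective. -/
def CrossInjective (B : Hah R) (π' : LinearMap.ker B.d →ₗ[R] H.carrier) : Prop :=
  ∀ t, (∃ c, B.d₂ c = B.cross t) → TensorProduct.map π' π' t = 0

/-- The external product is well defined on homology. By `ker_map_self` it suffices that a product
of a cycle with a boundary bounds: z ⊗ da is the boundary of `sgn` z ⊗ a, and da ⊗ w that of a ⊗ w.
-/
theorem cross_boundary (h : IsHomologyIso A H π) {t : LinearMap.ker A.d ⊗[R] LinearMap.ker A.d}
    (ht : TensorProduct.map π π t = 0) : ∃ c, A.d₂ c = A.cross t := by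
  have hle : LinearMap.ker (TensorProduct.map π π) ≤ (LinearMap.range A.d₂).comap A.cross := by
    rw [ker_map_self h.surjective]
    refine sup_le ?_ ?_
    · rintro _ ⟨t, rfl⟩
      induction t with
      | zero => simp
      | add x y hx hy => rw [map_add]; exact Submodule.add_mem _ hx hy
      | tmul z w =>
        obtain ⟨a, ha⟩ := (h.eq_zero_iff _).1 w.2
        refine ⟨tmul R (sgn A.grading z) a, ?_⟩
        rw [tensorD_tmul, ← neg_eq_iff_eq_neg.2 (A.isDGA.sgn_d z), z.2, map_zero, neg_zero,
          zero_tmul', zero_add, ha]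
        exact congr(tmul R $(sgn_sgn A.grading z.1) _)
    · rintro _ ⟨t, rfl⟩
      induction t with
      | zero => simp
      | add x y hx hy => rw [map_add]; exact Submodule.add_mem _ hx hy
      | tmul z w =>
        obtain ⟨a, ha⟩ := (h.eq_zero_iff _).1 z.2
        refine ⟨tmul R a w.1, ?_⟩
        rw [tensorD_tmul, w.2, tmul_zero', add_zero, ha]
        rfl
  exact hle ht

/-- A weak equivalence induces an automorphism of `H`. -/
theorem exists_aut_of_isWeakEquivalence (hA : IsHomologyIso A H π) (hB : IsHomologyIso B H π')
    (hc : CrossInjective B π') {f : A.carrier →ₐ[R] B.carrier} (hf : IsWeakEquivalence A B f) :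
    ∃ α : H.aut, ∀ (z : LinearMap.ker A.d) (w : LinearMap.ker B.d), (w : B.carrier) = f z →
      π' w = (α : H.carrier ≃ₐ[R] H.carrier) (π z) := by
  have hfd : ∀ z : LinearMap.ker A.d, B.d (f z) = 0 := fun z => by
    rw [← hf.map_d, z.2, map_zero]
  let φ : LinearMap.ker A.d →ₗ[R] LinearMap.ker B.d :=
    (f.toLinearMap ∘ₗ Submodule.subtype _).codRestrict _ hfd
  have hφ : ∀ z, (φ z : B.carrier) = f z := fun z => rfl
  have hwd : ∀ z w, π z = π w → π' (φ z) = π' (φ w) := fun z w h => by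
    obtain ⟨a, ha⟩ := (hA.eq_iff z w).1 h
    exact (hB.eq_iff _ _).2 ⟨f a, by rw [← hf.map_d, ha, map_sub, hφ, hφ]⟩
  -- A set-theoretic choice of cycle in each class; `hwd` makes the class of its image independent
  -- of the choice, hence linear and multiplicative.
  let g := Function.surjInv hA.surjective
  have hg : ∀ y, π (g y) = y := Function.surjInv_eq hA.surjective
  have hα : ∀ z, π' (φ (g (π z))) = π' (φ z) := fun z => hwd _ _ (hg _)
  let α₀ : H.carrier →ₗ[R] H.carrier :=
    { toFun := fun y => π' (φ (g y))
      map_add' := fun y y' => by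
        rw [← map_add, ← map_add]
        exact hwd _ _ (by rw [map_add, hg, hg, hg])
      map_smul' := fun r y => by
        rw [RingHom.id_apply, ← map_smul, ← map_smul]
        exact hwd _ _ (by rw [map_smul, hg, hg]) }
  have hα₀ : ∀ z, α₀ (π z) = π' (φ z) := hα
  let one : LinearMap.ker A.d := ⟨1, A.isDGA.map_one⟩
  let α₁ : H.carrier →ₐ[R] H.carrier := AlgHom.ofLinearMap α₀
    ((congrArg α₀ (hA.map_one one rfl)).symm.trans
      ((hα₀ one).trans (hB.map_one (φ one) (map_one f))))
    (fun y y' => by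
      obtain ⟨z, rfl⟩ := hA.surjective y
      obtain ⟨w, rfl⟩ := hA.surjective y'
      have hzw : A.d (z.1 * w.1) = 0 := by
        rw [A.isDGA.mul, z.2, w.2, zero_mul, mul_zero, add_zero]
      rw [← hA.map_mul z w ⟨_, hzw⟩ rfl, hα₀, hα₀, hα₀]
      exact hB.map_mul _ _ _ (map_mul f _ _))
  have hinj : Function.Injective α₁ := (injective_iff_map_eq_zero α₁).2 fun y hy => by
    obtain ⟨z, rfl⟩ := hA.surjective y
    obtain ⟨b, hb⟩ := (hB.eq_zero_iff _).1 ((hα₀ z).symm.trans hy)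
    exact (hA.eq_zero_iff z).2 (hf.homology_injective z z.2 ⟨b, hb⟩)
  have hsurj : Function.Surjective α₁ := fun y => by
    obtain ⟨w, rfl⟩ := hB.surjective y
    obtain ⟨a, ha, b, hb⟩ := hf.homology_surjective w w.2
    refine ⟨π ⟨a, ha⟩, (hα₀ _).trans ?_⟩
    exact (hB.eq_iff _ _).2 ⟨b, hb⟩
  have hmem : ∀ i, ∀ a ∈ H.grading i, α₁ a ∈ H.grading i := fun i a ha => by
    obtain ⟨z, rfl⟩ := hA.surjective a
    obtain ⟨w, hw, hwz⟩ := hA.exists_proj i z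
    rw [proj_of_mem ha] at hwz
    rw [← hwz]
    exact (hα₀ w).symm ▸ hB.mem i _ (hf.mem i _ hw)
  refine ⟨⟨AlgEquiv.ofBijective α₁ ⟨hinj, hsurj⟩, fun i a => ⟨fun ha => ?_, hmem i a⟩, fun a => ?_,
    fun a => ?_⟩, fun z w hw => ?_⟩
  · have e : α₁ (GradedAlgebra.proj H.grading i a) = α₁ a :=
      (proj_comm H.grading H.grading (f := α₁.toLinearMap) (m := 0)
        (fun i a ha => by rw [add_zero]; exact hmem i a ha) (add_zero i).symm a).symm.trans
          (proj_of_mem ha)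
    rw [← hinj e]
    exact proj_mem _ _ _
  · obtain ⟨z, rfl⟩ := hA.surjective a
    change H.counit (α₀ (π z)) = _
    rw [hα₀, hB.counit, hA.counit, hφ, hf.map_counit]
  · obtain ⟨z, rfl⟩ := hA.surjective a
    change H.coproduct (α₀ (π z)) = tensorMap α₀ α₀ (H.coproduct (π z))
    rw [hα₀]
    obtain ⟨t, ⟨c, hc'⟩, ht⟩ := hA.coproduct z
    obtain ⟨t', ⟨c', hc''⟩, ht'⟩ := hB.coproduct (φ z)
    obtain ⟨e, he⟩ := DerivHomotopic.exists_boundary hf.map_coproduct z.2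
    have hcross : ∀ t, tensorMap f.toLinearMap f.toLinearMap (A.cross t) =
        B.cross (TensorProduct.map φ φ t) := fun t => by
      induction t with
      | zero => simp
      | add x y hx hy => rw [map_add, map_add, hx, hy, map_add, map_add]
      | tmul z w => rfl
    -- The image of t and the tensor t' both represent the coproduct of f(z) in the homology of B ⊗
    -- B. The bounding element combines the image of -c, the homotopy e between (f ⊗ f)ψ and ψf, and
    -- c'. Injectivity of the external product turns this into an equality in H ⊗ H.
    have key := hc (TensorProduct.map φ φ t - t') ⟨tensorMap (𝒜 := A.grading) (ℬ := A.grading)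
      f.toLinearMap f.toLinearMap (-c) + e + c', by
        rw [map_add, map_add, ← tensorMap_tensorD hf.isDGAMap hf.isDGAMap, he, hc'', map_neg, hc',
          map_neg, map_sub, map_sub, hcross, LinearMap.comp_apply, LinearMap.comp_apply]
        simp only [hφ, AlgHom.toLinearMap_apply]
        abel⟩
    rw [map_sub, sub_eq_zero] at key
    rw [ht', ← key, ht]
    have hm : TensorProduct.map π' π' ∘ₗ TensorProduct.map φ φ =
        TensorProduct.map α₀ α₀ ∘ₗ TensorProduct.map π π := by
      rw [← TensorProduct.map_comp, ← TensorProduct.map_comp]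
      have : π' ∘ₗ φ = α₀ ∘ₗ π := LinearMap.ext fun z => (hα₀ z).symm
      rw [this]
    exact congr(GradedTensorProduct.of R H.grading H.grading ($hm t))
  · exact (congrArg π' (Subtype.ext hw)).trans (hα₀ z).symm

end Homology

/-! ### Perturbations -/

namespace HopfResolution


variable {R : Type u} [CommRing R] {H : GradedHopfAlgebra R} {Q : HopfResolution H}

theorem Perturbation.h_mem (x : Q.Perturbation) (q : ℕ) (a : Q.toHah.carrier) (ha : a ∈ Q.res q) :
    x.h a ∈ below Q.res (q - 1) := by
  rw [← iSup_add_two]; exact x.h_res q a ha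

theorem Perturbation.isDGA (x : Q.Perturbation) : IsDGA Q.toHah.grading x.d := x.isHah.isDGA

theorem Perturbation.d_of_res_zero (x : Q.Perturbation) {a : Q.toHah.carrier} (ha : a ∈ Q.res 0) :
    x.d a = 0 := by
  change Q.toHah.d a + x.h a = 0
  rw [Q.d_res_zero a ha, mem_below_zero.1 (x.h_mem 0 a ha), add_zero]

/-- Only resolution degrees 0 and 1 occur, and nothing lies two steps below them, so h vanishes. -/
theorem Perturbation.d_of_below_two (x : Q.Perturbation) {a : Q.toHah.carrier}
    (ha : a ∈ below Q.res 2) : x.d a = Q.toHah.d a := by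
  refine below_le (N := LinearMap.eqLocus x.d Q.toHah.d) (fun i hi a ha => ?_) ha
  have := x.h_mem i a ha
  rw [show i - 1 = 0 by omega, mem_below_zero] at this
  change Q.toHah.d a + x.h a = _
  rw [this, add_zero]

theorem Perturbation.coproduct_of_res_zero (x : Q.Perturbation) {a : Q.toHah.carrier}
    (ha : a ∈ Q.res 0) : x.coproduct a = Q.toHah.coproduct a := by
  have : x.ν a ∈ below Q.res₂ 0 := x.ν_res 0 a ha
  change Q.toHah.coproduct a + x.ν a = _
  rw [mem_below_zero.1 this, add_zero]

theorem Perturbation.exists_sub_mem (x : Q.Perturbation) {q : ℕ} {z : Q.toHah.carrier}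
    (hz : x.d z ∈ below Q.res q) : ∃ c, z - x.d c ∈ below Q.res (q + 1) :=
  (isPerturbedComplex x.h_mem).exists_sub_mem x.isDGA.d_d hz

/-- `z` is a cycle in the class of an element of resolution degree zero over `y`. -/
def Perturbation.IsClass (x : Q.Perturbation) (z : Q.toHah.carrier) (y : H.carrier) : Prop :=
  ∃ b ∈ Q.res 0, Q.ρ b = y ∧ ∃ c, x.d c = z - b

variable {x : Q.Perturbation}

/-- A cycle satisfies the hypothesis of `Perturbation.exists_sub_mem` with q = 0, so it can be
pushed by boundaries all the way to resolution degree zero. -/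
theorem Perturbation.exists_isClass {z : Q.toHah.carrier} (hz : x.d z = 0) :
    ∃ y, x.IsClass z y := by
  obtain ⟨c, hc⟩ := x.exists_sub_mem (q := 0) (by rw [hz]; exact Submodule.zero_mem _)
  rw [below_one] at hc
  exact ⟨_, _, hc, rfl, c, by abel⟩

/-- The element c can be moved by boundaries into resolution degrees 0 and 1. There the perturbed
differential is d, so b is a boundary for d and ρ kills it. -/
theorem Perturbation.ρ_eq_zero {b c : Q.toHah.carrier} (hb : b ∈ Q.res 0) (hc : x.d c = b) :
    Q.ρ b = 0 := by
  obtain ⟨e, he⟩ := x.exists_sub_mem (q := 1) (z := c) (by rw [hc, below_one]; exact hb)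
  have := x.d_of_below_two he
  rw [map_sub, x.isDGA.d_d, sub_zero, hc] at this
  rw [this, Q.ρ_d]

theorem Perturbation.IsClass.unique {z : Q.toHah.carrier} {y y' : H.carrier} (h : x.IsClass z y)
    (h' : x.IsClass z y') : y = y' := by
  obtain ⟨b, hb, rfl, c, hc⟩ := h
  obtain ⟨b', hb', rfl, c', hc'⟩ := h'
  rw [← sub_eq_zero, ← map_sub]
  exact x.ρ_eq_zero (Submodule.sub_mem _ hb hb') (c := c' - c) (by rw [map_sub, hc, hc']; abel)

theorem Perturbation.isClass_of_res_zero {b : Q.toHah.carrier} (hb : b ∈ Q.res 0) :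
    x.IsClass b (Q.ρ b) := ⟨b, hb, rfl, 0, by simp⟩

theorem Perturbation.IsClass.of_boundary {z z' c : Q.toHah.carrier} {y : H.carrier}
    (h : x.IsClass z y) (hc : x.d c = z' - z) : x.IsClass z' y := by
  obtain ⟨b, hb, rfl, e, he⟩ := h
  exact ⟨b, hb, rfl, c + e, by rw [map_add, hc, he]; abel⟩

theorem Perturbation.isClass_boundary (c : Q.toHah.carrier) : x.IsClass (x.d c) 0 :=
  ⟨0, Submodule.zero_mem _, map_zero _, c, by simp⟩

theorem Perturbation.IsClass.add {z z' : Q.toHah.carrier} {y y' : H.carrier} (h : x.IsClass z y)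
    (h' : x.IsClass z' y') : x.IsClass (z + z') (y + y') := by
  obtain ⟨b, hb, rfl, c, hc⟩ := h
  obtain ⟨b', hb', rfl, c', hc'⟩ := h'
  exact ⟨b + b', Submodule.add_mem _ hb hb', map_add _ _ _, c + c', by rw [map_add, hc, hc']; abel⟩

theorem Perturbation.IsClass.smul (r : R) {z : Q.toHah.carrier} {y : H.carrier}
    (h : x.IsClass z y) : x.IsClass (r • z) (r • y) := by
  obtain ⟨b, hb, rfl, c, hc⟩ := h
  exact ⟨r • b, Submodule.smul_mem _ _ hb, map_smul _ _ _, r • c, by rw [map_smul, hc, smul_sub]⟩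

theorem Perturbation.IsClass.mul {z z' : Q.toHah.carrier} {y y' : H.carrier} (h : x.IsClass z y)
    (hz' : x.d z' = 0) (h' : x.IsClass z' y') : x.IsClass (z * z') (y * y') := by
  obtain ⟨b, hb, rfl, c, hc⟩ := h
  obtain ⟨b', hb', rfl, c', hc'⟩ := h'
  refine ⟨b * b', res_mul 0 0 _ hb _ hb', map_mul _ _ _, c * z' + sgn Q.toHah.grading b * c', ?_⟩
  rw [map_add, x.isDGA.mul, x.isDGA.mul, hz', hc, hc', x.d_of_res_zero (sgn_mem_res hb), sgn_sgn]
  noncomm_ring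

theorem Perturbation.IsClass.exists_boundary {z : Q.toHah.carrier} (h : x.IsClass z 0) :
    ∃ c, x.d c = z := by
  obtain ⟨b, hb, hb0, c, hc⟩ := h
  obtain ⟨e, rfl⟩ := Q.ρ_injective b (Q.d_res_zero b hb) hb0
  have h1 : x.d (GradedAlgebra.proj Q.res 1 e) = Q.toHah.d e := by
    rw [x.d_of_below_two (le_below (by norm_num) (proj_mem Q.res 1 e)), d_proj, proj_of_mem hb]
  exact ⟨c + GradedAlgebra.proj Q.res 1 e, by rw [map_add, hc, h1]; abel⟩

theorem Perturbation.IsClass.mem {i : ℤ} {z : Q.toHah.carrier} {y : H.carrier} (h : x.IsClass z y)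
    (hz : z ∈ Q.toHah.grading i) : y ∈ H.grading i := by
  have h0 := h
  obtain ⟨b, hb, rfl, c, hc⟩ := h
  have : x.IsClass z (Q.ρ (GradedAlgebra.proj Q.toHah.grading i b)) := by
    refine ⟨_, proj_mem_res i hb, rfl, GradedAlgebra.proj Q.toHah.grading (i + 1) c, ?_⟩
    rw [← proj_comm Q.toHah.grading Q.toHah.grading x.isDGA.mem (show i = i + 1 + -1 by ring), hc,
      map_sub, proj_of_mem hz]
  rw [h0.unique this]
  exact Q.ρ_mem i _ (proj_mem _ _ _)

variable (x) in
theorem Perturbation.exists_π : ∃ π : LinearMap.ker x.perturbed.d →ₗ[R] H.carrier,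
    ∀ z : LinearMap.ker x.perturbed.d, x.IsClass z.1 (π z) := by
  choose f hf using fun z : LinearMap.ker x.perturbed.d => x.exists_isClass z.2
  exact ⟨⟨⟨f, fun z w => (hf _).unique ((hf z).add (hf w))⟩,
    fun r z => (hf _).unique ((hf z).smul r)⟩, hf⟩

variable (x) in
/-- The identification of the homology of a perturbed resolution with `H`. -/
def Perturbation.π : LinearMap.ker x.perturbed.d →ₗ[R] H.carrier := x.exists_π.choose

theorem Perturbation.isClass_π (z : LinearMap.ker x.perturbed.d) :
    x.IsClass z.1 (x.π z) := x.exists_π.choose_spec z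

theorem Perturbation.IsClass.π_eq {z : LinearMap.ker x.perturbed.d} {y : H.carrier}
    (h : x.IsClass z.1 y) : x.π z = y := (x.isClass_π z).unique h

/-- An element of resolution degree zero as a cycle. -/
def Perturbation.cycle (x : Q.Perturbation) (b : Q.res 0) : LinearMap.ker x.perturbed.d :=
  ⟨b.1, x.d_of_res_zero b.2⟩

theorem Perturbation.π_cycle (b : Q.res 0) : x.π (x.cycle b) = Q.ρ b :=
  Perturbation.IsClass.π_eq (z := x.cycle b) (isClass_of_res_zero b.2)

/-- The map `ρ ⊗ ρ`. -/
abbrev ρ₂ (Q : HopfResolution H) : Q.sq →ₗ[R] (H.grading ᵍ⊗[R] H.grading) :=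
  tensorMap Q.ρ.toLinearMap Q.ρ.toLinearMap

/-- The comparison map f is arbitrary so that the statement serves both for the identity of a
perturbed resolution and for the map from a resolution to A. -/
theorem Perturbation.exists_cross {A : Hah R} {π : LinearMap.ker A.d →ₗ[R] H.carrier}
    (f : Q.toHah.carrier →ₗ[R] A.carrier)
    (hf : ∀ b ∈ Q.res 0, ∃ z : LinearMap.ker A.d, (z : A.carrier) = f b ∧ π z = Q.ρ b) {u : Q.sq}
    (hu : u ∈ Q.res₂ 0) : ∃ t, A.cross t = tensorMap f f u ∧
      GradedTensorProduct.of R H.grading H.grading (TensorProduct.map π π t) = Q.ρ₂ u := by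
  induction hu using Submodule.span_induction with
  | zero => exact ⟨0, by simp⟩
  | add s t _ _ hs ht =>
    obtain ⟨s', h1, h2⟩ := hs
    obtain ⟨t', h3, h4⟩ := ht
    exact ⟨s' + t', by rw [map_add, h1, h3, map_add], by rw [map_add, map_add, h2, h4, map_add]⟩
  | smul r s _ hs =>
    obtain ⟨s', h1, h2⟩ := hs
    exact ⟨r • s', by rw [map_smul, h1, map_smul], by rw [map_smul, map_smul, h2, map_smul]⟩
  | mem s hs =>
    obtain ⟨i, j, hij, a, ha, b, hb, rfl⟩ := hs
    obtain ⟨rfl, rfl⟩ : i = 0 ∧ j = 0 := by omega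
    obtain ⟨z, hz, hz'⟩ := hf a ha
    obtain ⟨w, hw, hw'⟩ := hf b hb
    refine ⟨z ⊗ₜ w, ?_, ?_⟩
    · rw [Hah.cross_tmul, tensorMap_tmul, hz, hw]
    · rw [TensorProduct.map_tmul, hz', hw', tensorMap_tmul]; rfl

theorem Perturbation.exists_cross_self (x : Q.Perturbation) {u : Q.sq} (hu : u ∈ Q.res₂ 0) :
    ∃ t, x.perturbed.cross t = u ∧
      GradedTensorProduct.of R H.grading H.grading (TensorProduct.map x.π x.π t) = Q.ρ₂ u := by
  obtain ⟨t, h1, h2⟩ := exists_cross (A := x.perturbed) (π := x.π) LinearMap.id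
    (fun b hb => ⟨x.cycle ⟨b, hb⟩, (rfl : b = b), x.π_cycle _⟩) hu
  exact ⟨t, h1.trans congr($(tensorMap_id) u), h2⟩

/-- Every class has a representative in resolution degree zero, where h and ν vanish, so products,
augmentation and coproduct are those of the unperturbed resolution and are transported by ρ. -/
theorem Perturbation.isHomologyIso (x : Q.Perturbation) : IsHomologyIso x.perturbed H x.π where
  surjective y := by
    obtain ⟨b, hb, rfl⟩ := exists_res_zero (Q := Q) y
    exact ⟨x.cycle ⟨b, hb⟩, x.π_cycle _⟩
  eq_zero_iff z := by
    constructor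
    · intro h
      have := x.isClass_π z
      rw [h] at this
      exact this.exists_boundary
    · rintro ⟨c, hc⟩
      refine Perturbation.IsClass.π_eq ?_
      rw [← hc]
      exact isClass_boundary c
  mem i z hz := (x.isClass_π z).mem hz
  map_one z hz := Perturbation.IsClass.π_eq (by
    rw [hz, ← map_one Q.ρ]
    exact isClass_of_res_zero SetLike.GradedOne.one_mem)
  map_mul z w y hy := Perturbation.IsClass.π_eq (by
    rw [hy]
    exact (x.isClass_π z).mul w.2 (x.isClass_π w))
  counit z := by
    obtain ⟨b, hb, h, c, hc⟩ := x.isClass_π z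
    have h1 : Q.toHah.counit (x.d c) = 0 := x.isHah.counit_d c
    rw [hc, map_sub, sub_eq_zero] at h1
    rw [← h, Q.ρ_counit]
    exact h1.symm
  coproduct z := by
    obtain ⟨b, hb, h, c, hc⟩ := x.isClass_π z
    obtain ⟨t, h1, h2⟩ := x.exists_cross_self (Q.coproduct_res 0 b hb)
    refine ⟨t, ⟨x.coproduct c, ?_⟩, ?_⟩
    · rw [h1, ← x.coproduct_of_res_zero hb]
      change _ = x.coproduct z.1 - x.coproduct b
      rw [← map_sub, ← hc]
      exact (x.isHah.coproduct_d c).symm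
    · rw [h2, ← h, Q.ρ_coproduct]

theorem ρ₂_d₂ (t : Q.sq) : Q.ρ₂ (Q.toHah.d₂ t) = 0 := by
  have : Q.ρ₂ ∘ₗ Q.toHah.d₂ = 0 := tensor_ext fun a b => by
    rw [LinearMap.comp_apply, tensorD_tmul, map_add, tensorMap_tmul, tensorMap_tmul,
      AlgHom.toLinearMap_apply, Q.ρ_d, zero_tmul', AlgHom.toLinearMap_apply Q.ρ (Q.toHah.d b),
      Q.ρ_d, tmul_zero', add_zero]
    rfl
  exact congr($this t)

theorem Perturbation.d₂_eq (x : Q.Perturbation) : x.perturbed.d₂ =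
    Q.toHah.d₂ + tensorD Q.toHah.grading Q.toHah.grading x.h x.h := tensorD_add _ _

/-- A tensor of cycles is homologous to some u in the tensor square of R₀H with the same image in H
⊗ H. If u bounds, the acyclicity of the tensor square moves the bounding element to resolution
degree at most one; there h ⊗ 1 + 1 ⊗ h vanishes, so u is an unperturbed boundary and ρ ⊗ ρ kills
it. -/
theorem Perturbation.crossInjective [Module.Flat R H.carrier] (x : Q.Perturbation) :
    CrossInjective x.perturbed x.π := by
  have hres : ∀ t, ∃ u ∈ Q.res₂ 0, (∃ c : Q.sq, x.perturbed.d₂ c = (x.perturbed.cross t - u : Q.sq)) ∧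
      GradedTensorProduct.of R H.grading H.grading (TensorProduct.map x.π x.π t) = Q.ρ₂ u := by
    intro t
    induction t with
    | zero => exact ⟨0, Submodule.zero_mem _, ⟨0, by simp⟩, by simp⟩
    | add s t hs ht =>
      obtain ⟨u, hu, ⟨c, hc⟩, h⟩ := hs
      obtain ⟨u', hu', ⟨c', hc'⟩, h'⟩ := ht
      exact ⟨u + u', Submodule.add_mem _ hu hu', ⟨c + c', by rw [map_add, hc, hc', map_add]; abel⟩,
        by rw [map_add, map_add, h, h', map_add]⟩
    | tmul z w =>
      obtain ⟨b, hb, h, c, hc⟩ := x.isClass_π z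
      obtain ⟨b', hb', h', c', hc'⟩ := x.isClass_π w
      have hw : x.d w.1 = 0 := w.2
      have hm : (tmul R b b' : Q.sq) ∈ Q.res₂ 0 := tmul_mem_res₂ (add_zero 0) hb hb'
      refine ⟨_, hm, ⟨(tmul R c w.1 : Q.sq) +
        (tmul R (sgn Q.toHah.grading b) c' : Q.sq), ?_⟩, ?_⟩
      · have e1 : x.perturbed.d₂ (tmul R c w.1 : Q.sq) = (tmul R z.1 w.1 - tmul R b w.1 : Q.sq) := by
          rw [tensorD_tmul]
          change (tmul R (x.d c) w.1 + tmul R _ (x.d w.1) : Q.sq) = _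
          rw [hw, hc, tmul_zero', add_zero, sub_tmul']
        have e2 : x.perturbed.d₂ (tmul R (sgn Q.toHah.grading b) c' : Q.sq) =
            (tmul R b w.1 - tmul R b b' : Q.sq) := by
          rw [tensorD_tmul]
          change (tmul R (x.d (sgn Q.toHah.grading b)) c' +
            tmul R (sgn Q.toHah.grading (sgn Q.toHah.grading b)) (x.d c') : Q.sq) = _
          rw [hc', x.d_of_res_zero (sgn_mem_res hb), sgn_sgn, zero_tmul', zero_add, tmul_sub']
        rw [map_add, e1, e2, sub_add_sub_cancel, Hah.cross_tmul]
      · rw [TensorProduct.map_tmul, ← h, ← h', tensorMap_tmul]; rfl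
  rintro t ⟨c, hc⟩
  obtain ⟨u, hu, ⟨e, he⟩, ht⟩ := hres t
  have hPC := isPerturbedComplex₂ (Q := Q) x.h_mem
  have hd : x.perturbed.d₂ (c - e) = u := by rw [map_sub, hc, he, sub_sub_cancel]
  have hdd := x.perturbed.isDGA₂.d_d
  rw [x.d₂_eq] at hd hdd
  obtain ⟨v, hv⟩ := hPC.exists_sub_mem hdd (q := 1) (z := c - e)
    (by rw [hd, below_one]; exact hu)
  have h0 : tensorD Q.toHah.grading Q.toHah.grading x.h x.h (c - e -
      (Q.toHah.d₂ + tensorD Q.toHah.grading Q.toHah.grading x.h x.h) v) = 0 := by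
    refine below_le (N := LinearMap.ker (tensorD Q.toHah.grading Q.toHah.grading x.h x.h))
      (fun i hi a ha => ?_) hv
    have := hPC.h_mem i a ha
    rwa [show i - 1 = 0 by omega, mem_below_zero] at this
  have h1 : Q.ρ₂ u = 0 := by
    rw [← hd, ← sub_zero ((Q.toHah.d₂ + _) (c - e)), ← hdd v, ← map_sub, LinearMap.add_apply, h0,
      add_zero, ρ₂_d₂]
  rw [h1] at ht
  exact (GradedTensorProduct.of R H.grading H.grading).injective (ht.trans (map_zero _).symm)

end HopfResolution

/-! ### Homogeneous boundaries and unipotent maps -/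

section

variable {R : Type u} [CommRing R]

theorem DerivHomotopic.congr {A B : Type u} [Ring A] [Algebra R A] [Ring B] [Algebra R B]
    {𝒜 : ℤ → Submodule R A} [GradedAlgebra 𝒜] {ℬ : ℤ → Submodule R B} [GradedAlgebra ℬ]
    {dA : A →ₗ[R] A} {dB : B →ₗ[R] B} {f g f' g' : A →ₗ[R] B} (h : DerivHomotopic 𝒜 ℬ dA dB f g)
    (hf : ∀ a, f a = f' a) (hg : ∀ a, g a = g' a) : DerivHomotopic 𝒜 ℬ dA dB f' g' := by
  rwa [← LinearMap.ext hf, ← LinearMap.ext hg]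

theorem IsDGA.exists_mem_of_boundary {A : Type u} [Ring A] [Algebra R A] {𝒜 : ℤ → Submodule R A}
    [GradedAlgebra 𝒜] {d : A →ₗ[R] A} (hd : IsDGA 𝒜 d) {i : ℤ} {z : A} (hz : z ∈ 𝒜 i)
    (h : ∃ c, d c = z) : ∃ c ∈ 𝒜 (i + 1), d c = z := by
  obtain ⟨c, rfl⟩ := h
  refine ⟨_, proj_mem 𝒜 (i + 1) c, ?_⟩
  rw [← proj_comm 𝒜 𝒜 hd.mem (show i = i + 1 + -1 by ring), proj_of_mem hz]

theorem mem_of_map_mem {A B : Type u} [Ring A] [Algebra R A] [Ring B] [Algebra R B]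
    {𝒜 : ℤ → Submodule R A} [GradedAlgebra 𝒜] {ℬ : ℤ → Submodule R B} [GradedAlgebra ℬ]
    {f : A →ₗ[R] B} (hf : ∀ i, ∀ a ∈ 𝒜 i, f a ∈ ℬ i) (hinj : Function.Injective f) {i : ℤ} {a : A}
    (ha : f a ∈ ℬ i) : a ∈ 𝒜 i := by
  have e := proj_comm 𝒜 ℬ (m := 0) (fun i a ha => by rw [add_zero]; exact hf i a ha)
    (add_zero i).symm a
  rw [proj_of_mem ha] at e
  rw [hinj e]
  exact proj_mem _ _ _

/-- Unipotent maps are bijective. -/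
theorem bijective_of_sub_mem_below {M : Type u} [AddCommGroup M] [Module R M]
    {F : ℕ → Submodule R M} (hF : ∀ z, ∃ N, z ∈ below F N) {f : M →ₗ[R] M}
    (h : ∀ q, ∀ a ∈ F q, f a - a ∈ below F q) : Function.Bijective f := by
  have key : ∀ N, ∀ a ∈ below F (N + 1), f a - a ∈ below F N := fun N a ha => by
    have hle : below F (N + 1) ≤ (below F N).comap (f - LinearMap.id) :=
      below_le fun i hi a ha => by
        simpa using below_mono (show i ≤ N by omega) (h i a ha)
    simpa using hle ha
  constructor
  · refine (injective_iff_map_eq_zero f).2 fun a ha => ?_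
    obtain ⟨N, hN⟩ := hF a
    induction N with
    | zero => exact mem_below_zero.1 hN
    | succ N ih =>
      have := key N a hN
      rw [ha, zero_sub, Submodule.neg_mem_iff] at this
      exact ih this
  · intro a
    obtain ⟨N, hN⟩ := hF a
    induction N generalizing a with
    | zero => exact ⟨0, by rw [map_zero, mem_below_zero.1 hN]⟩
    | succ N ih =>
      obtain ⟨b, hb⟩ := ih _ (key N a hN)
      exact ⟨a - b, by rw [map_sub, hb, sub_sub_cancel]⟩

end

/-! ### Gauge equivalence as realization of the identity -/

namespace HopfResolution

variable {R : Type u} [CommRing R] {H : GradedHopfAlgebra R} {Q : HopfResolution H}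

/-- Testing on R₀H is enough because every class has a representative there; in terms of
`Perturbation.π` the condition composes and inverts easily. -/
theorem realizes_iff {α : H.carrier → H.carrier} {x y : Q.Perturbation} :
    Realizes α x y ↔ ∃ k : Q.toHah.carrier →ₐ[R] Q.toHah.carrier,
      IsWeakEquivalence x.perturbed y.perturbed k ∧
      ∀ (z : LinearMap.ker x.perturbed.d) (w : LinearMap.ker y.perturbed.d), w.1 = k z.1 →
        y.π w = α (x.π z) := by
  refine exists_congr fun k => and_congr_right fun hk => ⟨fun h z w hw => ?_, fun h a ha => ?_⟩
  · obtain ⟨b, hb, e, c, hc⟩ := x.isClass_π z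
    refine Perturbation.IsClass.π_eq ?_
    have h1 : y.IsClass (k b) (α (Q.ρ b)) := h b hb
    rw [← e, hw]
    exact h1.of_boundary (c := k c) (by rw [← map_sub, ← hc]; exact (hk.map_d c).symm)
  · have hd : y.d (k a) = 0 := by
      have := hk.map_d a
      change k (x.d a) = y.d (k a) at this
      rw [← this, x.d_of_res_zero ha, map_zero]
    have := h (x.cycle ⟨a, ha⟩) ⟨k a, hd⟩ rfl
    rw [Perturbation.π_cycle] at this
    exact this ▸ y.isClass_π ⟨k a, hd⟩

/-- A map inducing the identity on homology is homotopic to a unipotent one. -/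
theorem exists_unipotent (hQ : Q.Positive) {x y : Q.Perturbation}
    {k : Q.toHah.carrier →ₐ[R] Q.toHah.carrier}
    (hk : IsDGAMap Q.toHah.grading Q.toHah.grading x.d y.d k)
    (h : ∀ a ∈ Q.res 0, y.IsClass (k a) (Q.ρ a)) :
    ∃ p : Q.toHah.carrier →ₐ[R] Q.toHah.carrier,
      IsDGAMap Q.toHah.grading Q.toHah.grading x.d y.d p ∧
      DerivHomotopic Q.toHah.grading Q.toHah.grading x.d y.d k.toLinearMap p.toLinearMap ∧
      ∀ q, ∀ a ∈ Q.res q, p a - a ∈ below Q.res q := by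
  have lower : ∀ p : Q.toHah.carrier →ₐ[R] Q.toHah.carrier,
      (∀ v, p (Q.gen v) - Q.gen v ∈ below Q.res (Q.resDeg v)) →
      ∀ q, ∀ a ∈ Q.res q, p a - a ∈ below Q.res q := fun p hp =>
    sub_mem_below_of_gen Q.gen_free Q.gen_mem_res res_mul (v := AlgHom.id R _) (fun _ _ h => h) hp
  -- k is lifted through the identity map; the content lies in the side condition that each
  -- generator goes to itself plus terms of lower resolution degree.
  obtain ⟨p, s, hp, hs, hOk⟩ := (freeGen hQ).exists_lift x.isDGA y.isDGA y.isDGA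
    (φ := AlgHom.id R Q.toHah.carrier) IsDGAMap.id hk
    (fun v b _ => b - Q.gen v ∈ below Q.res (Q.resDeg v)) Q.gen hQ
    (fun v => by rw [sub_self]; exact Submodule.zero_mem _) (by
      intro v p s hp hs hmul hOk hd1 hd2
      obtain ⟨g, hg⟩ : ∃ g, g = Q.gen v := ⟨_, rfl⟩
      obtain ⟨i, hi⟩ : ∃ i, i = (freeGen hQ).deg v := ⟨_, rfl⟩
      have hgi : g ∈ Q.toHah.grading i := hg ▸ hi ▸ hQ v
      have hgr : g ∈ Q.res (Q.resDeg v) := hg ▸ Q.gen_mem_res v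
      have hgv : (freeGen hQ).gen v = g := hg.symm
      simp only [hgv, ← hg, ← hi, AlgHom.id_apply] at hd1 hd2 ⊢
      have hxd := x.isDGA.mem i g hgi
      have hu : k g - s (x.d g) ∈ Q.toHah.grading i := by
        refine Submodule.sub_mem _ (hk.mem i g hgi) ?_
        have := hs _ _ hxd
        rwa [neg_add_cancel_right] at this
      generalize Q.resDeg v = q at hgr
      cases q with
      | zero =>
        have h0 : x.d g = 0 := x.d_of_res_zero hgr
        rw [h0, map_zero, map_zero] at *
        -- In resolution degree zero p(g) = g is forced. The homotopy exists because k(g) and g have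
        -- the same class.
        have hc : ∃ c, y.d c = k g - g := by
          obtain ⟨c, hc⟩ := Perturbation.IsClass.exists_boundary (x := y) (z := k g - g) (by
            have := (h g hgr).add ((Perturbation.isClass_of_res_zero (x := y) hgr).smul (-1))
            simpa [sub_eq_add_neg] using this)
          exact ⟨c, hc⟩
        obtain ⟨c, hc, hcd⟩ := y.isDGA.exists_mem_of_boundary
          (Submodule.sub_mem _ (hk.mem i g hgi) hgi) hc
        refine ⟨g, hgi, c, hc, y.d_of_res_zero hgr, ?_, ?_⟩
        · rw [hcd]; abel
        · rw [sub_self]; exact Submodule.zero_mem _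
      | succ m =>
        -- The natural candidate k(g) - s(dg) need not be close to g. But the unperturbed parts of
        -- the boundary of the difference cancel to lower order, so subtracting a boundary brings
        -- the difference into lower filtration.
        have e1 : y.d (k g - s (x.d g) - g) = (p (Q.toHah.d g) - Q.toHah.d g) + p (x.h g) - y.h g := by
          rw [map_sub, ← hd2]
          change p (Q.toHah.d g + x.h g) - (Q.toHah.d g + y.h g) = _
          rw [map_add]; abel
        have hlow := lower p hOk
        have e2 : y.d (k g - s (x.d g) - g) ∈ below Q.res m := by
          rw [e1]
          refine Submodule.sub_mem _ (Submodule.add_mem _ (hlow m _ (Q.d_res m g hgr)) ?_)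
            (y.h_mem (m + 1) g hgr)
          exact map_below_succ (f := LinearMap.id) (g := p.toLinearMap) (fun _ _ h => h) hlow
            (x.h_mem (m + 1) g hgr)
        obtain ⟨c, hc, hcm⟩ := (isPerturbedComplex y.h_mem).exists_sub_mem_of_degree y.isDGA
          (fun i q a ha => proj_mem_res i ha) (Submodule.sub_mem _ hu hgi) e2
        refine ⟨k g - s (x.d g) - y.d c, Submodule.sub_mem _ hu ?_, c, hc, ?_, rfl, ?_⟩
        · have := y.isDGA.mem _ _ hc
          rwa [add_neg_cancel_right] at this
        · rw [map_sub, y.isDGA.d_d, sub_zero, hd2]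
        · rwa [sub_right_comm])
  exact ⟨p, hp, ⟨s, hs⟩, lower p hOk⟩

/-- The order is reversed because p maps x to y, so the differential of x is the conjugate of that
of y by p. The unipotent representative is bijective, and applying p⁻¹ ⊗ p⁻¹ to its coproduct
homotopy gives the required one. -/
theorem GaugeEquivalent.of_realizes (hQ : Q.Positive) {x y : Q.Perturbation}
    (h : Realizes id x y) : GaugeEquivalent y x := by
  obtain ⟨k, hk, hcl⟩ := h
  obtain ⟨p, hp, hkp, hlow⟩ := exists_unipotent hQ hk.isDGAMap (fun a ha => hcl a ha)
  have hbij : Function.Bijective p :=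
    bijective_of_sub_mem_below (f := p.toLinearMap) exhaust hlow
  let e := AlgEquiv.ofBijective p hbij
  have he : ∀ a, e a = p a := fun a => rfl
  have hWE := hk.of_homotopic (A := x.perturbed) (B := y.perturbed) (freeGen hQ) hp hkp
  have hes : IsDGAMap Q.toHah.grading Q.toHah.grading y.d x.d (e.symm : _ →ₐ[R] _) :=
    ⟨fun i a ha => mem_of_map_mem (f := p.toLinearMap) hp.mem hbij.1 (i := i) (by
      change p (e.symm a) ∈ _
      rwa [← he, e.apply_symm_apply]),
      fun a => e.injective (by
        change e (e.symm _) = p (x.d (e.symm a))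
        rw [hp.map_d, ← he, e.apply_symm_apply, e.apply_symm_apply])⟩
  refine ⟨e, hp.mem, hlow, fun a => ?_, ?_⟩
  · rw [he, ← hp.map_d, ← he, e.symm_apply_apply]
  · have := hWE.map_coproduct.comp_left (hes.tensor_isDGAMap hes)
    refine this.congr (fun a => ?_) fun a => rfl
    change tensorMap e.symm.toLinearMap e.symm.toLinearMap
      (tensorMap p.toLinearMap p.toLinearMap (x.coproduct a) : Q.sq) = x.coproduct a
    rw [tensorMap_comp_apply]
    have : e.symm.toLinearMap ∘ₗ p.toLinearMap = LinearMap.id :=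
      LinearMap.ext fun a => e.symm_apply_apply a
    rw [this]
    exact congr($(tensorMap_id) (x.coproduct a))

theorem GaugeEquivalent.realizes (hQ : Q.Positive) {x y : Q.Perturbation}
    (h : GaugeEquivalent x y) : Realizes id y x := by
  obtain ⟨p, hp, hlow, hd, hψ⟩ := h
  have hpd : IsDGAMap Q.toHah.grading Q.toHah.grading y.d x.d (p : _ →ₐ[R] _) :=
    ⟨hp, fun a => by
      change p (y.d a) = x.d (p a)
      rw [hd, p.apply_symm_apply]⟩
  have hmor : IsHahMorphism y.perturbed x.perturbed (p : _ →ₐ[R] _) := by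
    refine isHahMorphism_of_free (A := y.perturbed) (B := x.perturbed) (freeGen hQ) hpd ?_
    refine (hψ.comp_left (hpd.tensor_isDGAMap hpd)).congr (fun a => rfl) (fun a => ?_)
    change tensorMap p.toLinearMap p.toLinearMap (tensorMap p.symm.toLinearMap p.symm.toLinearMap
      (x.coproduct (p a)) : Q.sq) = x.coproduct (p a)
    rw [tensorMap_comp_apply]
    have : p.toLinearMap ∘ₗ p.symm.toLinearMap = LinearMap.id :=
      LinearMap.ext fun a => p.apply_symm_apply a
    rw [this]
    exact congr($(tensorMap_id) (x.coproduct (p a)))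
  refine ⟨p, hmor.isWeakEquivalence ⟨?_, ?_⟩, fun a ha => ⟨a, ha, rfl, 0, ?_⟩⟩
  · rintro a - ⟨b, hb⟩
    refine ⟨p.symm b, p.injective ?_⟩
    exact (hpd.map_d _).trans ((congrArg x.d (p.apply_symm_apply b)).trans hb)
  · intro b hb
    refine ⟨p.symm b, p.injective ?_, 0, ?_⟩
    · refine (hpd.map_d _).trans ((congrArg x.d (p.apply_symm_apply b)).trans (hb.trans ?_))
      exact (map_zero p).symm
    · exact (map_zero x.d).trans (sub_eq_zero.2 (p.apply_symm_apply b)).symm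
  · have : p a - a ∈ below Q.res 0 := hlow 0 a ha
    rw [mem_below_zero] at this
    exact (map_zero x.d).trans this.symm

theorem Realizes.refl (hQ : Q.Positive) (x : Q.Perturbation) : Realizes id x x :=
  realizes_iff.2 ⟨AlgHom.id R _, IsWeakEquivalence.id (A := x.perturbed) (freeGen hQ),
    fun _ _ hw => congrArg x.π (Subtype.ext hw)⟩

theorem Realizes.comp (hQ : Q.Positive) {α β : H.carrier → H.carrier} {x y z : Q.Perturbation}
    (hβ : Realizes β y z) (hα : Realizes α x y) : Realizes (β ∘ α) x z := by
  obtain ⟨k, hk, hkα⟩ := realizes_iff.1 hα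
  obtain ⟨l, hl, hlβ⟩ := realizes_iff.1 hβ
  refine realizes_iff.2 ⟨l.comp k, hl.comp (A := x.perturbed) (freeGen hQ) hk, fun u w hw => ?_⟩
  have hd : y.perturbed.d (k u.1) = 0 := by rw [← hk.map_d, u.2, map_zero]
  rw [hlβ ⟨k u.1, hd⟩ w hw, hkα u ⟨k u.1, hd⟩ rfl]
  rfl

/-- A homotopy inverse g of k satisfies 1 ≃ k g, so a cycle u and k(g(u)) are homologous, and the
class of g(u) is the image under β of that of u. -/
theorem Realizes.symm (hQ : Q.Positive) {α β : H.carrier → H.carrier} {x y : Q.Perturbation}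
    (hα : Realizes α x y) (hβα : ∀ a, β (α a) = a) : Realizes β y x := by
  obtain ⟨k, hk, hkα⟩ := realizes_iff.1 hα
  obtain ⟨g, hg, hkg⟩ := hk.exists_inverse (A := x.perturbed) (B := y.perturbed) (freeGen hQ) (freeGen hQ)
  refine realizes_iff.2 ⟨g, hg, fun u w hw => ?_⟩
  have hd : y.perturbed.d (k w.1) = 0 := by rw [← hk.map_d, w.2, map_zero]
  obtain ⟨b, hb⟩ := hkg.exists_boundary u.2
  have h1 : y.π u = y.π ⟨k w.1, hd⟩ := (y.isHomologyIso.eq_iff _ _).2 ⟨b,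
    hb.trans (congrArg (fun a => u.1 - k a) hw.symm)⟩
  rw [h1, hkα w _ rfl, hβα]

/-- Realizing the identity is itself an equivalence relation, so it contains the relation generated
by gauge equivalence; conversely each instance is a single gauge transformation. -/
theorem toD_eq_iff (hQ : Q.Positive) {x y : Q.Perturbation} :
    x.toD = y.toD ↔ Realizes id x y := by
  constructor
  · suffices key : ∀ x y : Q.Perturbation, Relation.EqvGen GaugeEquivalent x y → Realizes id x y from
      fun h => key x y (Quot.eqvGen_exact h)
    intro x y h
    induction h with
    | rel x y h => exact (GaugeEquivalent.realizes hQ h).symm hQ fun _ => rfl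
    | refl x => exact Realizes.refl hQ x
    | symm x y _ ih => exact ih.symm hQ fun _ => rfl
    | trans x y z _ _ h1 h2 => exact h2.comp hQ h1
  · intro h
    exact (Quot.sound (GaugeEquivalent.of_realizes hQ h)).symm

theorem exists_realizes_of_isWeakEquivalence [Module.Flat R H.carrier] {x y : Q.Perturbation}
    {k : Q.toHah.carrier →ₐ[R] Q.toHah.carrier}
    (hk : IsWeakEquivalence x.perturbed y.perturbed k) :
    ∃ α : H.aut, Realizes (α : H.carrier ≃ₐ[R] H.carrier) x y := by
  obtain ⟨α, hα⟩ := exists_aut_of_isWeakEquivalence x.isHomologyIso y.isHomologyIso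
    y.crossInjective hk
  exact ⟨α, realizes_iff.2 ⟨k, hk, hα⟩⟩

end HopfResolution

/-- The elements on which a derivation squares to zero and commutes with `f`. -/
def squareZeroSubalgebra {R : Type u} [CommRing R] {A B : Type u} [Ring A] [Algebra R A] [Ring B]
    [Algebra R B] {𝒜 : ℤ → Submodule R A} [GradedAlgebra 𝒜] {ℬ : ℤ → Submodule R B}
    [GradedAlgebra ℬ] {D : A →ₗ[R] A} {dB : B →ₗ[R] B} (hD : IsDerivationOfDegree 𝒜 (-1) D)
    (hdB : IsDGA ℬ dB) {f : A →ₐ[R] B} (hf : ∀ i, ∀ a ∈ 𝒜 i, f a ∈ ℬ i) : Subalgebra R A where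
  carrier := {a | D (D a) = 0 ∧ f (D a) = dB (f a)}
  mul_mem' {a b} ha hb := by
    obtain ⟨ha1, ha2⟩ := ha
    obtain ⟨hb1, hb2⟩ := hb
    have e1 : f (sgn 𝒜 a) = sgn ℬ (f a) := (sgn_comm_even 𝒜 ℬ (f := f.toLinearMap) hf a).symm
    refine ⟨?_, ?_⟩
    · rw [hD.mul, map_add, hD.mul, hD.mul, ha1, hb1, hD.sgn_d]
      noncomm_ring
    · rw [hD.mul, map_add, map_mul, map_mul, map_mul, hdB.mul, ha2, hb2, e1]
  add_mem' {a b} ha hb := by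
    obtain ⟨ha1, ha2⟩ := ha
    obtain ⟨hb1, hb2⟩ := hb
    exact ⟨by rw [map_add, map_add, ha1, hb1, add_zero],
      by rw [map_add, map_add, ha2, hb2, map_add, map_add]⟩
  algebraMap_mem' r := by
    simp [Algebra.algebraMap_eq_smul_one, hD.map_one, hdB.map_one]

theorem IsDerivationOfDegree.add {R : Type u} [CommRing R] {A : Type u} [Ring A] [Algebra R A]
    {𝒜 : ℤ → Submodule R A} [GradedAlgebra 𝒜] {d h : A →ₗ[R] A} {m : ℤ}
    (hd : IsDerivationOfDegree 𝒜 m d) (hh : IsDerivationOfDegree 𝒜 m h) :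
    IsDerivationOfDegree 𝒜 m (d + h) where
  mem i a ha := Submodule.add_mem _ (hd.mem i a ha) (hh.mem i a ha)
  leibniz i a ha b := by
    simp only [LinearMap.add_apply]
    rw [hd.leibniz i a ha, hh.leibniz i a ha, add_mul, mul_add, smul_add]
    abel

/-! ### The perturbed differential and the map to a given Hah -/

namespace HopfResolution

variable {R : Type u} [CommRing R] {H : GradedHopfAlgebra R} {Q : HopfResolution H}

theorem exists_d_eq {i : ℤ} {q : ℕ} {y : Q.toHah.carrier} (hy : y ∈ Q.res q)
    (hi : y ∈ Q.toHah.grading (i + -1)) (hdy : Q.toHah.d y = 0) (hρ : Q.ρ y = 0) :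
    ∃ w ∈ Q.res (q + 1), w ∈ Q.toHah.grading i ∧ Q.toHah.d w = y := by
  obtain ⟨e, rfl⟩ := Q.ρ_injective y hdy hρ
  refine ⟨GradedAlgebra.proj Q.toHah.grading i (GradedAlgebra.proj Q.res (q + 1) e),
    proj_mem_res i (proj_mem _ _ _), proj_mem _ _ _, ?_⟩
  rw [← proj_comm Q.toHah.grading Q.toHah.grading Q.toHah.isDGA.mem rfl, d_proj, proj_of_mem hy,
    proj_of_mem hi]

section Construction

variable {A : Hah R} {π : LinearMap.ker A.d →ₗ[R] H.carrier}

/-- `f b` is a cycle in the class of `ρ b`. -/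
def Represents (A : Hah R) (π : LinearMap.ker A.d →ₗ[R] H.carrier)
    (f : Q.toHah.carrier → A.carrier) (b : Q.toHah.carrier) : Prop :=
  ∃ z : LinearMap.ker A.d, z.1 = f b ∧ π z = Q.ρ b

theorem represents_of_gen (hA : IsHomologyIso A H π) {f : Q.toHah.carrier →ₐ[R] A.carrier}
    (hf : ∀ x, Q.resDeg x = 0 → Represents A π f (Q.gen x)) (b : Q.toHah.carrier)
    (hb : b ∈ Q.res 0) : Represents A π f b := by
  let N : Submodule R Q.toHah.carrier :=
    { carrier := {b | Represents A π f b}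
      add_mem' := by
        rintro a b ⟨z, hz, hz'⟩ ⟨w, hw, hw'⟩
        exact ⟨z + w, by rw [map_add, ← hz, ← hw]; rfl, by rw [map_add, hz', hw', map_add]⟩
      zero_mem' := ⟨0, by rw [map_zero]; rfl, by rw [map_zero, map_zero]⟩
      smul_mem' := by
        rintro r a ⟨z, hz, hz'⟩
        exact ⟨r • z, by rw [map_smul, ← hz]; rfl, by rw [map_smul, hz', map_smul]⟩ }
  refine graded_le_of_words Q.gen_free Q.gen_mem_res (N := N) (fun l hl => ?_) hb
  change Represents A π f _
  induction l with
  | nil =>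
    exact ⟨⟨1, A.isDGA.map_one⟩, (map_one f).symm, (hA.map_one _ rfl).trans (map_one Q.ρ).symm⟩
  | cons x l ih =>
    simp only [List.map_cons, List.sum_cons, Nat.add_eq_zero_iff] at hl
    obtain ⟨z, hz, hz'⟩ := hf x hl.1
    obtain ⟨w, hw, hw'⟩ := ih hl.2
    have hzw : A.d (z.1 * w.1) = 0 := by
      rw [A.isDGA.mul, z.2, w.2, zero_mul, mul_zero, add_zero]
    refine ⟨⟨_, hzw⟩, ?_, ?_⟩
    · rw [List.map_cons, List.prod_cons, map_mul, ← hz, ← hw]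
    · rw [hA.map_mul z w ⟨_, hzw⟩ rfl, hz', hw', List.map_cons, List.prod_cons, map_mul]

variable {h : Q.toHah.carrier →ₗ[R] Q.toHah.carrier} {f : Q.toHah.carrier →ₐ[R] A.carrier}

/-- A partially defined perturbed differential `d + h` and chain map `f`, valid in degree `i`. -/
structure IsPartial (A : Hah R) (π : LinearMap.ker A.d →ₗ[R] H.carrier)
    (h : Q.toHah.carrier →ₗ[R] Q.toHah.carrier) (f : Q.toHah.carrier →ₐ[R] A.carrier) (i : ℤ) :
    Prop where
  mem : ∀ i, ∀ a ∈ Q.toHah.grading i, (Q.toHah.d + h) a ∈ Q.toHah.grading (i + -1)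
  res : ∀ q, ∀ a ∈ Q.res q, h a ∈ below Q.res (q - 1)
  f_mem : ∀ i, ∀ a ∈ Q.toHah.grading i, f a ∈ A.grading i
  represents : ∀ b ∈ Q.res 0, Represents A π f b
  d_d : ∀ a ∈ Q.toHah.grading i, (Q.toHah.d + h) ((Q.toHah.d + h) a) = 0
  map_d : ∀ a ∈ Q.toHah.grading i, f ((Q.toHah.d + h) a) = A.d (f a)

theorem IsPartial.d_of_res_zero {i : ℤ} (hP : IsPartial A π h f i) {b : Q.toHah.carrier}
    (hb : b ∈ Q.res 0) : (Q.toHah.d + h) b = 0 := by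
  rw [LinearMap.add_apply, Q.d_res_zero b hb, mem_below_zero.1 (hP.res 0 b hb), add_zero]

/-- The argument only uses that d + h squares to zero in degree i. The top component of z is a
d-cycle; in positive resolution degree it is a boundary by acyclicity, and once z lies in resolution
degree zero the hypothesis on f(z) says that its class in H vanishes. -/
theorem IsPartial.exists_d_eq (hA : IsHomologyIso A H π) {i : ℤ} (hP : IsPartial A π h f i)
    {m : ℕ} {z : Q.toHah.carrier} (hz : z ∈ below Q.res m) (hzi : z ∈ Q.toHah.grading (i + -1))
    (hDz : (Q.toHah.d + h) z = 0) (hfz : ∃ c, A.d c = f z) :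
    ∃ w ∈ below Q.res (m + 1), w ∈ Q.toHah.grading i ∧ (Q.toHah.d + h) w = z := by
  induction m generalizing z with
  | zero => exact ⟨0, Submodule.zero_mem _, Submodule.zero_mem _,
      by rw [map_zero, mem_below_zero.1 hz]⟩
  | succ m ih =>
    have hPC := isPerturbedComplex hP.res
    obtain ⟨z', hz', y, hy, hzy⟩ := exists_of_mem_below_succ hz
    have hyi : y ∈ Q.toHah.grading (i + -1) := by
      have e : GradedAlgebra.proj Q.res m z = y := by
        rw [← hzy, map_add, hPC.proj_below hz', proj_of_mem hy, zero_add]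
      exact e ▸ proj_res_mem m hzi
    cases m with
    | zero =>
      rw [mem_below_zero] at hz'
      rw [hz', zero_add] at hzy
      subst hzy
      obtain ⟨c, hc, hc'⟩ := hP.represents y hy
      have hρ : Q.ρ y = 0 := by
        rw [← hc', hA.eq_zero_iff, hc]
        exact hfz
      obtain ⟨w, hw, hwi, hwy⟩ := HopfResolution.exists_d_eq hy hyi (Q.d_res_zero y hy) hρ
      refine ⟨w, le_below (by norm_num) hw, hwi, ?_⟩
      have : h w ∈ below Q.res 0 := hP.res 1 w hw
      rw [LinearMap.add_apply, hwy, mem_below_zero.1 this, add_zero]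
    | succ m =>
      have hy0 : Q.toHah.d y = 0 := by
        have e1 : Q.toHah.d y = -((Q.toHah.d + h) z' + h y) := by
          rw [← hzy, map_add, LinearMap.add_apply Q.toHah.d h y] at hDz
          rw [eq_neg_iff_add_eq_zero, ← hDz]
          abel
        have e2 : Q.toHah.d y ∈ below Q.res m := by
          have k1 := hPC.d_below hz'
          have k2 := hP.res (m + 1) y hy
          rw [Nat.add_sub_cancel] at k1 k2
          rw [e1]
          exact Submodule.neg_mem _ (Submodule.add_mem _ k1 k2)
        exact (proj_of_mem (Q.d_res m y hy)).symm.trans (hPC.proj_below e2)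
      obtain ⟨w, hw, hwi, hwy⟩ := HopfResolution.exists_d_eq hy hyi hy0
        (Q.ρ_res _ (Nat.succ_ne_zero m) y hy)
      have hhw : h w ∈ below Q.res (m + 1) := by
        have := hP.res (m + 1 + 1) w hw
        rwa [Nat.add_sub_cancel] at this
      have e : z - (Q.toHah.d + h) w = z' - h w := by
        rw [← hzy, LinearMap.add_apply, hwy]; abel
      obtain ⟨w', hw', hwi', hD'⟩ := ih (z := z - (Q.toHah.d + h) w)
        (by rw [e]; exact Submodule.sub_mem _ hz' hhw)
        (Submodule.sub_mem _ hzi (hP.mem i w hwi))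
        (by rw [map_sub, hDz, hP.d_d w hwi, sub_zero]) (by
          obtain ⟨c, hc⟩ := hfz
          exact ⟨c - f w, by rw [map_sub, map_sub, hc, hP.map_d w hwi]⟩)
      refine ⟨w + w', Submodule.add_mem _ (le_below (by omega) hw) (below_mono (by omega) hw'),
        Submodule.add_mem _ hwi hwi', ?_⟩
      rw [map_add, hD', add_sub_cancel]

/-- Here κ and c are the future values of h and f at the generator g. In resolution degrees 0 and 1
one can take κ = 0. Above that, w corrects dg to a cycle for d + h, and an element b of R₀H removes
the class of its image in A; the total correction -w - b lies low enough to be a perturbation. -/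
theorem IsPartial.exists_extension (hA : IsHomologyIso A H π) {i : ℤ}
    (hP : IsPartial A π h f (i + -1)) {q : ℕ} {g : Q.toHah.carrier} (hg : g ∈ Q.res q)
    (hgi : g ∈ Q.toHah.grading i) :
    ∃ κ ∈ Q.toHah.grading (i + -1), κ ∈ below Q.res (q - 1) ∧ ∃ c ∈ A.grading i,
      (q = 0 → ∃ z : LinearMap.ker A.d, z.1 = c ∧ π z = Q.ρ g) ∧
      (Q.toHah.d + h) (Q.toHah.d g + κ) = 0 ∧ f (Q.toHah.d g + κ) = A.d c := by
  have hdgi : Q.toHah.d g ∈ Q.toHah.grading (i + -1) := Q.toHah.isDGA.mem i g hgi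
  cases q with
  | zero =>
    obtain ⟨z, hz, hz'⟩ := hP.represents g hg
    refine ⟨0, Submodule.zero_mem _, Submodule.zero_mem _, f g, hP.f_mem i g hgi,
      fun _ => ⟨z, hz, hz'⟩, ?_, ?_⟩
    · rw [Q.d_res_zero g hg, add_zero, map_zero]
    · rw [Q.d_res_zero g hg, add_zero, map_zero, ← hz]; exact z.2.symm
  | succ m =>
    suffices key : ∃ κ ∈ Q.toHah.grading (i + -1), κ ∈ below Q.res m ∧
        (Q.toHah.d + h) (Q.toHah.d g + κ) = 0 ∧ ∃ c, A.d c = f (Q.toHah.d g + κ) by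
      obtain ⟨κ, hκ, hκm, hD, hc⟩ := key
      obtain ⟨c, hci, hc⟩ := A.isDGA.exists_mem_of_boundary
        (hP.f_mem _ _ (Submodule.add_mem _ hdgi hκ)) hc
      refine ⟨κ, hκ, hκm, c, ?_, fun h0 => absurd h0 (Nat.succ_ne_zero m), hD, hc.symm⟩
      rwa [neg_add_cancel_right] at hci
    have hdg := Q.d_res m g hg
    cases m with
    | zero =>
      refine ⟨0, Submodule.zero_mem _, Submodule.zero_mem _, ?_, ?_⟩
      · rw [add_zero, hP.d_of_res_zero hdg]
      · obtain ⟨z, hz, hz'⟩ := hP.represents _ hdg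
        rw [add_zero, ← hz]
        exact (hA.eq_zero_iff z).1 (by rw [hz', Q.ρ_d])
    | succ m =>
      have hz0 : (Q.toHah.d + h) (Q.toHah.d g) ∈ below Q.res m := by
        rw [LinearMap.add_apply, Q.toHah.isDGA.d_d, zero_add]
        exact hP.res (m + 1) _ hdg
      have hDz0 := hP.d_d _ hdgi
      obtain ⟨w, hw, hwi, hDw⟩ := hP.exists_d_eq hA hz0 (hP.mem _ _ hdgi) hDz0
        ⟨f (Q.toHah.d g), (hP.map_d _ hdgi).symm⟩
      have hDv : (Q.toHah.d + h) (Q.toHah.d g - w) = 0 := by rw [map_sub, hDw, sub_self]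
      have hvi := Submodule.sub_mem _ hdgi hwi
      have hfv : A.d (f (Q.toHah.d g - w)) = 0 := by
        rw [← hP.map_d _ hvi, hDv, map_zero]
      -- Subtracting b keeps the cycle condition, because d + h vanishes on R₀H, and makes the image
      -- under f a boundary.
      obtain ⟨b, hb, hbi, hρb⟩ := exists_res_zero_of_mem (Q := Q)
        (hA.mem _ ⟨_, hfv⟩ (hP.f_mem _ _ hvi))
      obtain ⟨z, hz, hz'⟩ := hP.represents b hb
      have e : Q.toHah.d g + (-w - b) = Q.toHah.d g - w - b := by abel
      refine ⟨-w - b, Submodule.sub_mem _ (Submodule.neg_mem _ hwi) hbi,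
        Submodule.sub_mem _ (Submodule.neg_mem _ hw) (le_below (Nat.succ_pos m) hb), ?_, ?_⟩
      · rw [e, map_sub, hDv, hP.d_of_res_zero hb, sub_zero]
      · obtain ⟨c, hc⟩ := (hA.eq_iff ⟨_, hfv⟩ z).1 (by rw [hz', hρb])
        exact ⟨c, by rw [hc, e, map_sub f (Q.toHah.d g - w), hz]⟩

/-- Every Hah with homology `H` receives a quasi-isomorphism from a perturbation of the
differential of a Hopf resolution. -/
theorem exists_perturbation (hQ : Q.Positive) (hA : IsHomologyIso A H π) :
    ∃ (h : Q.toHah.carrier →ₗ[R] Q.toHah.carrier) (f : Q.toHah.carrier →ₐ[R] A.carrier),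
      IsDerivationOfDegree Q.toHah.grading (-1) h ∧
      (∀ q, ∀ a ∈ Q.res q, h a ∈ below Q.res (q - 1)) ∧
      IsDGA Q.toHah.grading (Q.toHah.d + h) ∧
      IsDGAMap Q.toHah.grading A.grading (Q.toHah.d + h) A.d f ∧
      ∀ b ∈ Q.res 0, Represents A π f b := by
  let G := freeGen hQ
  -- These default values of f already give representing cycles on generators of resolution degree
  -- zero, so every partial f is correct on R₀H.
  have hf₀ : ∀ y, ∃ a ∈ A.grading (G.deg y), Q.resDeg y = 0 →
      ∃ z : LinearMap.ker A.d, z.1 = a ∧ π z = Q.ρ (Q.gen y) := fun y => by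
    obtain ⟨z, hz⟩ := hA.surjective (Q.ρ (Q.gen y))
    obtain ⟨w, hw, hwz⟩ := hA.exists_proj (G.deg y) z
    rw [hz] at hwz
    exact ⟨w.1, hw, fun _ => ⟨w, rfl, hwz.trans (proj_of_mem (Q.ρ_mem _ _ (hQ y)))⟩⟩
  choose f₀ hf₀_mem hf₀_rep using hf₀
  let hh (P : Q.X → Q.toHah.carrier × A.carrier) : Q.toHah.carrier →ₗ[R] Q.toHah.carrier :=
    derivLift Q.gen_free (sgn Q.toHah.grading) (AlgHom.id R _) fun y => (P y).1
  let ff (P : Q.X → Q.toHah.carrier × A.carrier) : Q.toHah.carrier →ₐ[R] A.carrier :=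
    freeLift Q.gen_free fun y => (P y).2
  let Valid (P : Q.X → Q.toHah.carrier × A.carrier) (y : Q.X) : Prop :=
    (P y).1 ∈ Q.toHah.grading (G.deg y + -1) ∧ (P y).1 ∈ below Q.res (Q.resDeg y - 1) ∧
    (P y).2 ∈ A.grading (G.deg y) ∧
    (Q.resDeg y = 0 → ∃ z : LinearMap.ker A.d, z.1 = (P y).2 ∧ π z = Q.ρ (Q.gen y))
  -- The pair holds h and f at the generator. The equations state that d + h squares to zero and
  -- that f commutes with the differentials there.
  let Good (P : Q.X → Q.toHah.carrier × A.carrier) (y : Q.X) : Prop :=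
    Valid P y ∧ (Q.toHah.d + hh P) (Q.toHah.d (Q.gen y) + (P y).1) = 0 ∧
    ff P (Q.toHah.d (Q.gen y) + (P y).1) = A.d (P y).2
  have hder : ∀ P, (∀ y, Valid P y) → IsDerivationOfDegree Q.toHah.grading (-1) (hh P) :=
    fun P hP => isDerivationOfDegree_of_mul
      (deriv_mem Q.gen_free (fun x => hQ x) (fun i a ha => sgn_mem _ ha) (fun i a ha => ha)
        (derivLift_mul Q.gen_free _ _ _) fun x => by
          rw [derivLift_gen]; exact (hP x).1)
      fun a b => by
        rw [derivLift_mul, add_comm]; rfl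
  have hres : ∀ P, (∀ y, Valid P y) → ∀ q, ∀ a ∈ Q.res q, hh P a ∈ below Q.res (q - 1) :=
    fun P hP => deriv_mem_below Q.gen_free Q.gen_mem_res (fun q a ha => sgn_mem_res ha)
      (derivLift_mul Q.gen_free _ _ _) fun x => by
        rw [derivLift_gen]; exact (hP x).2.1
  have hfm : ∀ P, (∀ y, Valid P y) → ∀ i, ∀ a ∈ Q.toHah.grading i, ff P a ∈ A.grading i :=
    fun P hP => freeLift_mem Q.gen_free (fun x => hQ x) fun x => (hP x).2.2.1
  have hrep : ∀ P, (∀ y, Valid P y) → ∀ b ∈ Q.res 0, Represents A π (ff P) b :=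
    fun P hP => represents_of_gen hA fun x hx => by
      obtain ⟨z, hz, hz'⟩ := (hP x).2.2.2 hx
      exact ⟨z, by rw [hz, freeLift_gen], hz'⟩
  have hS : ∀ P (hP : ∀ y, Valid P y) y, Good P y → Q.gen y ∈
      squareZeroSubalgebra (Q.toHah.isDGA.toIsDerivationOfDegree.add (hder P hP)) A.isDGA
        (hfm P hP) := fun P hP y hy => by
    have e : (Q.toHah.d + hh P) (Q.gen y) = Q.toHah.d (Q.gen y) + (P y).1 := by
      rw [LinearMap.add_apply, derivLift_gen]
    refine ⟨?_, ?_⟩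
    · rw [e]; exact hy.2.1
    · rw [e, freeLift_gen]; exact hy.2.2
  have hstep : ∃ P, ∀ x, Good P x := by
    refine exists_of_step G.rk Good ?_ (fun y => (0, f₀ y)) ?_
    · rintro P P' x hx hlt ⟨⟨h1, h2, h3, h4⟩, h5, h6⟩
      have hm : Q.toHah.d (Q.gen x) + (P x).1 ∈ Q.toHah.grading (G.deg x + -1) :=
        Submodule.add_mem _ (Q.toHah.isDGA.mem _ _ (hQ x)) h1
      have e1 : hh P (Q.toHah.d (Q.gen x) + (P x).1) = hh P' (Q.toHah.d (Q.gen x) + (P x).1) :=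
        G.derivLift_congr (fun y hy => ⟨rfl, rfl, by rw [hlt y (G.rk_lt hy)]⟩) hm
      have e2 : ff P (Q.toHah.d (Q.gen x) + (P x).1) = ff P' (Q.toHah.d (Q.gen x) + (P x).1) :=
        G.freeLift_congr (fun y hy => by rw [hlt y (G.rk_lt hy)]) hm
      refine ⟨⟨hx ▸ h1, hx ▸ h2, hx ▸ h3, hx ▸ h4⟩, ?_, ?_⟩
      · rw [← hx, LinearMap.add_apply, ← e1, ← LinearMap.add_apply]; exact h5
      · rw [← hx, ← e2]; exact h6
    · intro P x hlt hge
      have hV : ∀ y, Valid P y := fun y => by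
        rcases lt_or_ge (G.rk y) (G.rk x) with h | h
        · exact (hlt y h).1
        · simp only [Valid, hge y h]
          exact ⟨Submodule.zero_mem _, Submodule.zero_mem _, hf₀_mem y, hf₀_rep y⟩
      have hSi : ∀ a ∈ Q.toHah.grading (G.deg x + -1), a ∈
          squareZeroSubalgebra (Q.toHah.isDGA.toIsDerivationOfDegree.add (hder P hV)) A.isDGA
            (hfm P hV) := fun a ha =>
        mem_subalgebra_of_degree_le G.free G.mem G.pos _
          (fun y hy => hS P hV y (hlt y (G.rk_lt hy))) ha
      have hPart : IsPartial A π (hh P) (ff P) (G.deg x + -1) :=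
        ⟨(Q.toHah.isDGA.toIsDerivationOfDegree.add (hder P hV)).mem, hres P hV, hfm P hV,
          hrep P hV, fun a ha => (hSi a ha).1, fun a ha => (hSi a ha).2⟩
      obtain ⟨κ, hκ, hκr, c, hc, hc0, hD, hfc⟩ :=
        hPart.exists_extension hA (Q.gen_mem_res x) (hQ x)
      refine ⟨(κ, c), fun P' hx hP' => ?_⟩
      have hm : Q.toHah.d (Q.gen x) + κ ∈ Q.toHah.grading (G.deg x + -1) :=
        Submodule.add_mem _ (Q.toHah.isDGA.mem _ _ (hQ x)) hκ
      have e1 : hh P' (Q.toHah.d (Q.gen x) + κ) = hh P (Q.toHah.d (Q.gen x) + κ) :=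
        G.derivLift_congr (fun y hy => ⟨rfl, rfl, by rw [hP' y (G.rk_lt hy)]⟩) hm
      have e2 : ff P' (Q.toHah.d (Q.gen x) + κ) = ff P (Q.toHah.d (Q.gen x) + κ) :=
        G.freeLift_congr (fun y hy => by rw [hP' y (G.rk_lt hy)]) hm
      simp only [Good, Valid, hx]
      refine ⟨⟨hκ, hκr, hc, hc0⟩, ?_, ?_⟩
      · rw [LinearMap.add_apply, e1, ← LinearMap.add_apply]; exact hD
      · rw [e2]; exact hfc
  obtain ⟨P, hP⟩ := hstep
  have hV : ∀ y, Valid P y := fun y => (hP y).1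
  have hall := mem_subalgebra_of_gen Q.gen_free _ fun y => hS P hV y (hP y)
  exact ⟨hh P, ff P, hder P hV, hres P hV,
    ⟨Q.toHah.isDGA.toIsDerivationOfDegree.add (hder P hV), fun a => (hall a).1⟩,
    ⟨hfm P hV, fun a => (hall a).2⟩, hrep P hV⟩

end Construction

end HopfResolution

/-! ### Counits and the normalisation of tensors -/

section Counit

variable {R : Type u} [CommRing R]
variable {A : Type u} [Ring A] [Algebra R A] {𝒜 : ℤ → Submodule R A} [GradedAlgebra 𝒜]
variable {B : Type u} [Ring B] [Algebra R B] {ℬ : ℤ → Submodule R B} [GradedAlgebra ℬ]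

/-- An augmentation vanishes in nonzero degrees and on boundaries. -/
structure IsAugmentation (𝒜 : ℤ → Submodule R A) (d : A →ₗ[R] A) (ε : A →ₐ[R] R) : Prop where
  degree : ∀ i, i ≠ 0 → ∀ a ∈ 𝒜 i, ε a = 0
  d : ∀ a, ε (d a) = 0

variable {d : A →ₗ[R] A} {ε : A →ₐ[R] R} {dB : B →ₗ[R] B} {εB : B →ₐ[R] R}

variable (𝒜) in
/-- The map `ε ⊗ 1`. -/
def counitLeft (ε : A →ₐ[R] R) : (𝒜 ᵍ⊗[R] 𝒜) →ₗ[R] A :=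
  (TensorProduct.lid R A).toLinearMap ∘ₗ TensorProduct.map ε.toLinearMap LinearMap.id ∘ₗ
    (GradedTensorProduct.of R 𝒜 𝒜).symm.toLinearMap

variable (𝒜) in
/-- The map `1 ⊗ ε`. -/
def counitRight (ε : A →ₐ[R] R) : (𝒜 ᵍ⊗[R] 𝒜) →ₗ[R] A :=
  (TensorProduct.rid R A).toLinearMap ∘ₗ TensorProduct.map LinearMap.id ε.toLinearMap ∘ₗ
    (GradedTensorProduct.of R 𝒜 𝒜).symm.toLinearMap

theorem counitLeft_tmul (a b : A) : counitLeft 𝒜 ε (tmul R a b) = ε a • b := rfl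

theorem counitRight_tmul (a b : A) : counitRight 𝒜 ε (tmul R a b) = ε b • a := rfl

/-- The Koszul sign is trivial when the left factor of the second tensor has degree zero, and
otherwise both sides vanish since ε does. -/
theorem IsAugmentation.counitLeft_mul (h : IsAugmentation 𝒜 d ε) (x y : 𝒜 ᵍ⊗[R] 𝒜) :
    counitLeft 𝒜 ε (x * y) = counitLeft 𝒜 ε x * counitLeft 𝒜 ε y := by
  refine tensor_mul_ext (m := (LinearMap.mul R A).compl₁₂ (counitLeft 𝒜 ε) (counitLeft 𝒜 ε))
    (fun i j i' j' a ha b hb a' ha' b' hb' => ?_) x y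
  rw [tmul_mul_tmul a hb ha' b', map_zsmul, counitLeft_tmul, LinearMap.compl₁₂_apply,
    LinearMap.mul_apply', counitLeft_tmul, counitLeft_tmul, map_mul]
  by_cases hi : i' = 0
  · subst hi
    rw [mul_zero, zpow_zero, Units.val_one, one_smul, smul_mul_smul_comm]
  · rw [h.degree i' hi a' ha', mul_zero, zero_smul, zero_smul, smul_zero, mul_zero]

theorem IsAugmentation.counitRight_mul (h : IsAugmentation 𝒜 d ε) (x y : 𝒜 ᵍ⊗[R] 𝒜) :
    counitRight 𝒜 ε (x * y) = counitRight 𝒜 ε x * counitRight 𝒜 ε y := by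
  refine tensor_mul_ext (m := (LinearMap.mul R A).compl₁₂ (counitRight 𝒜 ε) (counitRight 𝒜 ε))
    (fun i j i' j' a ha b hb a' ha' b' hb' => ?_) x y
  rw [tmul_mul_tmul a hb ha' b', map_zsmul, counitRight_tmul, LinearMap.compl₁₂_apply,
    LinearMap.mul_apply', counitRight_tmul, counitRight_tmul, map_mul]
  by_cases hi : j = 0
  · subst hi
    rw [zero_mul, zpow_zero, Units.val_one, one_smul, smul_mul_smul_comm]
  · rw [h.degree j hi b hb, zero_mul, zero_smul, zero_smul, smul_zero, zero_mul]

/-- `ε ⊗ 1` as a homomorphism of algebras. -/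
def IsAugmentation.counitLeftHom (h : IsAugmentation 𝒜 d ε) : (𝒜 ᵍ⊗[R] 𝒜) →ₐ[R] A :=
  AlgHom.ofLinearMap (counitLeft 𝒜 ε)
    (by
      change counitLeft 𝒜 ε (tmul R 1 1) = 1
      rw [counitLeft_tmul, map_one, one_smul]) h.counitLeft_mul

/-- `1 ⊗ ε` as a homomorphism of algebras. -/
def IsAugmentation.counitRightHom (h : IsAugmentation 𝒜 d ε) : (𝒜 ᵍ⊗[R] 𝒜) →ₐ[R] A :=
  AlgHom.ofLinearMap (counitRight 𝒜 ε)
    (by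
      change counitRight 𝒜 ε (tmul R 1 1) = 1
      rw [counitRight_tmul, map_one, one_smul]) h.counitRight_mul

theorem IsAugmentation.sgn (h : IsAugmentation 𝒜 d ε) (a : A) : ε (sgn 𝒜 a) = ε a := by
  have : ε.toLinearMap ∘ₗ (HopfHomotopy.sgn 𝒜).toLinearMap = ε.toLinearMap :=
    graded_hom_ext 𝒜 fun i a ha => by
      change ε (HopfHomotopy.sgn 𝒜 a) = ε a
      by_cases hi : i = 0
      · subst hi
        rw [sgn_apply, signMap_apply 𝒜 ha, zpow_zero, Units.val_one, one_smul]
      · rw [h.degree i hi _ (sgn_mem 𝒜 ha), h.degree i hi a ha]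
  exact congr($this a)

theorem IsAugmentation.counitLeft_tensorD (h : IsAugmentation 𝒜 d ε) (t : 𝒜 ᵍ⊗[R] 𝒜) :
    counitLeft 𝒜 ε (tensorD 𝒜 𝒜 d d t) = d (counitLeft 𝒜 ε t) := by
  have : counitLeft 𝒜 ε ∘ₗ tensorD 𝒜 𝒜 d d = d ∘ₗ counitLeft 𝒜 ε := tensor_ext fun a b => by
    rw [LinearMap.comp_apply, LinearMap.comp_apply, tensorD_tmul, map_add, counitLeft_tmul,
      counitLeft_tmul, counitLeft_tmul, h.d, h.sgn, zero_smul, zero_add, map_smul]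
  exact congr($this t)

theorem IsAugmentation.counitRight_tensorD (h : IsAugmentation 𝒜 d ε) (t : 𝒜 ᵍ⊗[R] 𝒜) :
    counitRight 𝒜 ε (tensorD 𝒜 𝒜 d d t) = d (counitRight 𝒜 ε t) := by
  have : counitRight 𝒜 ε ∘ₗ tensorD 𝒜 𝒜 d d = d ∘ₗ counitRight 𝒜 ε := tensor_ext fun a b => by
    rw [LinearMap.comp_apply, LinearMap.comp_apply, tensorD_tmul, map_add, counitRight_tmul,
      counitRight_tmul, counitRight_tmul, h.d, zero_smul, add_zero, map_smul]
  exact congr($this t)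

theorem counitLeft_tensorMap {f : A →ₐ[R] B} (hε : ∀ a, εB (f a) = ε a) (t : 𝒜 ᵍ⊗[R] 𝒜) :
    counitLeft ℬ εB (tensorMap f.toLinearMap f.toLinearMap t) = f (counitLeft 𝒜 ε t) := by
  have : counitLeft ℬ εB ∘ₗ (tensorMap f.toLinearMap f.toLinearMap : _ →ₗ[R] (ℬ ᵍ⊗[R] ℬ)) =
      f.toLinearMap ∘ₗ counitLeft 𝒜 ε := tensor_ext fun a b => by
    rw [LinearMap.comp_apply, LinearMap.comp_apply, tensorMap_tmul, counitLeft_tmul,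
      counitLeft_tmul, map_smul, AlgHom.toLinearMap_apply, hε]
  exact congr($this t)

theorem counitRight_tensorMap {f : A →ₐ[R] B} (hε : ∀ a, εB (f a) = ε a) (t : 𝒜 ᵍ⊗[R] 𝒜) :
    counitRight ℬ εB (tensorMap f.toLinearMap f.toLinearMap t) = f (counitRight 𝒜 ε t) := by
  have : counitRight ℬ εB ∘ₗ (tensorMap f.toLinearMap f.toLinearMap : _ →ₗ[R] (ℬ ᵍ⊗[R] ℬ)) =
      f.toLinearMap ∘ₗ counitRight 𝒜 ε := tensor_ext fun a b => by
    rw [LinearMap.comp_apply, LinearMap.comp_apply, tensorMap_tmul, counitRight_tmul,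
      counitRight_tmul, map_smul, AlgHom.toLinearMap_apply, AlgHom.toLinearMap_apply, hε]
  exact congr($this t)

/-- The projection `a ↦ a - ε(a)` onto the augmentation ideal. -/
def reduce (ε : A →ₐ[R] R) : A →ₗ[R] A :=
  LinearMap.id - Algebra.linearMap R A ∘ₗ ε.toLinearMap

theorem reduce_apply (a : A) : reduce ε a = a - ε a • 1 := by
  rw [← Algebra.algebraMap_eq_smul_one]; rfl

theorem counit_reduce (a : A) : ε (reduce ε a) = 0 := by
  rw [reduce_apply, map_sub, map_smul, map_one, smul_eq_mul, mul_one, sub_self]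

theorem map_reduce {f : A →ₐ[R] B} (hε : ∀ a, εB (f a) = ε a) (a : A) :
    f (reduce ε a) = reduce εB (f a) := by
  rw [reduce_apply, reduce_apply, map_sub, map_smul, map_one, hε]

theorem IsAugmentation.reduce_mem (h : IsAugmentation 𝒜 d ε) (i : ℤ) (a : A) (ha : a ∈ 𝒜 i) :
    reduce ε a ∈ 𝒜 i := by
  rw [reduce_apply]
  by_cases hi : i = 0
  · subst hi
    exact Submodule.sub_mem _ ha (Submodule.smul_mem _ _ SetLike.GradedOne.one_mem)
  · rwa [h.degree i hi a ha, zero_smul, sub_zero]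

variable (𝒜) in
/-- The projection of `A ⊗ A` onto the tensor square of the augmentation ideal. -/
def reduce₂ (ε : A →ₐ[R] R) : (𝒜 ᵍ⊗[R] 𝒜) →ₗ[R] (𝒜 ᵍ⊗[R] 𝒜) :=
  tensorMap (reduce ε) (reduce ε)

theorem reduce₂_tmul (a b : A) :
    reduce₂ 𝒜 ε (tmul R a b) = tmul R (reduce ε a) (reduce ε b) := rfl

theorem IsAugmentation.reduce₂_mem (h : IsAugmentation 𝒜 d ε) {i : ℤ} {t : 𝒜 ᵍ⊗[R] 𝒜}
    (ht : t ∈ tensorGrading 𝒜 𝒜 i) : reduce₂ 𝒜 ε t ∈ tensorGrading 𝒜 𝒜 i :=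
  tensorMap_mem_zero h.reduce_mem h.reduce_mem i t ht

theorem counitLeft_reduce₂ (t : 𝒜 ᵍ⊗[R] 𝒜) : counitLeft 𝒜 ε (reduce₂ 𝒜 ε t) = 0 := by
  have : counitLeft 𝒜 ε ∘ₗ reduce₂ 𝒜 ε = 0 := tensor_ext fun a b => by
    rw [LinearMap.comp_apply, reduce₂_tmul, counitLeft_tmul, counit_reduce, zero_smul]; rfl
  exact congr($this t)

theorem counitRight_reduce₂ (t : 𝒜 ᵍ⊗[R] 𝒜) : counitRight 𝒜 ε (reduce₂ 𝒜 ε t) = 0 := by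
  have : counitRight 𝒜 ε ∘ₗ reduce₂ 𝒜 ε = 0 := tensor_ext fun a b => by
    rw [LinearMap.comp_apply, reduce₂_tmul, counitRight_tmul, counit_reduce, zero_smul]; rfl
  exact congr($this t)

/-- The projection differs from the identity only by terms built from the two counits of t, as `key`
makes explicit. -/
theorem reduce₂_eq_self {t : 𝒜 ᵍ⊗[R] 𝒜} (hl : counitLeft 𝒜 ε t = 0)
    (hr : counitRight 𝒜 ε t = 0) : reduce₂ 𝒜 ε t = t := by
  have key : ∀ t : 𝒜 ᵍ⊗[R] 𝒜, reduce₂ 𝒜 ε t = t - tmul R 1 (counitLeft 𝒜 ε t) -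
      tmul R (counitRight 𝒜 ε t) 1 + ε (counitLeft 𝒜 ε t) • tmul R 1 1 := by
    intro t
    induction t using tensor_induction with
    | zero => simp only [map_zero, tmul_zero', zero_tmul', zero_smul]; simp
    | add x y hx hy =>
      simp only [map_add, hx, hy, tmul_add', add_tmul', add_smul]; abel
    | tm a b =>
      rw [reduce₂_tmul, reduce_apply, reduce_apply, counitLeft_tmul, counitRight_tmul, map_smul,
        tmul_sub', sub_tmul', sub_tmul', tmul_smul'', tmul_smul'', tmul_smul'', smul_tmul'',
        smul_tmul'', smul_tmul'', smul_eq_mul, mul_comm, mul_smul]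
      abel
  rw [key, hl, hr, tmul_zero', zero_tmul', map_zero, zero_smul, sub_zero, sub_zero, add_zero]

theorem IsAugmentation.reduce₂_tensorD (h : IsAugmentation 𝒜 d ε)
    (hd : IsDerivationOfDegree 𝒜 (-1) d) (t : 𝒜 ᵍ⊗[R] 𝒜) :
    reduce₂ 𝒜 ε (tensorD 𝒜 𝒜 d d t) = tensorD 𝒜 𝒜 d d (reduce₂ 𝒜 ε t) := by
  have e1 : ∀ a, reduce ε (d a) = d a := fun a => by
    rw [reduce_apply, h.d, zero_smul, sub_zero]
  have e2 : ∀ a, d (reduce ε a) = d a := fun a => by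
    rw [reduce_apply, map_sub, map_smul, hd.map_one, smul_zero, sub_zero]
  have : reduce₂ 𝒜 ε ∘ₗ tensorD 𝒜 𝒜 d d = tensorD 𝒜 𝒜 d d ∘ₗ reduce₂ 𝒜 ε :=
    tensor_ext fun a b => by
      rw [LinearMap.comp_apply, LinearMap.comp_apply, tensorD_tmul, map_add, reduce₂_tmul,
        reduce₂_tmul, reduce₂_tmul, tensorD_tmul, e1, e1, e2, e2, sgn_comm_even 𝒜 𝒜 h.reduce_mem]
  exact congr($this t)

theorem reduce₂_tensorMap {f : A →ₐ[R] B} (hε : ∀ a, εB (f a) = ε a) (t : 𝒜 ᵍ⊗[R] 𝒜) :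
    (tensorMap f.toLinearMap f.toLinearMap (reduce₂ 𝒜 ε t) : ℬ ᵍ⊗[R] ℬ) =
      reduce₂ ℬ εB (tensorMap f.toLinearMap f.toLinearMap t) := by
  have : (tensorMap f.toLinearMap f.toLinearMap : _ →ₗ[R] (ℬ ᵍ⊗[R] ℬ)) ∘ₗ reduce₂ 𝒜 ε =
      reduce₂ ℬ εB ∘ₗ tensorMap f.toLinearMap f.toLinearMap := tensor_ext fun a b => by
    rw [LinearMap.comp_apply, LinearMap.comp_apply, tensorMap_tmul, reduce₂_tmul, reduce₂_tmul,
      tensorMap_tmul, AlgHom.toLinearMap_apply, AlgHom.toLinearMap_apply, AlgHom.toLinearMap_apply,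
      AlgHom.toLinearMap_apply, map_reduce hε, map_reduce hε]
  exact congr($this t)

theorem Hah.isAugmentation (A : Hah R) : IsAugmentation A.grading A.d A.counit :=
  ⟨A.isHah.isCoproduct.counit_degree, A.isHah.counit_d⟩

theorem Hah.counitLeft_psi (A : Hah R) (a : A.carrier) :
    counitLeft A.grading A.counit (A.psi a) = a := A.isHah.isCoproduct.counit_left a

theorem Hah.counitRight_psi (A : Hah R) (a : A.carrier) :
    counitRight A.grading A.counit (A.psi a) = a := A.isHah.isCoproduct.counit_right a

/-- A solution of a lifting problem for coproducts can be changed to one that respects counits. -/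
theorem exists_counital (hA : IsAugmentation 𝒜 d ε) (hd : IsDGA 𝒜 d) (hB : IsAugmentation ℬ dB εB)
    (hdB : IsDGA ℬ dB) {f : A →ₐ[R] B} (hε : ∀ a, εB (f a) = ε a) {g : A} {i : ℤ}
    {t u b : 𝒜 ᵍ⊗[R] 𝒜} {v c : ℬ ᵍ⊗[R] ℬ}
    (ht : t ∈ tensorGrading 𝒜 𝒜 i) (hb : b ∈ tensorGrading 𝒜 𝒜 i)
    (hc : c ∈ tensorGrading ℬ ℬ (i + 1)) (hbu : tensorD 𝒜 𝒜 d d b = u)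
    (hbv : tensorMap f.toLinearMap f.toLinearMap b = v - tensorD ℬ ℬ dB dB c)
    (htl : counitLeft 𝒜 ε t = g) (htr : counitRight 𝒜 ε t = g)
    (hul : counitLeft 𝒜 ε u = d g) (hur : counitRight 𝒜 ε u = d g)
    (hvl : counitLeft ℬ εB v = f g) (hvr : counitRight ℬ εB v = f g) :
    let b' := t + reduce₂ 𝒜 ε (b - t)
    let c' := reduce₂ ℬ εB c
    b' ∈ tensorGrading 𝒜 𝒜 i ∧ c' ∈ tensorGrading ℬ ℬ (i + 1) ∧ tensorD 𝒜 𝒜 d d b' = u ∧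
      tensorMap f.toLinearMap f.toLinearMap b' = v - tensorD ℬ ℬ dB dB c' ∧
      counitLeft 𝒜 ε b' = g ∧ counitRight 𝒜 ε b' = g ∧
      counitLeft ℬ εB c' = 0 ∧ counitRight ℬ εB c' = 0 := by
  -- t meets the counit conditions, while b solves the equations. The differences of u and v from
  -- the corresponding values at t are killed by both counits, so replacing b - t and c by their
  -- reduced parts keeps the equations.
  refine ⟨Submodule.add_mem _ ht (hA.reduce₂_mem (Submodule.sub_mem _ hb ht)), hB.reduce₂_mem hc,
    ?_, ?_, ?_, ?_, counitLeft_reduce₂ c, counitRight_reduce₂ c⟩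
  · rw [map_add, ← hA.reduce₂_tensorD hd.toIsDerivationOfDegree, map_sub, hbu, reduce₂_eq_self,
      add_sub_cancel]
    · rw [map_sub, hul, hA.counitLeft_tensorD, htl, sub_self]
    · rw [map_sub, hur, hA.counitRight_tensorD, htr, sub_self]
  · rw [map_add, reduce₂_tensorMap hε, map_sub, hbv, sub_right_comm, map_sub,
      hB.reduce₂_tensorD hdB.toIsDerivationOfDegree,
      reduce₂_eq_self (t := v - tensorMap f.toLinearMap f.toLinearMap t)]
    · abel
    · rw [map_sub, hvl, counitLeft_tensorMap hε, htl, sub_self]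
    · rw [map_sub, hvr, counitRight_tensorMap hε, htr, sub_self]
  · rw [map_add, htl, counitLeft_reduce₂, add_zero]
  · rw [map_add, htr, counitRight_reduce₂, add_zero]

end Counit

/-! ### Lifting the coproduct -/

namespace HopfResolution

variable {R : Type u} [CommRing R] {H : GradedHopfAlgebra R} {Q : HopfResolution H}
variable {A : Hah R} {π : LinearMap.ker A.d →ₗ[R] H.carrier}
variable {h : Q.toHah.carrier →ₗ[R] Q.toHah.carrier} {f : Q.toHah.carrier →ₐ[R] A.carrier}

/-- A perturbation `d + h` of the differential of a Hopf resolution, with a map of dga's to `A`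
inducing the given identification of homologies. -/
structure IsModel (A : Hah R) (π : LinearMap.ker A.d →ₗ[R] H.carrier)
    (h : Q.toHah.carrier →ₗ[R] Q.toHah.carrier) (f : Q.toHah.carrier →ₐ[R] A.carrier) : Prop where
  res : ∀ q, ∀ a ∈ Q.res q, h a ∈ below Q.res (q - 1)
  isDGA : IsDGA Q.toHah.grading (Q.toHah.d + h)
  isDGAMap : IsDGAMap Q.toHah.grading A.grading (Q.toHah.d + h) A.d f
  represents : ∀ b ∈ Q.res 0, Represents A π f b

theorem IsModel.isQuasiIso (M : IsModel A π h f) (hA : IsHomologyIso A H π) :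
    IsQuasiIso (Q.toHah.d + h) A.d f where
  inj a ha hc := by
    obtain ⟨c, hc⟩ := hc
    obtain ⟨e, he⟩ := (isPerturbedComplex M.res).exists_sub_mem M.isDGA.d_d (q := 0) (z := a)
      (by rw [ha]; exact Submodule.zero_mem _)
    rw [below_one] at he
    obtain ⟨z, hz, hz'⟩ := M.represents _ he
    have hρ : Q.ρ (a - (Q.toHah.d + h) e) = 0 := by
      rw [← hz', hA.eq_zero_iff, hz]
      exact ⟨c - f e, by rw [map_sub, map_sub, hc, M.isDGAMap.map_d]⟩
    obtain ⟨w, hw⟩ := Q.ρ_injective _ (Q.d_res_zero _ he) hρ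
    refine ⟨e + GradedAlgebra.proj Q.res 1 w, ?_⟩
    have h1 : h (GradedAlgebra.proj Q.res 1 w) = 0 :=
      mem_below_zero.1 (M.res 1 _ (proj_mem _ _ _))
    rw [map_add, LinearMap.add_apply _ _ (GradedAlgebra.proj Q.res 1 w), h1, add_zero, d_proj, hw,
      proj_of_mem he, add_sub_cancel]
  surj c hc := by
    obtain ⟨b, hb, hb'⟩ := exists_res_zero (Q := Q) (π ⟨c, hc⟩)
    obtain ⟨z, hz, hz'⟩ := M.represents b hb
    obtain ⟨e, he⟩ := (hA.eq_iff z ⟨c, hc⟩).1 (hz'.trans hb')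
    refine ⟨b, ?_, e, by rw [he, hz]⟩
    rw [LinearMap.add_apply, Q.d_res_zero b hb, mem_below_zero.1 (M.res 0 b hb), add_zero]

variable (Q) in
/-- The differential of the tensor square of a perturbed resolution. -/
abbrev D₂ (h : Q.toHah.carrier →ₗ[R] Q.toHah.carrier) : Q.sq →ₗ[R] Q.sq :=
  tensorD Q.toHah.grading Q.toHah.grading (Q.toHah.d + h) (Q.toHah.d + h)

theorem D₂_apply (t : Q.sq) : Q.D₂ h t =
    Q.toHah.d₂ t + tensorD Q.toHah.grading Q.toHah.grading h h t := by
  rw [D₂, tensorD_add]; rfl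

variable (Q) in
/-- The grading of the tensor square of a resolution. -/
abbrev grading₂ : ℤ → Submodule R Q.sq := tensorGrading Q.toHah.grading Q.toHah.grading

/-- Both elements represent the coproduct of ρ(g) by tensors of cycles with equal images in H ⊗ H,
so they are homologous by `cross_boundary`. -/
theorem IsModel.psi_boundary (M : IsModel A π h f) (hA : IsHomologyIso A H π)
    {g : Q.toHah.carrier} (hg : g ∈ Q.res 0) :
    ∃ c, A.d₂ c = A.psi (f g) - tensorMap f.toLinearMap f.toLinearMap (Q.toHah.psi g) := by
  obtain ⟨z, hz, hz'⟩ := M.represents g hg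
  obtain ⟨t, ⟨c, hc⟩, ht⟩ := hA.coproduct z
  obtain ⟨t', h1, h2⟩ := Perturbation.exists_cross f.toLinearMap M.represents
    (Q.coproduct_res 0 g hg)
  have h3 : TensorProduct.map π π (t - t') = 0 := by
    apply (GradedTensorProduct.of R H.grading H.grading).injective
    rw [map_sub, map_sub, ← ht, h2, hz', Q.ρ_coproduct, map_zero, sub_self]
  obtain ⟨e, he⟩ := cross_boundary hA h3
  refine ⟨c + e, ?_⟩
  rw [map_add, hc, he, map_sub, h1, hz]
  change _ = A.coproduct (f g) - tensorMap f.toLinearMap f.toLinearMap (Q.toHah.coproduct g)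
  abel

/-- In resolution degree zero the lift is the unperturbed coproduct of g. Above, any lift exists
because f ⊗ f is a quasi-isomorphism; its difference from the unperturbed coproduct has low
boundary, so acyclicity of the tensor square allows a boundary to be subtracted that makes the
difference low, with the homotopy adjusted accordingly. -/
theorem IsModel.exists_lift_step [Module.Flat R H.carrier] (M : IsModel A π h f)
    (hA : IsHomologyIso A H π)
    (hq : IsQuasiIso (Q.D₂ h) A.d₂ (M.isDGAMap.tensor M.isDGAMap)) {q : ℕ} {i : ℤ}
    {g : Q.toHah.carrier} (hg : g ∈ Q.res q) (hgi : g ∈ Q.toHah.grading i) {u : Q.sq}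
    {v : A.grading ᵍ⊗[R] A.grading} (hu : u ∈ Q.grading₂ (i + -1)) (hDu : Q.D₂ h u = 0)
    (hu' : u - Q.D₂ h (Q.toHah.psi g) ∈ below Q.res₂ (q - 1))
    (hv : v ∈ tensorGrading A.grading A.grading i)
    (huv : M.isDGAMap.tensor M.isDGAMap u = A.d₂ v) (hu0 : q = 0 → u = 0)
    (hv0 : q = 0 → v = A.psi (f g)) :
    ∃ b ∈ Q.grading₂ i, ∃ c ∈ tensorGrading A.grading A.grading (i + 1), Q.D₂ h b = u ∧
      M.isDGAMap.tensor M.isDGAMap b = v - A.d₂ c ∧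
      b - Q.toHah.psi g ∈ below Q.res₂ q := by
  have hφ := M.isDGAMap.tensor_isDGAMap M.isDGAMap
  have hψ := Q.toHah.psi_isDGAMap.mem i g hgi
  have hD := M.isDGA.tensor M.isDGA
  cases q with
  | zero =>
    rw [Nat.zero_sub, mem_below_zero, sub_eq_zero] at hu'
    obtain ⟨c, hc, hc'⟩ := A.isDGA₂.exists_mem_of_boundary
      (Submodule.sub_mem _ hv (hφ.mem i _ hψ)) (by
        rw [hv0 rfl]; exact M.psi_boundary hA hg)
    exact ⟨_, hψ, c, hc, hu'.symm, by rw [hc', sub_sub_cancel],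
      by rw [sub_self]; exact Submodule.zero_mem _⟩
  | succ m =>
    rw [Nat.add_sub_cancel] at hu'
    obtain ⟨b₀, hb₀, c₀, hc₀, hDb, hφb⟩ := hq.exists_lift hD A.isDGA₂ hφ hu hv hDu huv
    have hP := isPerturbedComplex₂ (Q := Q) M.res
    have e := tensorD_add (Q := Q) Q.toHah.d h
    obtain ⟨c₁, hc₁, hc₁'⟩ := hP.exists_sub_mem_of_degree (e ▸ hD)
      (fun i q a ha => proj_mem_res₂ i ha) (Submodule.sub_mem _ hb₀ hψ) (q := m)
      (by rwa [← e, map_sub, hDb])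
    rw [← e] at hc₁'
    have hDc := hD.mem _ _ hc₁
    rw [add_neg_cancel_right] at hDc
    refine ⟨b₀ - Q.D₂ h c₁, Submodule.sub_mem _ hb₀ hDc,
      c₀ + M.isDGAMap.tensor M.isDGAMap c₁, Submodule.add_mem _ hc₀ (hφ.mem _ _ hc₁), ?_, ?_, ?_⟩
    · rw [map_sub, hDb, hD.d_d, sub_zero]
    · rw [map_sub, hφb, hφ.map_d, map_add]; abel
    · rwa [sub_right_comm]

/-- The unperturbed coproduct commutes with d, so only terms containing h or the difference between
p and that coproduct remain, and these lower the filtration. -/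
theorem IsModel.sub_mem_below (M : IsModel A π h f) {p : Q.toHah.carrier →ₐ[R] Q.sq}
    (hp : ∀ q, ∀ a ∈ Q.res q, p a - Q.toHah.psi a ∈ below Q.res₂ q) {q : ℕ}
    {g : Q.toHah.carrier} (hg : g ∈ Q.res q) :
    p ((Q.toHah.d + h) g) - Q.D₂ h (Q.toHah.psi g) ∈ below Q.res₂ (q - 1) := by
  have e : p ((Q.toHah.d + h) g) - Q.D₂ h (Q.toHah.psi g) =
      (p (Q.toHah.d g) - Q.toHah.psi (Q.toHah.d g)) + p (h g) -
        tensorD Q.toHah.grading Q.toHah.grading h h (Q.toHah.psi g) := by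
    rw [D₂_apply, Q.toHah.psi_isDGAMap.map_d, LinearMap.add_apply, map_add]; abel
  rw [e]
  refine Submodule.sub_mem _ (Submodule.add_mem _ ?_ ?_)
    (tensorD_mem_below M.res q _ (Q.coproduct_res q g hg))
  · cases q with
    | zero => rw [Q.d_res_zero g hg, map_zero, map_zero, sub_zero]; exact Submodule.zero_mem _
    | succ m => exact hp m _ (Q.d_res m g hg)
  · have := M.res q g hg
    cases q with
    | zero => rw [mem_below_zero.1 this, map_zero]; exact Submodule.zero_mem _
    | succ m =>
      have key : below Q.res m ≤ (below Q.res₂ m).comap p.toLinearMap :=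
        below_le fun i hi a ha => by
          have h1 := below_mono hi.le (hp i a ha)
          have h2 : Q.toHah.coproduct a ∈ below Q.res₂ m :=
            le_below (F := Q.res₂) hi (Q.coproduct_res i a ha)
          have := Submodule.add_mem _ h1 h2
          change p a ∈ below Q.res₂ m
          rwa [show p a - Q.toHah.psi a + Q.toHah.coproduct a = p a from sub_add_cancel _ _] at this
      exact key this

/-- The coproduct of `A` lifts to a perturbation of the coproduct of the resolution. -/
theorem IsModel.exists_coproduct [Module.Flat R H.carrier] (hQ : Q.Positive)
    (GA : FreeGen A.grading) (M : IsModel A π h f) (hA : IsHomologyIso A H π) :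
    ∃ p : Q.toHah.carrier →ₐ[R] Q.sq,
      IsDGAMap Q.toHah.grading Q.grading₂ (Q.toHah.d + h) (Q.D₂ h) p ∧
      DerivHomotopic Q.toHah.grading (tensorGrading A.grading A.grading) (Q.toHah.d + h) A.d₂
        (A.psi.comp f).toLinearMap ((M.isDGAMap.tensor M.isDGAMap).comp p).toLinearMap ∧
      (∀ q, ∀ a ∈ Q.res q, p a - Q.toHah.psi a ∈ below Q.res₂ q) ∧
      (∀ a, counitLeft Q.toHah.grading Q.toHah.counit (p a) = a) ∧
      ∀ a, counitRight Q.toHah.grading Q.toHah.counit (p a) = a := by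
  have hφ := M.isDGAMap.tensor_isDGAMap M.isDGAMap
  have hD := M.isDGA.tensor M.isDGA
  obtain ⟨g', hg', hfg, hgf⟩ := (M.isQuasiIso hA).exists_inverse (freeGen hQ) GA M.isDGA A.isDGA
    M.isDGAMap
  have hq : IsQuasiIso (Q.D₂ h) A.d₂ (M.isDGAMap.tensor M.isDGAMap) :=
    isQuasiIso_tensor M.isDGA A.isDGA M.isDGAMap hg' hfg hgf
  have hε : ∀ a, A.counit (f a) = Q.toHah.counit a :=
    counit_comp_of_free (A := Q.toHah) (B := A) (freeGen hQ) M.isDGAMap.mem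
  have augA := A.isAugmentation
  have augQ : IsAugmentation Q.toHah.grading (Q.toHah.d + h) Q.toHah.counit :=
    ⟨Q.toHah.isAugmentation.degree, fun a => by
      rw [← hε, M.isDGAMap.map_d, augA.d]⟩
  have hlow : ∀ p : Q.toHah.carrier →ₐ[R] Q.sq,
      (∀ x, p (Q.gen x) - Q.toHah.psi (Q.gen x) ∈ below Q.res₂ (Q.resDeg x)) →
      ∀ q, ∀ a ∈ Q.res q, p a - Q.toHah.psi a ∈ below Q.res₂ q := fun p hp =>
    sub_mem_below_of_gen Q.gen_free Q.gen_mem_res res₂_mul Q.coproduct_res hp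
  have hcl : ∀ p : Q.toHah.carrier →ₐ[R] Q.sq,
      (∀ x, counitLeft Q.toHah.grading Q.toHah.counit (p (Q.gen x)) = Q.gen x) →
      ∀ a, counitLeft Q.toHah.grading Q.toHah.counit (p a) = a := fun p hp a =>
    congr($(free_hom_ext Q.gen_free (f := augQ.counitLeftHom.comp p) (g := AlgHom.id R _) hp) a)
  have hcr : ∀ p : Q.toHah.carrier →ₐ[R] Q.sq,
      (∀ x, counitRight Q.toHah.grading Q.toHah.counit (p (Q.gen x)) = Q.gen x) →
      ∀ a, counitRight Q.toHah.grading Q.toHah.counit (p a) = a := fun p hp a =>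
    congr($(free_hom_ext Q.gen_free (f := augQ.counitRightHom.comp p) (g := AlgHom.id R _) hp) a)
  -- The lift must equal Δ up to lower terms and be counital. The homotopy must be killed by both
  -- counits, for otherwise the next lifting problem would not be compatible with them.
  let Ok : Q.X → Q.sq → (A.grading ᵍ⊗[R] A.grading) → Prop := fun x b c =>
    b - Q.toHah.psi (Q.gen x) ∈ below Q.res₂ (Q.resDeg x) ∧
    counitLeft Q.toHah.grading Q.toHah.counit b = Q.gen x ∧
    counitRight Q.toHah.grading Q.toHah.counit b = Q.gen x ∧
    counitLeft A.grading A.counit c = 0 ∧ counitRight A.grading A.counit c = 0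
  obtain ⟨p, s, hp, hs, hOk⟩ := (freeGen hQ).exists_lift M.isDGA hD A.isDGA₂ hφ
    (A.psi_isDGAMap.comp M.isDGAMap) Ok (fun x => Q.toHah.psi (Q.gen x))
    (fun x => Q.toHah.psi_isDGAMap.mem _ _ (hQ x))
    (fun x => ⟨by rw [sub_self]; exact Submodule.zero_mem _, Q.toHah.counitLeft_psi _,
      Q.toHah.counitRight_psi _, map_zero _, map_zero _⟩) (by
      intro x p s hp hs hmul hOk hd1 hd2
      obtain ⟨g, hg⟩ : ∃ g, g = Q.gen x := ⟨_, rfl⟩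
      obtain ⟨i, hi⟩ : ∃ i, i = (freeGen hQ).deg x := ⟨_, rfl⟩
      have hgi : g ∈ Q.toHah.grading i := hg ▸ hi ▸ hQ x
      have hgr : g ∈ Q.res (Q.resDeg x) := hg ▸ Q.gen_mem_res x
      have hgv : (freeGen hQ).gen x = g := hg.symm
      simp only [Ok, hgv, ← hg, ← hi] at hd1 hd2 ⊢
      have hpl := hcl p fun y => (hOk y).2.1
      have hpr := hcr p fun y => (hOk y).2.2.1
      have hpp := hlow p fun y => (hOk y).1
      -- Composing the homotopy with the algebra map ε ⊗ 1 gives a twisted derivation, which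
      -- vanishes because it does so on generators.
      have hsl : ∀ a, counitLeft A.grading A.counit (s a) = 0 := fun a =>
        deriv_ext Q.gen_free (F := (augA.counitLeftHom.comp (A.psi.comp f)).comp (sgn _))
          (G := (augA.counitLeftHom.comp (M.isDGAMap.tensor M.isDGAMap)).comp p)
          (D := counitLeft A.grading A.counit ∘ₗ s) (E := 0)
          (fun a b => (congrArg (counitLeft A.grading A.counit) (hmul a b)).trans
            ((map_add _ _ _).trans (congrArg₂ _ (augA.counitLeft_mul _ _)
              (augA.counitLeft_mul _ _))))
          (fun a b => by simp) (fun y => (hOk y).2.2.2.1) a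
      have hsr : ∀ a, counitRight A.grading A.counit (s a) = 0 := fun a =>
        deriv_ext Q.gen_free (F := (augA.counitRightHom.comp (A.psi.comp f)).comp (sgn _))
          (G := (augA.counitRightHom.comp (M.isDGAMap.tensor M.isDGAMap)).comp p)
          (D := counitRight A.grading A.counit ∘ₗ s) (E := 0)
          (fun a b => (congrArg (counitRight A.grading A.counit) (hmul a b)).trans
            ((map_add _ _ _).trans (congrArg₂ _ (augA.counitRight_mul _ _)
              (augA.counitRight_mul _ _))))
          (fun a b => by simp) (fun y => (hOk y).2.2.2.2) a
      have hDg := M.isDGA.mem i g hgi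
      have hD0 : Q.resDeg x = 0 → (Q.toHah.d + h) g = 0 := fun h0 => by
        rw [h0] at hgr
        rw [LinearMap.add_apply, Q.d_res_zero g hgr, mem_below_zero.1 (M.res 0 g hgr), add_zero]
      have hv : A.psi (f g) - s ((Q.toHah.d + h) g) ∈ tensorGrading A.grading A.grading i := by
        refine Submodule.sub_mem _ (A.psi_isDGAMap.mem i _ (M.isDGAMap.mem i g hgi)) ?_
        have := hs _ _ hDg
        rwa [neg_add_cancel_right] at this
      obtain ⟨b, hb, c, hc, hbu, hbv, hlb⟩ := M.exists_lift_step hA hq hgr hgi (hp _ _ hDg) hd1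
        (M.sub_mem_below hpp hgr) hv hd2 (fun h0 => by rw [hD0 h0, map_zero])
        (fun h0 => by rw [hD0 h0, map_zero, sub_zero])
      obtain ⟨k1, k2, k3, k4, k5, k6, k7, k8⟩ := exists_counital augQ M.isDGA augA A.isDGA hε
        (g := g) (Q.toHah.psi_isDGAMap.mem i g hgi) hb hc hbu hbv (Q.toHah.counitLeft_psi g)
        (Q.toHah.counitRight_psi g) (hpl _) (hpr _)
        (by rw [map_sub, hsl, sub_zero, A.counitLeft_psi])
        (by rw [map_sub, hsr, sub_zero, A.counitRight_psi])
      refine ⟨_, k1, _, k2, k3, k4, ?_, k5, k6, k7, k8⟩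
      rw [add_sub_cancel_left]
      -- The counit normalisation preserves the resolution degree, because the augmentation vanishes
      -- in positive resolution degree and the unit has resolution degree zero.
      have hred : ∀ q, ∀ a ∈ Q.res q, reduce Q.toHah.counit a ∈ Q.res q := fun q a ha => by
        rw [reduce_apply]
        by_cases hq0 : q = 0
        · subst hq0
          exact Submodule.sub_mem _ ha (Submodule.smul_mem _ _ SetLike.GradedOne.one_mem)
        · rwa [counit_res hq0 ha, zero_smul, sub_zero]
      refine map_below (fun q t ht => ?_) hlb
      refine (res₂_le (N := (Q.res₂ q).comap (reduce₂ Q.toHah.grading Q.toHah.counit))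
        fun i j hij k l a ha _ b hb _ => ?_) ht
      exact tmul_mem_res₂ hij (hred i a ha) (hred j b hb))
  exact ⟨p, hp, ⟨s, hs⟩, hlow p fun x => (hOk x).1, hcl p fun x => (hOk x).2.1,
    hcr p fun x => (hOk x).2.2.1⟩

end HopfResolution

/-! ### Transport of coassociativity and cocommutativity -/

section Transport

variable {R : Type u} [CommRing R]
variable {E : Type u} [Ring E] [Algebra R E] {ℰ : ℤ → Submodule R E} [GradedAlgebra ℰ]
variable {A : Hah R} {dE : E →ₗ[R] E} {f : E →ₐ[R] A.carrier} {g : A.carrier →ₐ[R] E}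
  {p : E →ₐ[R] (ℰ ᵍ⊗[R] ℰ)}

/-- Coassociativity up to homotopy is reflected by quasi-isomorphisms. -/
theorem FreeGen.coassoc (G : FreeGen ℰ) (hdE : IsDGA ℰ dE) (hf : IsDGAMap ℰ A.grading dE A.d f)
    (hg : IsDGAMap A.grading ℰ A.d dE g)
    (hgf : DerivHomotopic ℰ ℰ dE dE (g.comp f).toLinearMap LinearMap.id)
    (hp : IsDGAMap ℰ (tensorGrading ℰ ℰ) dE (tensorD ℰ ℰ dE dE) p)
    (h : DerivHomotopic ℰ (tensorGrading A.grading A.grading) dE A.d₂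
      (A.psi.comp f).toLinearMap ((hf.tensor hf).comp p).toLinearMap) :
    DerivHomotopic ℰ (tensorGrading ℰ (tensorGrading ℰ ℰ)) dE
      (tensorD ℰ (tensorGrading ℰ ℰ) dE (tensorD ℰ ℰ dE dE))
      (coassocLeft p.toLinearMap) (coassocRight p.toLinearMap) := by
  have hid := IsDGAMap.id (𝒜 := ℰ) (dA := dE)
  have hidA := IsDGAMap.id (𝒜 := A.grading) (dA := A.d)
  have hψ := A.psi_isDGAMap
  have hφ := hf.tensor_isDGAMap hf
  have hφp := hφ.comp hp
  have hψf := hψ.comp hf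
  have ha := assocHom_isDGAMap (𝒜 := A.grading) (ℬ := A.grading) (𝒞 := A.grading)
    (dA := A.d) (dB := A.d) (dC := A.d)
  have haE := assocHom_isDGAMap (𝒜 := ℰ) (ℬ := ℰ) (𝒞 := ℰ) (dA := dE) (dB := dE) (dC := dE)
  have hu := haE.comp ((hp.tensor_isDGAMap hid).comp hp)
  have hv := (hid.tensor_isDGAMap hp).comp hp
  have hF := hf.tensor_isDGAMap hφ
  have hL := ha.comp (hψ.tensor_isDGAMap hidA)
  have hR := hidA.tensor_isDGAMap hψ
  have hd := A.isDGA.tensor A.isDGA₂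
  have h' := G.symm hdE A.isDGA₂ hψf hφp h
  refine G.reflect_tensor₃ hdE hdE hf hg hgf hu hv ?_
  -- Up to reassociation the chain is (f ⊗ f ⊗ f)(p ⊗ 1)p ≃ (ψ ⊗ 1)(f ⊗ f)p ≃ (ψ ⊗ 1)ψf ≃ (1 ⊗ ψ)ψf
  -- ≃ (1 ⊗ ψ)(f ⊗ f)p ≃ (f ⊗ f ⊗ f)(1 ⊗ p)p.
  have e1 := (DerivHomotopic.tensor_right hf hψf.mem h').comp_right hp |>.comp_left ha
  have e2 := h'.comp_left hL
  have e3 := A.isHah.coassoc.comp_right hf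
  have e4 := h.comp_left hR
  have e5 := (DerivHomotopic.tensor_left hf A.isDGA hψf.mem h).comp_right hp
  have t1 := G.trans hdE hd (hF.comp hu) (hL.comp hφp) (hL.comp hψf) (e1.congr (fun a => by
      change tensorAssoc _ _ _ _ = tensorMap f.toLinearMap
        (tensorMap f.toLinearMap f.toLinearMap : _ →ₗ[R] (A.grading ᵍ⊗[R] A.grading))
        (tensorAssoc _ _ _ (tensorMap p.toLinearMap LinearMap.id (p a)))
      rw [← tensorAssoc_tensorMap, tensorMap_comp_apply]
      rfl) fun a => by
        change _ = tensorAssoc _ _ _ (tensorMap A.psi.toLinearMap LinearMap.id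
          (tensorMap f.toLinearMap f.toLinearMap (p a)))
        rw [tensorMap_comp_apply]
        rfl) e2
  have t2 := G.trans hdE hd (hF.comp hu) (hL.comp hψf) (hR.comp hψf) t1 e3
  have t3 := G.trans hdE hd (hF.comp hu) (hR.comp hψf) (hR.comp hφp) t2 e4
  exact G.trans hdE hd (hF.comp hu) (hR.comp hφp) (hF.comp hv) t3 (e5.congr (fun a => by
      change (_ : A.grading ᵍ⊗[R] tensorGrading A.grading A.grading) =
        tensorMap LinearMap.id A.psi.toLinearMap
        (tensorMap f.toLinearMap f.toLinearMap (p a) : A.grading ᵍ⊗[R] A.grading)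
      rw [tensorMap_comp_apply]
      rfl) fun a => by
        change (_ : A.grading ᵍ⊗[R] tensorGrading A.grading A.grading) = tensorMap f.toLinearMap
          (tensorMap f.toLinearMap f.toLinearMap : _ →ₗ[R] (A.grading ᵍ⊗[R] A.grading))
          (tensorMap LinearMap.id p.toLinearMap (p a) : ℰ ᵍ⊗[R] tensorGrading ℰ ℰ)
        rw [tensorMap_comp_apply]
        rfl)

/-- Cocommutativity up to homotopy is reflected by quasi-isomorphisms. -/
theorem FreeGen.cocomm (G : FreeGen ℰ) (hdE : IsDGA ℰ dE) (hf : IsDGAMap ℰ A.grading dE A.d f)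
    (hg : IsDGAMap A.grading ℰ A.d dE g)
    (hgf : DerivHomotopic ℰ ℰ dE dE (g.comp f).toLinearMap LinearMap.id)
    (hp : IsDGAMap ℰ (tensorGrading ℰ ℰ) dE (tensorD ℰ ℰ dE dE) p)
    (h : DerivHomotopic ℰ (tensorGrading A.grading A.grading) dE A.d₂
      (A.psi.comp f).toLinearMap ((hf.tensor hf).comp p).toLinearMap) :
    DerivHomotopic ℰ (tensorGrading ℰ ℰ) dE (tensorD ℰ ℰ dE dE)
      ((GradedTensorProduct.comm ℰ ℰ).toLinearMap ∘ₗ p.toLinearMap) p.toLinearMap := by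
  have hc := comm_isDGAMap A.isDGA A.isDGA
  have hψf := A.psi_isDGAMap.comp hf
  have hφ := hf.tensor_isDGAMap hf
  have hφp := hφ.comp hp
  have hu := (comm_isDGAMap hdE hdE).comp hp
  have hd := A.isDGA₂
  have h' := G.symm hdE hd hψf hφp h
  refine G.reflect_tensor hdE hdE hf hg hgf hu hp ?_
  -- With T the signed flip, the chain is (f ⊗ f)Tp = T(f ⊗ f)p ≃ Tψf ≃ ψf ≃ (f ⊗ f)p.
  have e1 := (h'.comp_left hc).congr (f' := ((hf.tensor hf).comp
    ((GradedTensorProduct.comm ℰ ℰ).toAlgHom.comp p)).toLinearMap)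
    (fun a => comm_tensorMap hf.mem hf.mem (p a)) fun a => rfl
  have e2 := A.isHah.cocomm.comp_right hf
  have t1 := G.trans hdE hd (hφ.comp hu) (hc.comp hψf) hψf e1 e2
  exact G.trans hdE hd (hφ.comp hu) hψf hφp t1 h

end Transport

/-! ### Realization, the action and homotopy types -/

namespace HopfResolution

variable {R : Type u} [CommRing R] {H : GradedHopfAlgebra R} {Q : HopfResolution H}
variable {A : Hah R} {π : LinearMap.ker A.d →ₗ[R] H.carrier}

/-- Every free Hah with homology `H` is weakly equivalent to a perturbation of a Hopf resolution. -/
theorem exists_perturbed_isWeakEquivalence [Module.Flat R H.carrier] (hQ : Q.Positive)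
    (GA : FreeGen A.grading) (hA : IsHomologyIso A H π) :
    ∃ (y : Q.Perturbation) (f : Q.toHah.carrier →ₐ[R] A.carrier),
      IsWeakEquivalence y.perturbed A f ∧ ∀ b ∈ Q.res 0, Represents A π f b := by
  obtain ⟨h, f, h1, h2, h3, h4, h5⟩ := exists_perturbation hQ hA
  have M : IsModel A π h f := ⟨h2, h3, h4, h5⟩
  obtain ⟨p, hp, hfp, hlow, hl, hr⟩ := M.exists_coproduct hQ GA hA
  obtain ⟨g, hg, -, hgf⟩ := (M.isQuasiIso hA).exists_inverse (freeGen hQ) GA h3 A.isDGA h4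
  have hH : IsHah (Q.toHah.d + h) Q.toHah.counit p.toLinearMap :=
    { isDGA := h3
      counit_d := fun a => by
        rw [← counit_comp_of_free (A := Q.toHah) (B := A) (freeGen hQ) h4.mem, h4.map_d,
          A.isHah.counit_d]
      isCoproduct := ⟨Q.toHah.isHah.isCoproduct.counit_degree, hp.mem, map_one p, map_mul p, hl, hr⟩
      coproduct_d := hp.map_d
      coassoc := (freeGen hQ).coassoc h3 h4 hg hgf hp hfp
      cocomm := (freeGen hQ).cocomm h3 h4 hg hgf hp hfp }
  have e : Q.toHah.coproduct + (p.toLinearMap - Q.toHah.coproduct) = p.toLinearMap :=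
    add_sub_cancel _ _
  let y : Q.Perturbation :=
    { h := h
      ν := p.toLinearMap - Q.toHah.coproduct
      h_derivation := h1
      h_res := fun q a ha => by rw [iSup_add_two]; exact h2 q a ha
      ν_mem := fun i a ha =>
        Submodule.sub_mem _ (hp.mem i a ha) (Q.toHah.isHah.isCoproduct.mem i a ha)
      ν_res := hlow
      isHah := e.symm ▸ hH }
  refine ⟨y, f, IsHahMorphism.isWeakEquivalence (isHahMorphism_of_free (A := y.perturbed)
    (freeGen hQ) h4 ?_) (M.isQuasiIso hA), h5⟩
  have h' := (freeGen hQ).symm h3 A.isDGA₂ (A.psi_isDGAMap.comp h4)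
    ((h4.tensor_isDGAMap h4).comp hp) hfp
  refine h'.congr (fun a => ?_) fun a => rfl
  change tensorMap f.toLinearMap f.toLinearMap (p.toLinearMap a) =
    tensorMap f.toLinearMap f.toLinearMap
      ((Q.toHah.coproduct + (p.toLinearMap - Q.toHah.coproduct)) a)
  rw [e]

/-- The identification of the homology of x with H is twisted by α and fed to
`exists_perturbed_isWeakEquivalence`. The resulting weak equivalence from y to x induces the inverse
of α, and a homotopy inverse of it realizes α. -/
theorem exists_realizes [Module.Flat R H.carrier] (hQ : Q.Positive) (α : H.aut)
    (x : Q.Perturbation) :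
    ∃ y : Q.Perturbation, Realizes (α : H.carrier ≃ₐ[R] H.carrier) x y := by
  obtain ⟨y, f, hf, hrep⟩ := exists_perturbed_isWeakEquivalence (A := x.perturbed) hQ (freeGen hQ)
    (x.isHomologyIso.comp_aut α)
  refine ⟨y, Realizes.symm (α := (α : H.carrier ≃ₐ[R] H.carrier).symm) hQ ⟨f, hf, fun a ha => ?_⟩
    fun a => (α : H.carrier ≃ₐ[R] H.carrier).apply_symm_apply a⟩
  obtain ⟨z, hz, hz'⟩ := hrep a ha
  have := x.isClass_π z
  rw [hz] at this
  rw [← hz']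
  change x.IsClass (f a) ((α : H.carrier ≃ₐ[R] H.carrier).symm
    ((α : H.carrier ≃ₐ[R] H.carrier) (x.π z)))
  rwa [AlgEquiv.symm_apply_apply]

theorem realizes_congr (hQ : Q.Positive) {α : H.carrier → H.carrier} {x x' y y' : Q.Perturbation}
    (hx : x.toD = x'.toD) (hy : y.toD = y'.toD) (h : Realizes α x y) : Realizes α x' y' :=
  ((toD_eq_iff hQ).1 hy).comp hQ (h.comp hQ ((toD_eq_iff hQ).1 hx.symm))

theorem toD_eq_of_realizes (hQ : Q.Positive) {α β : H.carrier → H.carrier}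
    {x y y' : Q.Perturbation} (hβα : ∀ a, β (α a) = a) (hαβ : ∀ a, α (β a) = a)
    (h : Realizes α x y) (h' : Realizes α x y') : y.toD = y'.toD := by
  have := h'.comp hQ (h.symm hQ hβα)
  rw [show α ∘ β = id from funext hαβ] at this
  exact (toD_eq_iff hQ).2 this

/-- The action of `Aut H` on `D_H`. -/
theorem exists_mulAction [Module.Flat R H.carrier] (hQ : Q.Positive) :
    ∃ _ : MulAction H.aut Q.D, ∀ (α : H.aut) (x y : Q.Perturbation),
      α • x.toD = y.toD ↔ Realizes (α : H.carrier ≃ₐ[R] H.carrier) x y := by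
  have hrep : ∀ t : Q.D, ∃ x : Q.Perturbation, x.toD = t := fun t => Quot.exists_rep t
  choose rep hrep using hrep
  choose act hact using fun (α : H.aut) (x : Q.Perturbation) => exists_realizes hQ α x
  -- The action is defined by choices; this shows that they do not matter, and reduces the axioms to
  -- `Realizes.refl` and `Realizes.comp`.
  have key : ∀ (α : H.aut) (x y : Q.Perturbation),
      (act α (rep x.toD)).toD = y.toD ↔ Realizes (α : H.carrier ≃ₐ[R] H.carrier) x y := by
    intro α x y
    have h1 := realizes_congr hQ (hrep x.toD) rfl (hact α (rep x.toD))
    constructor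
    · exact fun h => realizes_congr hQ rfl h h1
    · exact fun h => toD_eq_of_realizes hQ (α : H.carrier ≃ₐ[R] H.carrier).symm_apply_apply
        (α : H.carrier ≃ₐ[R] H.carrier).apply_symm_apply h1 h
  refine ⟨{ smul := fun α t => (act α (rep t)).toD, one_smul := fun t => ?_,
            mul_smul := fun α β t => ?_ }, key⟩
  on_goal 2 => obtain ⟨x, rfl⟩ := Quot.exists_rep t; exact (key 1 x x).2 (Realizes.refl hQ x)
  obtain ⟨x, rfl⟩ := Quot.exists_rep t
  have h1 : Realizes (β : H.carrier ≃ₐ[R] H.carrier) x (act β (rep x.toD)) := (key β x _).1 rfl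
  have h2 : Realizes (α : H.carrier ≃ₐ[R] H.carrier) (act β (rep x.toD))
    (act α (rep (act β (rep x.toD)).toD)) := (key α _ _).1 rfl
  exact (key (α * β) x _).2 (h2.comp hQ h1)

/-- Weak equivalences between free Hah's have homotopy inverses which are again weak equivalences,
so any zigzag collapses to one map. -/
theorem exists_isWeakEquivalence_of_homotopyType_eq {r n : ℕ} (hr : 1 ≤ r) {A B : HAH R r n}
    (h : (Quot.mk _ A : HomotopyType R r n) = Quot.mk _ B) :
    ∃ f : A.1.carrier →ₐ[R] B.1.carrier, IsWeakEquivalence A.1 B.1 f := by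
  have G : ∀ A : HAH R r n, FreeGen A.1.grading := fun A => (A.2.freeGen hr).some
  have key : Relation.EqvGen WeaklyEquivalent A B := Quot.eqvGen_exact h
  clear h
  induction key with
  | rel A B h =>
    obtain ⟨C, f, g, hf, hg⟩ := h
    obtain ⟨f', hf', -⟩ := hf.exists_inverse (G C) (G A)
    exact ⟨_, hg.comp (G A) hf'⟩
  | refl A => exact ⟨_, IsWeakEquivalence.id (G A)⟩
  | symm A B _ ih =>
    obtain ⟨f, hf⟩ := ih
    obtain ⟨f', hf', -⟩ := hf.exists_inverse (G A) (G B)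
    exact ⟨f', hf'⟩
  | trans A B C _ _ h1 h2 =>
    obtain ⟨f, hf⟩ := h1
    obtain ⟨g, hg⟩ := h2
    exact ⟨_, hg.comp (G A) hf⟩

theorem Realizes.homotopyType_eq {r n : ℕ} {α : H.carrier → H.carrier} (hQ : Q.Positive)
    (hQ' : HasGeneratorsInRange Q.toHah.grading r n) {x y : Q.Perturbation}
    (h : Realizes α x y) :
    (Quot.mk _ (x.toHAH hQ') : HomotopyType R r n) = Quot.mk _ (y.toHAH hQ') := by
  obtain ⟨k, hk, -⟩ := h
  exact Quot.sound ⟨x.toHAH hQ', AlgHom.id R _, k,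
    IsWeakEquivalence.id (A := x.perturbed) (freeGen hQ), hk⟩

end HopfResolution

end

end HopfHomotopy

/-! ### The action and the classification -/

theorem corollary5p1 {R : Type u} [CommRing R]
    (H : HopfHomotopy.GradedHopfAlgebra R) [Module.Flat R H.carrier]
    (r n : ℕ) (hr : 1 ≤ r)
    (Q : HopfHomotopy.HopfResolution H)
    (hQ : HopfHomotopy.HasGeneratorsInRange Q.toHah.grading r n) :
    ∃ _ : MulAction H.aut Q.D,
      (∀ (α : H.aut) (x y : Q.Perturbation),
        α • x.toD = y.toD ↔
          HopfHomotopy.HopfResolution.Realizes (α : H.carrier ≃ₐ[R] H.carrier) x y) ∧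
      ∃ e : MulAction.orbitRel.Quotient H.aut Q.D ≃
          HopfHomotopy.HomotopyTypesWithHomology r n H,
        ∀ x : Q.Perturbation,
          (e (Quotient.mk _ x.toD) : HopfHomotopy.HomotopyType R r n) =
            Quot.mk _ (x.toHAH hQ) := by
  have hP : Q.Positive := Q.positive_of_hasGeneratorsInRange hr hQ
  obtain ⟨inst, hact⟩ := HopfHomotopy.HopfResolution.exists_mulAction hP
  refine ⟨inst, hact, ?_⟩
  have horbit : ∀ x y : Q.Perturbation,
      (Quotient.mk _ x.toD : MulAction.orbitRel.Quotient H.aut Q.D) = Quotient.mk _ y.toD ↔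
        ∃ α : H.aut,
          HopfHomotopy.HopfResolution.Realizes (α : H.carrier ≃ₐ[R] H.carrier) y x := by
    intro x y
    rw [Quotient.eq, MulAction.orbitRel_apply, MulAction.mem_orbit_iff]
    exact exists_congr fun α => hact α y x
  let F : Q.Perturbation → HopfHomotopy.HomotopyTypesWithHomology r n H := fun x =>
    ⟨Quot.mk _ (x.toHAH hQ), x.toHAH hQ, rfl,
      HopfHomotopy.hasHomology_iff.2 ⟨x.π, x.isHomologyIso⟩⟩
  have hF : ∀ (α : H.aut) (x y : Q.Perturbation),
      HopfHomotopy.HopfResolution.Realizes (α : H.carrier ≃ₐ[R] H.carrier) x y → F x = F y :=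
    fun α x y h => Subtype.ext (h.homotopyType_eq hP hQ)
  choose rep hrep using fun t : MulAction.orbitRel.Quotient H.aut Q.D =>
    show ∃ x : Q.Perturbation, Quotient.mk _ x.toD = t by
      obtain ⟨s, rfl⟩ := Quotient.exists_rep t
      obtain ⟨x, rfl⟩ := Quot.exists_rep s
      exact ⟨x, rfl⟩
  have hFrep : ∀ x : Q.Perturbation, F (rep (Quotient.mk _ x.toD)) = F x := fun x => by
    obtain ⟨α, hα⟩ := (horbit _ x).1 (hrep (Quotient.mk _ x.toD))
    exact (hF α _ _ hα).symm
  have hbij : Function.Bijective fun t => F (rep t) := by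
    constructor
    -- Equal homotopy types give a single weak equivalence between representatives. It induces an
    -- automorphism of H, so the classes lie in the same orbit.
    · intro s t hst
      obtain ⟨f, hf⟩ := HopfHomotopy.HopfResolution.exists_isWeakEquivalence_of_homotopyType_eq hr
        (Subtype.ext_iff.1 hst)
      obtain ⟨α, hα⟩ :=
        HopfHomotopy.HopfResolution.exists_realizes_of_isWeakEquivalence (x := rep s) hf
      rw [← hrep s, ← hrep t]
      exact ((horbit _ _).2 ⟨α, hα⟩).symm
    -- Any A in the given class is free with homology H, so it receives a weak equivalence from a
    -- perturbed resolution; together with the identity this is a zigzag in the category.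
    · rintro ⟨_, A, rfl, hA⟩
      obtain ⟨π, hπ⟩ := HopfHomotopy.hasHomology_iff.1 hA
      obtain ⟨G⟩ := A.2.freeGen hr
      obtain ⟨y, f, hf, -⟩ :=
        HopfHomotopy.HopfResolution.exists_perturbed_isWeakEquivalence hP G hπ
      refine ⟨Quotient.mk _ y.toD, (hFrep y).trans (Subtype.ext (Quot.sound ?_))⟩
      exact ⟨y.toHAH hQ, AlgHom.id R _, f, HopfHomotopy.IsWeakEquivalence.id (A := y.perturbed)
        (HopfHomotopy.HopfResolution.freeGen hP), hf⟩
  exact ⟨Equiv.ofBijective _ hbij, fun x => Subtype.ext_iff.1 (hFrep x)⟩
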